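/- **Setting.** Let $A_1,\dots,A_d$ be nonzero symmetric positive semidefinite $n\times n$ matrices, $\mathcal S=\{X\succeq0:\operatorname{Tr}X=1\}$, $\mathcal B(X)=(\langle A_i,X\rangle)_{i\le d}$, and consider $$\min_{X\in\mathcal S} F(X),\qquad F(X)=-\sum_{i=1}^d\log\langle A_i,X\rangle .$$ A point is feasible if $X\in\mathcal S$ and all $\langle A_i,X\rangle>0$; it is $\varepsilon$-optimal if it is feasible and $F(X)\le F(Y)+\varepsilon$ for every feasible $Y$. Let $\varepsilon>0$, put $\eta=2\varepsilon/5$ and assume $\eta\le d$; let $l\ge1$, $0<p<1$, $c>2$. **Oracle (power method).** Given a feasible $X$ and $\delta>0$, let $J=\sum_i A_i/\langle A_i,X\rangle$ and $\tau=\min\{\delta,(c-2)d\}/(cd)$. Starting from a standard Gaussian vector $g$, perform $\lceil\log(n/p^2)/(2\tau)\rceil$ steps $x\mapsto Jx/\|Jx\|$ to get $u$ (with $0/0=0$). Let $G=\langle J,uu^T-X\rangle$. Return $(H,G)$ with $H=uu^T$ if $G\ge0$, and $(X,0)$ otherwise. **Method.** Start with $X^0=I/n$, $\mathrm{count}=0$.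 While $\mathrm{count}<l$: choose $\delta_t$; call the oracle at $(X^t,\delta_t)$ with a fresh $g^t$ to get $(H^t,G_t)$ and $u^t$; increase $\mathrm{count}$ by one if $G_t\le\eta$ and $\delta_t\le 3\eta/2$; put $D_t=\big(\sum_i(\langle A_i,H^t-X^t\rangle/\langle A_i,X^t\rangle)^2\big)^{1/2}$, $\gamma_t=\min\{G_t/(D_t(D_t+G_t)),1\}$ (with $0/0=0$), $X^{t+1}=(1-\gamma_t)X^t+\gamma_tH^t$. The final iterate is $\widehat X$. The $\delta_t$ come from a rule that is either scheduled ($\delta_t$ is a fixed positive sequence that is eventually at most $\eta/2$, e.g. one converging to $0$) or adaptive ($\delta_t$ is a measurable function of $t$ and of $\min_{s<t}G_s$ with $0<\delta_t\le\eta/2+\min_{s<t}G_s$, only $\delta_0>0$ being required at $t=0$). **Gaussian representation.** With $z^0\sim N(0,I/n)$ and i.i.d. $\zeta_t\sim N(0,1)$, all independent of $(g^t)_t$, let $z^{t+1}=\sqrt{1-\gamma_t}\,z^t+\sqrt{\gamma_t}\,\zeta_tu^t$; the output $\widehat z$ is the final $z^t$. **Machine model.** Real random-access machine with exact arithmetic,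 $\sqrt{\ }$ and $\log$; read-only input (the entries of the $A_i$, the parameters, and the rule for $\delta_t$); two one-way tapes of i.i.d. $N(0,1)$ numbers, one for the $g^t$ and one for $z^0,\zeta_0,\zeta_1,\dots$. Memory is the number of cells (integers or reals) of working memory. **Proposition.** There are one program and one absolute constant $C$ such that the following holds for all $n,d,\varepsilon,l$ and all rules for $\delta_t$ as above. There is $K$, depending only on $n,d,\varepsilon,l$ and the rule, such that for all $A_1,\dots,A_d$, $p$ and $c$ as above: 1. The power method is a valid oracle: at every feasible $X$ and for every $\delta>0$ it always returns $H\in\mathcal S$ and $G=\langle J,H-X\rangle\ge0$, and with probability at least $1-p$ it holds that $G>d$ or $\langle -J,H\rangle\le\min_{Y\in\mathcal S}\langle -J,Y\rangle+\delta$. 2. For every outcome of $(g^t)_t$ the method stops after at most $K$ iterations and $\widehat X$ is feasible. 3. On all tapes the program halts, outputs exactly $\widehat z$, and uses at most $C(n+d)$ cells of memory in addition to the input. 4. For every fixed outcome of $(g^t)_t$, $\widehat z\sim N(0,\widehat X)$; that is, given the randomness of the power method, $\widehat z$ is a zero-mean Gaussian vector with covariance $\widehat X$. 5. With probability at least $1-\binom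 Kl p^l$, $\widehat X$ is $\varepsilon$-optimal. In particular, this probability is at least $1-q^l$ whenever $Kp\le q$. -/

import Mathlib

open MeasureTheory ProbabilityTheory Filter Topology

noncomputable section

namespace GMeanSDP

/-! ## The semidefinite program `min { -∑ i, log ⟨A i, X⟩ : X ⪰ 0, Tr X = 1 }` -/

/-- The trace inner product `⟨M, N⟩ = Tr (Mᵀ N)`. -/
def frob {n : ℕ} (M N : Matrix (Fin n) (Fin n) ℝ) : ℝ := (M.transpose * N).trace

/-- The feasible set `𝒮` of positive semidefinite matrices of trace one. -/
def spectraplex (n : ℕ) : Set (Matrix (Fin n) (Fin n) ℝ) := {X | X.PosSemidef ∧ X.trace = 1}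

/-- The linear map `ℬ`, with coordinates `⟨A i, X⟩`. -/
def meas {n d : ℕ} (A : Fin d → Matrix (Fin n) (Fin n) ℝ) (X : Matrix (Fin n) (Fin n) ℝ)
    (i : Fin d) : ℝ := frob (A i) X

/-- Points of `𝒮` at which the objective is finite. -/
def IsFeasible {n d : ℕ} (A : Fin d → Matrix (Fin n) (Fin n) ℝ)
    (X : Matrix (Fin n) (Fin n) ℝ) : Prop := X ∈ spectraplex n ∧ ∀ i, 0 < meas A X i

/-- The objective `-∑ i, log ⟨A i, X⟩` (meaningful at feasible points). -/
def objective {n d : ℕ} (A : Fin d → Matrix (Fin n) (Fin n) ℝ)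
    (X : Matrix (Fin n) (Fin n) ℝ) : ℝ := -∑ i, Real.log (meas A X i)

/-- `X` is feasible and its objective value is within `ε` of that of every feasible point. -/
def IsEpsOptimal {n d : ℕ} (A : Fin d → Matrix (Fin n) (Fin n) ℝ) (ε : ℝ)
    (X : Matrix (Fin n) (Fin n) ℝ) : Prop :=
  IsFeasible A X ∧ ∀ Y, IsFeasible A Y → objective A X ≤ objective A Y + ε

/-- The gradient `ℬ*(∇f(ℬ X)) = -∑ i, A i / ⟨A i, X⟩` of the objective at `X`. -/
def gradB {n d : ℕ} (A : Fin d → Matrix (Fin n) (Fin n) ℝ)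
    (X : Matrix (Fin n) (Fin n) ℝ) : Matrix (Fin n) (Fin n) ℝ :=
  -∑ i, (meas A X i)⁻¹ • A i

/-- The linearised objective `H ↦ ⟨ℬ*(∇f(ℬ X)), H⟩` (the indicator of `𝒮` vanishes on `𝒮`). -/
def linObj {n d : ℕ} (A : Fin d → Matrix (Fin n) (Fin n) ℝ)
    (X H : Matrix (Fin n) (Fin n) ℝ) : ℝ := frob (gradB A X) H

/-- The approximate Frank-Wolfe duality gap. -/
def approxGap {n d : ℕ} (A : Fin d → Matrix (Fin n) (Fin n) ℝ)
    (X H : Matrix (Fin n) (Fin n) ℝ) : ℝ := linObj A X X - linObj A X H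

/-- The distance `D = ‖ℬ (H - X)‖_{ℬ X}`, in the local norm given by the Hessian
`diag (1 / v i ^ 2)` of `v ↦ -∑ i, log (v i)` at `v = ℬ X`. -/
def localDist {n d : ℕ} (A : Fin d → Matrix (Fin n) (Fin n) ℝ)
    (X H : Matrix (Fin n) (Fin n) ℝ) : ℝ :=
  √(∑ i, (meas A (H - X) i / meas A X i) ^ 2)

/-- `δ`-suboptimality of `H` for the linear subproblem at `X`. -/
def IsSubopt {n d : ℕ} (A : Fin d → Matrix (Fin n) (Fin n) ℝ) (δ : ℝ)
    (X H : Matrix (Fin n) (Fin n) ℝ) : Prop :=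
  ∀ Y ∈ spectraplex n, linObj A X H ≤ linObj A X Y + δ

/-! ## The data of the method, and the two strategies for `δ_t` -/

/-- Everything that the method is given: the matrices, the stopping tolerance, the failure
parameter `p` and the constant `c` of the oracle, the number `l` of times that the stopping
test has to be passed, and the rule which yields `δ_t` from `t` and from the smallest
approximate gap `min_{τ < t} G_τ` seen so far (at `t = 0` the rule is given `0` instead). -/
structure Input (n d : ℕ) where
  A : Fin d → Matrix (Fin n) (Fin n) ℝ
  tol : ℝ
  p : ℝ
  c : ℝ
  l : ℕ
  rule : ℕ → ℝ → ℝ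

/-- Scheduled strategy: a fixed positive sequence which is eventually at most `tol / 2`
(for instance one that converges to zero, or the constant `tol / 2`). -/
def IsScheduled (tol : ℝ) (rule : ℕ → ℝ → ℝ) : Prop :=
  ∃ s : ℕ → ℝ, (∀ t, 0 < s t) ∧ (∀ᶠ t in atTop, s t ≤ tol / 2) ∧ ∀ t m, rule t m = s t

/-- Adaptive strategy: `0 < δ_t ≤ tol / 2 + min_{τ < t} G_τ`; at `t = 0` the minimum is over the
empty set, and only positivity is required. -/
def IsAdaptive (tol : ℝ) (rule : ℕ → ℝ → ℝ) : Prop :=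
  (∀ t, Measurable (rule t)) ∧ (∀ t m, 0 ≤ m → 0 < rule t m) ∧
    ∀ t m, 1 ≤ t → 0 ≤ m → rule t m ≤ tol / 2 + m

/-! ## The oracle, implemented by the power method -/

/-- One normalised step of the power method for `M`. -/
def powerStep {n : ℕ} (M : Matrix (Fin n) (Fin n) ℝ) (x : Fin n → ℝ) : Fin n → ℝ :=
  (√(M.mulVec x ⬝ᵥ M.mulVec x))⁻¹ • M.mulVec x

/-- The prescribed relative error `τ = min {δ, (c - 2) θ} / (c θ)`, where `θ = d`. -/
def relErr (d : ℕ) (c δ : ℝ) : ℝ := min δ ((c - 2) * d) / (c * d)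

/-- The number `⌈log (n / p²) / (2 τ)⌉` of iterations of the power method. -/
def powerCount (n d : ℕ) (p c δ : ℝ) : ℕ := ⌈Real.log (n / p ^ 2) / (2 * relErr d c δ)⌉₊

/-- The vector `u` that the power method returns for `J = -ℬ*(∇f(ℬ X))`, started at `g`. -/
def powerVec {n d : ℕ} (I : Input n d) (X : Matrix (Fin n) (Fin n) ℝ) (δ : ℝ)
    (g : Fin n → ℝ) : Fin n → ℝ :=
  (powerStep (-gradB I.A X))^[powerCount n d I.p I.c δ] g

/-- The oracle: the pair `(u uᵀ, G)` if its gap `G` is nonnegative, and `(X, 0)` otherwise. -/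
def plmo {n d : ℕ} (I : Input n d) (X : Matrix (Fin n) (Fin n) ℝ) (δ : ℝ)
    (g : Fin n → ℝ) : Matrix (Fin n) (Fin n) ℝ × ℝ :=
  let H := Matrix.vecMulVec (powerVec I X δ g) (powerVec I X δ g)
  if approxGap I.A X H < 0 then (X, 0) else (H, approxGap I.A X H)

/-- The law of the start vector: a standard Gaussian vector, so that its direction is uniform
on the sphere (the power method depends on the direction only). -/
def startLaw (n : ℕ) : Measure (Fin n → ℝ) := Measure.pi fun _ => gaussianReal 0 1

/-- A randomised oracle (with randomness `g`) is a `PLMO` with failure probability `p`: it returns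
a point of `𝒮` and its approximate gap, which is nonnegative, and with probability at least
`1 - p` the gap exceeds `θ + R_g = d` or the point is `δ`-suboptimal. -/
def IsPLMO {n d : ℕ} (A : Fin d → Matrix (Fin n) (Fin n) ℝ) (p : ℝ)
    (oracle : Matrix (Fin n) (Fin n) ℝ → ℝ → (Fin n → ℝ) → Matrix (Fin n) (Fin n) ℝ × ℝ) :
    Prop :=
  ∀ X, IsFeasible A X → ∀ δ : ℝ, 0 < δ →
    (∀ g, (oracle X δ g).1 ∈ spectraplex n ∧
      (oracle X δ g).2 = approxGap A X (oracle X δ g).1 ∧ 0 ≤ (oracle X δ g).2) ∧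
    ENNReal.ofReal (1 - p) ≤
      startLaw n {g | (d : ℝ) < (oracle X δ g).2 ∨ IsSubopt A δ X (oracle X δ g).1}

/-! ## The approximate generalised Frank-Wolfe method with this oracle

The randomness consists of two sequences of reals: `ρ` supplies the start vectors of the power
method and `ξ` the Gaussian representation. -/

/-- The start vector of the power method in iteration `t`. -/
def startVec (n : ℕ) (ρ : ℕ → ℝ) (t : ℕ) : Fin n → ℝ := fun j => ρ (t * n + j)

/-- The state before an iteration: the iterate `X^t`, the smallest approximate gap so far (`0` if
there is none yet), and the number of times that the stopping test was passed. -/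
structure Iterate (n : ℕ) where
  X : Matrix (Fin n) (Fin n) ℝ
  best : ℝ
  count : ℕ

/-- `δ_t`. -/
def Iterate.delta {n d : ℕ} (I : Input n d) (t : ℕ) (s : Iterate n) : ℝ := I.rule t s.best

/-- The step size `γ_t = min {G / (D (D + G)), 1}`; it is `0` if the oracle returned `(X^t, 0)`,
where `G = D = 0`. -/
def Iterate.stepSize {n d : ℕ} (I : Input n d) (t : ℕ) (s : Iterate n) (g : Fin n → ℝ) : ℝ :=
  let o := plmo I s.X (s.delta I t) g
  min (o.2 / (localDist I.A s.X o.1 * (localDist I.A s.X o.1 + o.2))) 1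

/-- One pass through the loop. -/
def Iterate.next {n d : ℕ} (I : Input n d) (t : ℕ) (s : Iterate n) (g : Fin n → ℝ) :
    Iterate n :=
  let o := plmo I s.X (s.delta I t) g
  { X := (1 - s.stepSize I t g) • s.X + s.stepSize I t g • o.1
    best := if t = 0 then o.2 else min s.best o.2
    count := if o.2 ≤ I.tol ∧ s.delta I t ≤ 3 * I.tol / 2 then s.count + 1 else s.count }

/-- The states of the method, from `X^0 = I / n`. -/
def states {n d : ℕ} (I : Input n d) (ρ : ℕ → ℝ) : ℕ → Iterate n
  | 0 => ⟨(n : ℝ)⁻¹ • (1 : Matrix (Fin n) (Fin n) ℝ), 0, 0⟩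
  | t + 1 => (states I ρ t).next I t (startVec n ρ t)

/-- The method stops before iteration `t` if the stopping test was passed `l` times. -/
def Stopped {n d : ℕ} (I : Input n d) (ρ : ℕ → ℝ) (t : ℕ) : Prop := I.l ≤ (states I ρ t).count

/-- The number of iterations that are performed. -/
def stopTime {n d : ℕ} (I : Input n d) (ρ : ℕ → ℝ) : ℕ := sInf {t | Stopped I ρ t}

/-- The final iterate `X̂`. -/
def finalX {n d : ℕ} (I : Input n d) (ρ : ℕ → ℝ) : Matrix (Fin n) (Fin n) ℝ :=
  (states I ρ (stopTime I ρ)).X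

/-- The Gaussian representation of the iterates: `z^0 ∼ N(0, I / n)` and
`z^{t+1} = √(1 - γ_t) z^t + √γ_t ζ_t u^t` (if the oracle returned `(X^t, 0)`, then `γ_t = 0`). -/
def gaussIter {n d : ℕ} (I : Input n d) (ρ ξ : ℕ → ℝ) : ℕ → Fin n → ℝ
  | 0 => fun j => ξ j / √n
  | t + 1 =>
    let s := states I ρ t
    let γ := s.stepSize I t (startVec n ρ t)
    √(1 - γ) • gaussIter I ρ ξ t +
      (√γ * ξ (n + t)) • powerVec I s.X (s.delta I t) (startVec n ρ t)

/-- The final Gaussian vector `ẑ`. -/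
def finalZ {n d : ℕ} (I : Input n d) (ρ ξ : ℕ → ℝ) : Fin n → ℝ :=
  gaussIter I ρ ξ (stopTime I ρ)

/-- The law of a sequence of independent standard Gaussian reals. -/
def stdStream : Measure (ℕ → ℝ) := Measure.infinitePi fun _ : ℕ => gaussianReal 0 1

/-! ## Programs, and the memory that they use

A real random-access machine with read-only input. Its working memory has a bank of integer
cells (for counters and addresses) and a bank of real cells, both initially zero; only a cell
inside the allotted memory can be written. Real cells are addressed indirectly. There are two
one-way tapes of random reals. -/

/-- Integer expressions. -/
inductive NExp where
  | const (k : ℕ)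
  | cell (r : ℕ)
  | dimN
  | dimD
  | target
  | add (a b : NExp)
  | mul (a b : NExp)

/-- Real expressions: working memory, read-only input (entries of the matrices, the numerical
parameters, the rule for `δ_t`), and arithmetic. -/
inductive RExp where
  | cell (a : NExp)
  | ofNat (a : NExp)
  | entry (i j k : NExp)
  | tol
  | failProb
  | constC
  | rule (t : NExp) (m : RExp)
  | add (x y : RExp)
  | sub (x y : RExp)
  | mul (x y : RExp)
  | div (x y : RExp)
  | sqrt (x : RExp)
  | log (x : RExp)

/-- Commands: assignments to an integer cell and to a real cell, drawing the next number from a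
tape into a real cell, composition, a branch on `x ≤ y`, and a loop that runs while `x < y`. -/
inductive Cmd where
  | setN (r : ℕ) (e : NExp)
  | setR (a : NExp) (e : RExp)
  | draw (tape : Bool) (a : NExp)
  | seq (c₁ c₂ : Cmd)
  | ifLE (x y : RExp) (c₁ c₂ : Cmd)
  | whileLT (x y : RExp) (c : Cmd)

/-- A configuration: the integer cells, the real cells, and the positions on the tapes. -/
structure Config where
  ints : ℕ → ℕ
  reals : ℕ → ℝ
  heads : Bool → ℕ

def NExp.eval {n d : ℕ} (I : Input n d) (s : Config) : NExp → ℕ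
  | .const k => k
  | .cell r => s.ints r
  | .dimN => n
  | .dimD => d
  | .target => I.l
  | .add a b => a.eval I s + b.eval I s
  | .mul a b => a.eval I s * b.eval I s

/-- The entry `(j, k)` of the `i`-th input matrix (zero outside the range). -/
def Input.entry {n d : ℕ} (I : Input n d) (i j k : ℕ) : ℝ :=
  if h : i < d ∧ j < n ∧ k < n then I.A ⟨i, h.1⟩ ⟨j, h.2.1⟩ ⟨k, h.2.2⟩ else 0

def RExp.eval {n d : ℕ} (I : Input n d) (s : Config) : RExp → ℝ
  | .cell a => s.reals (a.eval I s)
  | .ofNat a => (a.eval I s : ℝ)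
  | .entry i j k => I.entry (i.eval I s) (j.eval I s) (k.eval I s)
  | .tol => I.tol
  | .failProb => I.p
  | .constC => I.c
  | .rule t m => I.rule (t.eval I s) (m.eval I s)
  | .add x y => x.eval I s + y.eval I s
  | .sub x y => x.eval I s - y.eval I s
  | .mul x y => x.eval I s * y.eval I s
  | .div x y => x.eval I s / y.eval I s
  | .sqrt x => √(x.eval I s)
  | .log x => Real.log (x.eval I s)

/-- `Exec I tape M₁ M₂ c s s'`: on the input `I` and the given tapes, the command `c` started in
`s` terminates in `s'`, writing only to the first `M₁` integer cells and the first `M₂` real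
cells. -/
inductive Exec {n d : ℕ} (I : Input n d) (tape : Bool → ℕ → ℝ) (M₁ M₂ : ℕ) :
    Cmd → Config → Config → Prop where
  | setN (r : ℕ) (e : NExp) (s : Config) (h : r < M₁) :
      Exec I tape M₁ M₂ (.setN r e) s { s with ints := Function.update s.ints r (e.eval I s) }
  | setR (a : NExp) (e : RExp) (s : Config) (h : a.eval I s < M₂) :
      Exec I tape M₁ M₂ (.setR a e) s
        { s with reals := Function.update s.reals (a.eval I s) (e.eval I s) }
  | draw (b : Bool) (a : NExp) (s : Config) (h : a.eval I s < M₂) :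
      Exec I tape M₁ M₂ (.draw b a) s
        { s with
          reals := Function.update s.reals (a.eval I s) (tape b (s.heads b))
          heads := Function.update s.heads b (s.heads b + 1) }
  | seq (c₁ c₂ : Cmd) (s s' s'' : Config) (h₁ : Exec I tape M₁ M₂ c₁ s s')
      (h₂ : Exec I tape M₁ M₂ c₂ s' s'') : Exec I tape M₁ M₂ (.seq c₁ c₂) s s''
  | ifTrue (x y : RExp) (c₁ c₂ : Cmd) (s s' : Config) (h : x.eval I s ≤ y.eval I s)
      (h₁ : Exec I tape M₁ M₂ c₁ s s') : Exec I tape M₁ M₂ (.ifLE x y c₁ c₂) s s'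
  | ifFalse (x y : RExp) (c₁ c₂ : Cmd) (s s' : Config) (h : ¬ x.eval I s ≤ y.eval I s)
      (h₂ : Exec I tape M₁ M₂ c₂ s s') : Exec I tape M₁ M₂ (.ifLE x y c₁ c₂) s s'
  | whileStop (x y : RExp) (c : Cmd) (s : Config) (h : ¬ x.eval I s < y.eval I s) :
      Exec I tape M₁ M₂ (.whileLT x y c) s s
  | whileStep (x y : RExp) (c : Cmd) (s s' s'' : Config) (h : x.eval I s < y.eval I s)
      (h₁ : Exec I tape M₁ M₂ c s s') (h₂ : Exec I tape M₁ M₂ (.whileLT x y c) s' s'') :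
      Exec I tape M₁ M₂ (.whileLT x y c) s s''

/-- On the input `I`, with the tapes `ρ` and `ξ`, the program halts, uses at most `M` cells of
working memory, and leaves the vector `out` in the first `n` real cells. -/
def OutputsWithin {n d : ℕ} (prog : Cmd) (I : Input n d) (ρ ξ : ℕ → ℝ) (M : ℕ)
    (out : Fin n → ℝ) : Prop :=
  ∃ M₁ M₂ : ℕ, M₁ + M₂ ≤ M ∧ ∃ s' : Config,
    Exec I (fun b => cond b ξ ρ) M₁ M₂ prog ⟨fun _ => 0, fun _ => 0, fun _ => 0⟩ s' ∧
      ∀ j : Fin n, s'.reals j = out j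

end GMeanSDP

end

/-! Convergence. For a step from `X` towards `H` put `r i = ⟨A i, H⟩ / ⟨A i, X⟩ - 1`. Then `∑ r i =
G`, the Euclidean norm of `r` is `D`, and a step of length `γ` changes the objective by exactly `-∑
log (1 + γ r i)`. A second-order lower bound on the logarithm turns the damped step size into a
decrease of at least `γ G / 2` (`sum_log_one_add_ge`). The ratios `r i + 1` are nonnegative with sum
`G + d`, so `D ≤ G + d`, and a gap above `η` forces a decrease of at least `progress d η / 2`
(`damped_step_ge`). As `I / n` is within `d log n` of the optimum, the number of such iterations is
bounded independently of the matrices. The rule for `δ_t` lets only boundedly many small gaps fail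
the stopping test, which gives the uniform iteration bound `K`.

Optimality. If the test is passed in an iteration in which the oracle kept its guarantee, the exact
Frank-Wolfe gap is at most `G + δ ≤ 5 η / 2 = ε`, and the objective never increases afterwards. A
bad output thus requires `l` failed oracle calls among the first `K`. Given the past, each call
fails with probability at most `p`, so `l` prescribed calls all fail with probability at most `p ^
l`; a union bound over the `l`-subsets finishes (`stdStream_forall_fails_le`,
`isEpsOptimal_probability`).

Power method. In an eigenbasis of `J` the start vector is again standard Gaussian. A tangent
inequality bounds the damage done by all smaller eigenvalues without any spectral gap
(`power_method_rayleigh`), provided that the leading coefficient is not too small; a small-ball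
estimate bounds the probability of the exception by `p`.

Gaussian output and memory. With the power method's randomness fixed, `z^t` is linear in independent
Gaussians, and its covariance obeys the recursion of `X^t`. The program stores only `z`, the
measurements `ℬ X` and a few work vectors: `J x` is assembled from the input matrices and `ℬ X`, and
neither `X` nor `J` is formed. -/

namespace GMeanSDP

/-! ### Trace inner product and the spectraplex -/

section Frob
variable {n d : ℕ}

theorem frob_eq_sum (M N : Matrix (Fin n) (Fin n) ℝ) :
    frob M N = ∑ i, ∑ j, M i j * N i j := by
  rw [Finset.sum_comm]
  simp [frob, Matrix.trace, Matrix.mul_apply]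

theorem frob_add_right (M N P : Matrix (Fin n) (Fin n) ℝ) :
    frob M (N + P) = frob M N + frob M P := by simp [frob, Matrix.mul_add]

theorem frob_sub_right (M N P : Matrix (Fin n) (Fin n) ℝ) :
    frob M (N - P) = frob M N - frob M P := by simp [frob, Matrix.mul_sub]

theorem frob_smul_right (a : ℝ) (M N : Matrix (Fin n) (Fin n) ℝ) :
    frob M (a • N) = a * frob M N := by simp [frob]

theorem frob_neg_left (M N : Matrix (Fin n) (Fin n) ℝ) : frob (-M) N = -frob M N := by
  simp [frob]

theorem frob_smul_left (a : ℝ) (M N : Matrix (Fin n) (Fin n) ℝ) :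
    frob (a • M) N = a * frob M N := by simp [frob]

theorem frob_sub_left (M N P : Matrix (Fin n) (Fin n) ℝ) :
    frob (M - N) P = frob M P - frob N P := by simp [frob, Matrix.sub_mul]

theorem frob_sum_left {ι : Type*} (s : Finset ι) (M : ι → Matrix (Fin n) (Fin n) ℝ)
    (N : Matrix (Fin n) (Fin n) ℝ) : frob (∑ i ∈ s, M i) N = ∑ i ∈ s, frob (M i) N := by
  simp [frob, Matrix.transpose_sum, Matrix.sum_mul, Matrix.trace_sum]

theorem frob_one_left (N : Matrix (Fin n) (Fin n) ℝ) : frob 1 N = N.trace := by simp [frob]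

theorem frob_one_right {M : Matrix (Fin n) (Fin n) ℝ} : frob M 1 = M.trace := by simp [frob]

theorem frob_vecMulVec (M : Matrix (Fin n) (Fin n) ℝ) (u : Fin n → ℝ) :
    frob M (Matrix.vecMulVec u u) = u ⬝ᵥ M.mulVec u := by
  rw [frob_eq_sum]
  simp only [Matrix.vecMulVec_apply, dotProduct, Matrix.mulVec, Finset.mul_sum]
  exact Finset.sum_congr rfl fun i _ => Finset.sum_congr rfl fun j _ => by ring

/-- With `N = Bᴴ B` the inner product is the trace of `B M Bᴴ`, which is positive semidefinite. -/
theorem frob_nonneg {M N : Matrix (Fin n) (Fin n) ℝ} (hM : M.PosSemidef) (hN : N.PosSemidef) :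
    0 ≤ frob M N := by
  obtain ⟨B, rfl⟩ : ∃ B : Matrix (Fin n) (Fin n) ℝ, N = B.conjTranspose * B := by
    open scoped MatrixOrder in
    obtain ⟨B, hB⟩ := (CStarAlgebra.nonneg_iff_eq_star_mul_self (a := N)).1 hN.nonneg
    exact ⟨B, hB⟩
  have hs : M.transpose = M := by simpa using hM.1.eq
  have h := (hM.mul_mul_conjTranspose_same B).trace_nonneg
  rw [frob, hs, ← mul_assoc, Matrix.trace_mul_comm, ← mul_assoc]
  exact h

/-- For `X = Bᴴ B` this is `‖B v‖² ≤ ‖B‖_F² ‖v‖²`, that is, Cauchy-Schwarz applied to each row of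
`B`. -/
theorem posSemidef_trace_smul_one_sub {X : Matrix (Fin n) (Fin n) ℝ} (hX : X.PosSemidef) :
    (X.trace • (1 : Matrix (Fin n) (Fin n) ℝ) - X).PosSemidef := by
  obtain ⟨B, rfl⟩ : ∃ B : Matrix (Fin n) (Fin n) ℝ, X = B.conjTranspose * B := by
    open scoped MatrixOrder in
    obtain ⟨B, hB⟩ := (CStarAlgebra.nonneg_iff_eq_star_mul_self (a := X)).1 hX.nonneg
    exact ⟨B, hB⟩
  refine Matrix.PosSemidef.of_dotProduct_mulVec_nonneg ?_ fun v => ?_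
  · refine Matrix.IsHermitian.sub ?_ hX.1
    simp [Matrix.IsHermitian]
  have h1 : star v ⬝ᵥ (B.conjTranspose * B).mulVec v = ∑ r, (∑ k, B r k * v k) ^ 2 := by
    rw [← Matrix.mulVec_mulVec, Matrix.dotProduct_mulVec, ← Matrix.star_mulVec]
    simp only [dotProduct, Pi.star_apply, star_trivial, Matrix.mulVec, sq]
  have h2 : (B.conjTranspose * B).trace = ∑ r, ∑ k, B r k ^ 2 := by
    rw [Finset.sum_comm]
    simp [Matrix.trace, Matrix.mul_apply, sq]
  rw [Matrix.sub_mulVec, dotProduct_sub, h1, h2, Matrix.smul_mulVec, Matrix.one_mulVec,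
    dotProduct_smul, smul_eq_mul, Finset.sum_mul, sub_nonneg]
  refine Finset.sum_le_sum fun r _ => ?_
  have h3 : star v ⬝ᵥ v = ∑ k, v k ^ 2 := by simp [dotProduct, sq]
  rw [h3]
  exact Finset.sum_mul_sq_le_sq_mul_sq _ _ _

theorem frob_le_trace {M X : Matrix (Fin n) (Fin n) ℝ} (hM : M.PosSemidef)
    (hX : X ∈ spectraplex n) : frob M X ≤ M.trace := by
  have h := frob_nonneg hM (posSemidef_trace_smul_one_sub hX.1)
  rw [frob_sub_right, frob_smul_right, hX.2, frob_one_right] at h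
  linarith

theorem trace_pos {M : Matrix (Fin n) (Fin n) ℝ} (hM : M.PosSemidef) (h0 : M ≠ 0) :
    0 < M.trace :=
  lt_of_le_of_ne hM.trace_nonneg fun h => h0 (hM.trace_eq_zero_iff.1 h.symm)

theorem spectraplex_convex {X Y : Matrix (Fin n) (Fin n) ℝ} (hX : X ∈ spectraplex n)
    (hY : Y ∈ spectraplex n) {γ : ℝ} (h0 : 0 ≤ γ) (h1 : γ ≤ 1) :
    (1 - γ) • X + γ • Y ∈ spectraplex n := by
  refine ⟨(hX.1.smul (sub_nonneg.2 h1)).add (hY.1.smul h0), ?_⟩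
  simp [hX.2, hY.2]

theorem vecMulVec_mem_spectraplex {u : Fin n → ℝ} (hu : u ⬝ᵥ u = 1) :
    Matrix.vecMulVec u u ∈ spectraplex n := by
  refine ⟨by simpa using Matrix.posSemidef_vecMulVec_self_star u, ?_⟩
  rw [Matrix.trace_vecMulVec, hu]

end Frob

/-! ### Scalar inequalities behind the damped step -/

section Scalar

theorem log_one_add_ge {x : ℝ} (hx : |x| < 1) :
    x - x ^ 2 / (2 * (1 - |x|)) ≤ Real.log (1 + x) := by
  rcases le_or_gt 0 x with h | h
  · rw [abs_of_nonneg h] at hx ⊢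
    refine le_trans ?_ (Real.le_log_one_add_of_nonneg h)
    rw [sub_le_iff_le_add, ← sub_le_iff_le_add']
    have : x - 2 * x / (x + 2) = x ^ 2 / (x + 2) := by field_simp; ring
    rw [this]
    exact div_le_div_of_nonneg_left (sq_nonneg x) (by linarith) (by linarith)
  · rw [abs_of_neg h] at hx ⊢
    have hp : 0 < 1 + x := by linarith
    have h1 : 1 ≤ (1 + x)⁻¹ := (one_le_inv₀ hp).2 (by linarith)
    -- For negative `x` the bound is `log y ≤ sinh (log y) = (y - 1 / y) / 2` at `y = 1 / (1 + x)`;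
    -- the rest is an identity.
    have h2 := Real.self_le_sinh_iff.2 (Real.log_nonneg h1)
    rw [Real.sinh_log (by positivity), Real.log_inv, inv_inv] at h2
    have : ((1 + x)⁻¹ - (1 + x)) / 2 = -(x - x ^ 2 / (2 * (1 - -x))) := by
      rw [sub_neg_eq_add]; field_simp; ring
    linarith

/-- Decrease of the logarithmic barrier along a damped step. -/
theorem sum_log_one_add_ge {d : ℕ} (r : Fin d → ℝ) {γ G D : ℝ} (hG : 0 ≤ G)
    (hD : D = √(∑ i, r i ^ 2)) (hsum : ∑ i, r i = G) (h0 : 0 ≤ γ)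
    (h1 : γ ≤ G / (D * (D + G))) :
    (∀ i, |γ * r i| < 1) ∧ γ * G / 2 ≤ ∑ i, Real.log (1 + γ * r i) := by
  have hD0 : 0 ≤ D := hD ▸ Real.sqrt_nonneg _
  have hDsq : D ^ 2 = ∑ i, r i ^ 2 := by rw [hD, Real.sq_sqrt (by positivity)]
  have hle : ∀ i, |r i| ≤ D := fun i => by
    refine abs_le_of_sq_le_sq' ?_ hD0 |> abs_le.2
    rw [hDsq]
    exact Finset.single_le_sum (f := fun i => r i ^ 2) (fun _ _ => sq_nonneg _) (Finset.mem_univ i)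
  rcases hD0.eq_or_lt with h | hDp
  -- If `D = 0`, the quotient that bounds `γ` is a division by zero, but then `r = 0` and both
  -- claims are trivial.
  · have hr : ∀ i, r i = 0 := fun i => abs_nonpos_iff.1 (h ▸ hle i)
    have : G = 0 := by rw [← hsum]; simp [hr]
    simp [hr, this]
  have hmul : γ * D * (D + G) ≤ G := by
    rw [le_div_iff₀ (by positivity)] at h1
    linarith
  have hlt : γ * D < 1 := by
    by_contra! hc
    nlinarith
  have hlt' : ∀ i, |γ * r i| ≤ γ * D := fun i => by
    rw [abs_mul, abs_of_nonneg h0]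
    exact mul_le_mul_of_nonneg_left (hle i) h0
  refine ⟨fun i => (hlt' i).trans_lt hlt, ?_⟩
  have key : ∀ i, γ * r i - (γ * r i) ^ 2 / (2 * (1 - γ * D)) ≤ Real.log (1 + γ * r i) := by
    intro i
    refine le_trans ?_ (log_one_add_ge ((hlt' i).trans_lt hlt))
    refine sub_le_sub_left (div_le_div_of_nonneg_left (sq_nonneg _) (by linarith) ?_) _
    linarith [hlt' i]
  refine le_trans ?_ (Finset.sum_le_sum fun i _ => key i)
  rw [Finset.sum_sub_distrib, ← Finset.mul_sum, hsum, ← Finset.sum_div]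
  simp_rw [mul_pow]
  rw [← Finset.mul_sum, ← hDsq]
  -- `hmul` rearranges to `γ D² ≤ G (1 - γ D)`, so the second-order loss is at most half of the
  -- first-order gain `γ G`.
  have : γ ^ 2 * D ^ 2 / (2 * (1 - γ * D)) ≤ γ * G / 2 := by
    rw [div_le_div_iff₀ (by linarith) two_pos]
    nlinarith [mul_le_mul_of_nonneg_left hmul h0]
  linarith

/-- A damped step that starts with gap more than `η` makes at least a fixed progress. -/
theorem damped_step_ge {d : ℕ} (q : Fin d → ℝ) (hq : ∀ i, 0 ≤ q i) {G D η : ℝ} (hη : 0 < η)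
    (hG : η ≤ G) (hD : D = √(∑ i, (q i - 1) ^ 2)) (hsum : ∑ i, (q i - 1) = G) :
    min (η ^ 2 / ((η + d) * (2 * η + d))) η ≤ min (G / (D * (D + G))) 1 * G := by
  have hD0 : 0 ≤ D := hD ▸ Real.sqrt_nonneg _
  have hDsq : D ^ 2 = ∑ i, (q i - 1) ^ 2 := by rw [hD, Real.sq_sqrt (by positivity)]
  have hGp : 0 < G := hη.trans_le hG
  have hq1 : ∑ i, q i = G + d := by
    rw [← hsum, Finset.sum_sub_distrib]; simp
  have hq2 : ∑ i, q i ^ 2 ≤ (G + d) ^ 2 := by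
    rw [← hq1]; exact Finset.sum_sq_le_sq_sum_of_nonneg fun i _ => hq i
  have hd : (0 : ℝ) ≤ d := d.cast_nonneg
  -- Nonnegativity of `q` gives `∑ q i ^ 2 ≤ (∑ q i) ^ 2`, and centring at `1` only subtracts `2 (G
  -- + d) - d ≥ 0`.
  have hDle : D ≤ G + d := by
    refine abs_le_of_sq_le_sq' ?_ (by positivity) |>.2
    have : ∑ i, (q i - 1) ^ 2 = ∑ i, q i ^ 2 - 2 * (G + d) + d := by
      rw [← hq1, Finset.mul_sum, ← Finset.sum_sub_distrib]
      have h1 : (d : ℝ) = ∑ _i : Fin d, (1 : ℝ) := by simp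
      conv_rhs => rw [h1]
      rw [← Finset.sum_add_distrib]
      exact Finset.sum_congr rfl fun i _ => by ring
    rw [hDsq, this]
    linarith
  have hDp : 0 < D := by
    rcases hD0.eq_or_lt with h | h
    · exfalso
      have : ∑ i, (q i - 1) ^ 2 = 0 := by rw [← hDsq, ← h]; simp
      have h0 := (Finset.sum_eq_zero_iff_of_nonneg fun i _ => sq_nonneg _).1 this
      have : ∑ i, (q i - 1) = 0 := Finset.sum_eq_zero fun i hi => by
        simpa using h0 i hi
      linarith
    · exact h
  rw [min_mul_of_nonneg _ _ hGp.le, one_mul]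
  refine min_le_min ?_ hG
  rw [div_mul_eq_mul_div, div_le_div_iff₀ (by positivity) (by positivity)]
  -- The two factors of `D (D + G)` are bounded separately, from `D ≤ G + d` and `η ≤ G`; the
  -- product of the bounds is the claim.
  have e1 : η * D ≤ G * (η + d) := by nlinarith
  have e2 : η * (D + G) ≤ G * (2 * η + d) := by nlinarith
  nlinarith [mul_le_mul e1 e2 (by positivity) (by positivity)]

end Scalar

/-! ### Deterministic properties of the oracle and of one step -/

section Oracle
variable {n d : ℕ} {A : Fin d → Matrix (Fin n) (Fin n) ℝ}

theorem linObj_eq_sum (X H : Matrix (Fin n) (Fin n) ℝ) :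
    linObj A X H = -∑ i, meas A H i / meas A X i := by
  simp only [linObj, gradB, frob_neg_left, frob_sum_left, frob_smul_left, meas]
  congr 1
  exact Finset.sum_congr rfl fun i _ => by rw [div_eq_inv_mul]

theorem linObj_self {X : Matrix (Fin n) (Fin n) ℝ} (hX : IsFeasible A X) :
    linObj A X X = -d := by
  rw [linObj_eq_sum, Finset.sum_congr rfl fun i _ => div_self (hX.2 i).ne']
  simp

theorem approxGap_eq_sum {X : Matrix (Fin n) (Fin n) ℝ} (hX : IsFeasible A X)
    (H : Matrix (Fin n) (Fin n) ℝ) :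
    approxGap A X H = ∑ i, (meas A H i / meas A X i - 1) := by
  rw [approxGap, linObj_self hX, linObj_eq_sum, Finset.sum_sub_distrib]
  simp; ring

theorem localDist_eq {X : Matrix (Fin n) (Fin n) ℝ} (hX : IsFeasible A X)
    (H : Matrix (Fin n) (Fin n) ℝ) :
    localDist A X H = √(∑ i, (meas A H i / meas A X i - 1) ^ 2) := by
  rw [localDist]
  congr 1
  refine Finset.sum_congr rfl fun i _ => ?_
  have : meas A (H - X) i = meas A H i - meas A X i := frob_sub_right _ _ _
  rw [this, sub_div, div_self (hX.2 i).ne']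

theorem approxGap_self (X : Matrix (Fin n) (Fin n) ℝ) : approxGap A X X = 0 := sub_self _

theorem meas_nonneg (hA : ∀ i, (A i).PosSemidef) {X : Matrix (Fin n) (Fin n) ℝ}
    (hX : X.PosSemidef) (i : Fin d) : 0 ≤ meas A X i := frob_nonneg (hA i) hX

theorem neg_gradB_posSemidef (hA : ∀ i, (A i).PosSemidef) {X : Matrix (Fin n) (Fin n) ℝ}
    (hX : X.PosSemidef) : (-gradB A X).PosSemidef := by
  rw [gradB, neg_neg]
  exact Matrix.posSemidef_sum _ fun i _ => (hA i).smul (inv_nonneg.2 (meas_nonneg hA hX i))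

theorem powerStep_dotProduct_self (M : Matrix (Fin n) (Fin n) ℝ) (x : Fin n → ℝ) :
    powerStep M x = 0 ∨ powerStep M x ⬝ᵥ powerStep M x = 1 := by
  have h0 : 0 ≤ M.mulVec x ⬝ᵥ M.mulVec x := Finset.sum_nonneg fun i _ => mul_self_nonneg _
  rcases h0.eq_or_lt with h | h
  · left; simp [powerStep, ← h]
  · right
    rw [powerStep, smul_dotProduct, dotProduct_smul, smul_eq_mul, smul_eq_mul, ← mul_assoc,
      ← mul_inv, Real.mul_self_sqrt h0, inv_mul_cancel₀ h.ne']

theorem relErr_pos {c δ : ℝ} (hd : 0 < d) (hc : 2 < c) (hδ : 0 < δ) : 0 < relErr d c δ := by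
  have hd' : (0 : ℝ) < d := Nat.cast_pos.2 hd
  exact div_pos (lt_min hδ (mul_pos (by linarith) hd')) (mul_pos (by linarith) hd')

theorem log_div_sq_pos {p : ℝ} (hn : 0 < n) (hp : 0 < p) (hp1 : p < 1) :
    0 < Real.log (n / p ^ 2) := by
  have hn' : (1 : ℝ) ≤ n := Nat.one_le_cast.2 hn
  refine Real.log_pos ((one_lt_div (by positivity)).2 ?_)
  exact (pow_lt_one₀ hp.le hp1 two_ne_zero).trans_le hn'

/-- At least one step is needed for a normalised output, since the start vector is not a unit
vector. -/
theorem powerCount_pos {p c δ : ℝ} (hn : 0 < n) (hd : 0 < d) (hp : 0 < p) (hp1 : p < 1)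
    (hc : 2 < c) (hδ : 0 < δ) : 0 < powerCount n d p c δ :=
  Nat.ceil_pos.2 (div_pos (log_div_sq_pos hn hp hp1)
    (mul_pos two_pos (relErr_pos hd hc hδ)))

theorem powerVec_dotProduct_self {I : Input n d} {X : Matrix (Fin n) (Fin n) ℝ} {δ : ℝ}
    (h : 0 < powerCount n d I.p I.c δ) (g : Fin n → ℝ) :
    powerVec I X δ g = 0 ∨ powerVec I X δ g ⬝ᵥ powerVec I X δ g = 1 := by
  obtain ⟨k, hk⟩ := Nat.exists_eq_succ_of_ne_zero h.ne'
  rw [powerVec, hk, Function.iterate_succ_apply']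
  exact powerStep_dotProduct_self _ _

/-- Admissible data: the standing assumptions on the input, as far as the deterministic part of
the analysis needs them. -/
structure Input.Admissible (I : Input n d) : Prop where
  n_pos : 0 < n
  d_pos : 0 < d
  psd : ∀ i, (I.A i).PosSemidef
  ne_zero : ∀ i, I.A i ≠ 0
  p_pos : 0 < I.p
  p_lt : I.p < 1
  c_gt : 2 < I.c
  tol_pos : 0 < I.tol
  rule_pos : ∀ t m, 0 ≤ m → 0 < I.rule t m

variable {I : Input n d}

theorem plmo_spec (hI : I.Admissible) {X : Matrix (Fin n) (Fin n) ℝ} (hX : IsFeasible I.A X)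
    {δ : ℝ} (hδ : 0 < δ) (g : Fin n → ℝ) :
    (plmo I X δ g).1 ∈ spectraplex n ∧
      (plmo I X δ g).2 = approxGap I.A X (plmo I X δ g).1 ∧ 0 ≤ (plmo I X δ g).2 := by
  rw [plmo]
  split_ifs with h
  · exact ⟨hX.1, (approxGap_self X).symm, le_rfl⟩
  · refine ⟨?_, rfl, not_lt.1 h⟩
    rcases powerVec_dotProduct_self (I := I) (X := X)
      (powerCount_pos hI.n_pos hI.d_pos hI.p_pos hI.p_lt hI.c_gt hδ) g with h0 | h1
    -- If the power method breaks down, then `u = 0` and the gap is `-d < 0`, so the oracle has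
    -- already fallen back to `(X, 0)`.
    · refine absurd ?_ h
      have hd : (0 : ℝ) < d := Nat.cast_pos.2 hI.d_pos
      simp only [h0]
      rw [approxGap, linObj_self hX]
      simp [linObj, frob, hd]
    · exact vecMulVec_mem_spectraplex h1

/-- The step size for the gap `G` and the distance `D`. -/
noncomputable def dampedStep (G D : ℝ) : ℝ := min (G / (D * (D + G))) 1

theorem dampedStep_nonneg {G D : ℝ} (hG : 0 ≤ G) (hD : 0 ≤ D) : 0 ≤ dampedStep G D :=
  le_min (by positivity) zero_le_one

theorem localDist_nonneg (X H : Matrix (Fin n) (Fin n) ℝ) : 0 ≤ localDist A X H :=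
  Real.sqrt_nonneg _

theorem meas_step (X H : Matrix (Fin n) (Fin n) ℝ) (γ : ℝ) (i : Fin d) :
    meas A ((1 - γ) • X + γ • H) i = (1 - γ) * meas A X i + γ * meas A H i := by
  simp [meas, frob_add_right, frob_smul_right]

/-- The step multiplies each measurement by `1 + γ r i`, where `r i` is its relative change from `X`
to `H`; `sum_log_one_add_ge` keeps these factors positive and bounds the sum of their logarithms. -/
theorem dampedStep_feasible {X H : Matrix (Fin n) (Fin n) ℝ}
    (hX : IsFeasible A X) (hH : H ∈ spectraplex n) (hG : 0 ≤ approxGap A X H) {γ : ℝ}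
    (hγ : γ = dampedStep (approxGap A X H) (localDist A X H)) :
    IsFeasible A ((1 - γ) • X + γ • H) ∧
      objective A ((1 - γ) • X + γ • H) ≤ objective A X - γ * approxGap A X H / 2 := by
  have hγ0 : 0 ≤ γ := hγ ▸ dampedStep_nonneg hG (localDist_nonneg X H)
  have hγ1 : γ ≤ 1 := hγ ▸ min_le_right _ _
  obtain ⟨h1, h2⟩ := sum_log_one_add_ge (fun i => meas A H i / meas A X i - 1) hG
    (localDist_eq hX H) (approxGap_eq_sum hX H).symm hγ0 (hγ ▸ min_le_left _ _)
  have hm : ∀ i, meas A ((1 - γ) • X + γ • H) i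
      = meas A X i * (1 + γ * (meas A H i / meas A X i - 1)) := fun i => by
    have := (hX.2 i).ne'
    rw [meas_step]; field_simp; ring
  have hp : ∀ i, 0 < 1 + γ * (meas A H i / meas A X i - 1) := fun i => by
    linarith [(abs_lt.1 (h1 i)).1]
  refine ⟨⟨spectraplex_convex hX.1 hH hγ0 hγ1, fun i => ?_⟩, ?_⟩
  · rw [hm]; exact mul_pos (hX.2 i) (hp i)
  · simp only [objective]
    simp_rw [hm]
    rw [Finset.sum_congr rfl fun i _ => Real.log_mul (hX.2 i).ne' (hp i).ne',
      Finset.sum_add_distrib]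
    linarith

/-- The objective lies above its linearisation. -/
theorem objective_le_add_gap {X Y : Matrix (Fin n) (Fin n) ℝ} (hX : IsFeasible A X)
    (hY : IsFeasible A Y) : objective A X ≤ objective A Y + (linObj A X X - linObj A X Y) := by
  have h := approxGap_eq_sum hX Y
  rw [approxGap] at h
  rw [h]
  simp only [objective]
  have : ∀ i ∈ Finset.univ, Real.log (meas A Y i) - Real.log (meas A X i)
      ≤ meas A Y i / meas A X i - 1 := fun i _ => by
    rw [← Real.log_div (hY.2 i).ne' (hX.2 i).ne']
    exact Real.log_le_sub_one_of_pos (div_pos (hY.2 i) (hX.2 i))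
  have := Finset.sum_le_sum this
  rw [Finset.sum_sub_distrib] at this
  linarith

theorem isFeasible_inv_smul_one (hn : 0 < n) (hA : ∀ i, (A i).PosSemidef)
    (h0 : ∀ i, A i ≠ 0) : IsFeasible A ((n : ℝ)⁻¹ • (1 : Matrix (Fin n) (Fin n) ℝ)) := by
  have hn' : (0 : ℝ) < n := Nat.cast_pos.2 hn
  refine ⟨⟨Matrix.PosSemidef.one.smul (by positivity), by simp [hn'.ne']⟩, fun i => ?_⟩
  rw [meas, frob_smul_right, frob_one_right]
  exact mul_pos (by positivity) (trace_pos (hA i) (h0 i))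

/-- A matrix of trace one satisfies `⟨A i, Y⟩ ≤ Tr (A i) = n ⟨A i, I / n⟩`, so no logarithm exceeds
its initial value by more than `log n`. -/
theorem objective_init_le (hn : 0 < n) (hA : ∀ i, (A i).PosSemidef) (h0 : ∀ i, A i ≠ 0)
    {Y : Matrix (Fin n) (Fin n) ℝ} (hY : IsFeasible A Y) :
    objective A ((n : ℝ)⁻¹ • (1 : Matrix (Fin n) (Fin n) ℝ))
      ≤ objective A Y + d * Real.log n := by
  have hn' : (0 : ℝ) < n := Nat.cast_pos.2 hn
  have h1 : ∀ i ∈ Finset.univ, Real.log (meas A Y i) ≤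
      Real.log (meas A ((n : ℝ)⁻¹ • (1 : Matrix (Fin n) (Fin n) ℝ)) i) + Real.log n := by
    intro i _
    rw [meas, meas, frob_smul_right, frob_one_right,
      Real.log_mul (by positivity) (trace_pos (hA i) (h0 i)).ne', Real.log_inv]
    have := Real.log_le_log (hY.2 i) (frob_le_trace (hA i) hY.1)
    rw [meas] at this
    linarith
  have := Finset.sum_le_sum h1
  rw [Finset.sum_add_distrib] at this
  simp only [objective]
  simp at this ⊢
  linarith

end Oracle

/-! ### Termination and the optimality certificate, for fixed randomness -/

section Method
variable {n d : ℕ} {I : Input n d}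

/-- What the oracle returns in iteration `t`. -/
noncomputable def oracleAt (I : Input n d) (ρ : ℕ → ℝ) (t : ℕ) : Matrix (Fin n) (Fin n) ℝ × ℝ :=
  plmo I (states I ρ t).X ((states I ρ t).delta I t) (startVec n ρ t)

/-- The step size of iteration `t`. -/
noncomputable def stepAt (I : Input n d) (ρ : ℕ → ℝ) (t : ℕ) : ℝ :=
  (states I ρ t).stepSize I t (startVec n ρ t)

theorem states_succ_X (ρ : ℕ → ℝ) (t : ℕ) : (states I ρ (t + 1)).X =
    (1 - stepAt I ρ t) • (states I ρ t).X + stepAt I ρ t • (oracleAt I ρ t).1 := rfl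

theorem states_succ_best (ρ : ℕ → ℝ) (t : ℕ) : (states I ρ (t + 1)).best =
    if t = 0 then (oracleAt I ρ t).2 else min (states I ρ t).best (oracleAt I ρ t).2 := rfl

/-- The stopping test is passed in iteration `t`. -/
def Passed (I : Input n d) (ρ : ℕ → ℝ) (t : ℕ) : Prop :=
  (oracleAt I ρ t).2 ≤ I.tol ∧ (states I ρ t).delta I t ≤ 3 * I.tol / 2

open scoped Classical in
theorem states_succ_count (ρ : ℕ → ℝ) (t : ℕ) : (states I ρ (t + 1)).count =
    if Passed I ρ t then (states I ρ t).count + 1 else (states I ρ t).count := by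
  simp only [states, Iterate.next, Passed, oracleAt]
  congr

/-- The two claims need a joint induction: the rule yields a positive `δ` only for a nonnegative
argument, and the oracle is valid only at a feasible point with positive `δ`. -/
theorem feasible_and_best_nonneg (hI : I.Admissible) (ρ : ℕ → ℝ) (t : ℕ) :
    IsFeasible I.A (states I ρ t).X ∧ 0 ≤ (states I ρ t).best := by
  induction t with
  | zero => exact ⟨isFeasible_inv_smul_one hI.n_pos hI.psd hI.ne_zero, le_rfl⟩
  | succ t ih =>
    obtain ⟨hX, hb⟩ := ih
    obtain ⟨h1, h2, h3⟩ := plmo_spec hI hX (hI.rule_pos t _ hb) (startVec n ρ t)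
    refine ⟨?_, ?_⟩
    · refine (dampedStep_feasible hX h1 (h2 ▸ h3) ?_).1
      rw [← h2]; rfl
    · rw [states_succ_best]
      split_ifs
      · exact h3
      · exact le_min hb h3

theorem delta_pos (hI : I.Admissible) (ρ : ℕ → ℝ) (t : ℕ) :
    0 < (states I ρ t).delta I t :=
  hI.rule_pos t _ (feasible_and_best_nonneg hI ρ t).2

theorem oracleAt_spec (hI : I.Admissible) (ρ : ℕ → ℝ) (t : ℕ) :
    (oracleAt I ρ t).1 ∈ spectraplex n ∧
      (oracleAt I ρ t).2 = approxGap I.A (states I ρ t).X (oracleAt I ρ t).1 ∧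
      0 ≤ (oracleAt I ρ t).2 :=
  plmo_spec hI (feasible_and_best_nonneg hI ρ t).1 (delta_pos hI ρ t) _

theorem stepAt_eq (ρ : ℕ → ℝ) (t : ℕ) : stepAt I ρ t =
    dampedStep (oracleAt I ρ t).2 (localDist I.A (states I ρ t).X (oracleAt I ρ t).1) := rfl

theorem stepAt_mem (hI : I.Admissible) (ρ : ℕ → ℝ) (t : ℕ) :
    0 ≤ stepAt I ρ t ∧ stepAt I ρ t ≤ 1 :=
  ⟨dampedStep_nonneg (oracleAt_spec hI ρ t).2.2 (localDist_nonneg _ _), min_le_right _ _⟩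

theorem objective_succ_le (hI : I.Admissible) (ρ : ℕ → ℝ) (t : ℕ) :
    objective I.A (states I ρ (t + 1)).X ≤
      objective I.A (states I ρ t).X - stepAt I ρ t * (oracleAt I ρ t).2 / 2 := by
  obtain ⟨h1, h2, h3⟩ := oracleAt_spec hI ρ t
  rw [states_succ_X, h2]
  refine (dampedStep_feasible (feasible_and_best_nonneg hI ρ t).1 h1 (h2 ▸ h3) ?_).2
  rw [stepAt_eq, h2]

theorem objective_antitone (hI : I.Admissible) (ρ : ℕ → ℝ) :
    Antitone fun t => objective I.A (states I ρ t).X := by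
  refine antitone_nat_of_succ_le fun t => (objective_succ_le hI ρ t).trans ?_
  have := mul_nonneg (stepAt_mem hI ρ t).1 (oracleAt_spec hI ρ t).2.2
  linarith

/-- The progress that is guaranteed (up to the factor `1 / 2`) as long as the gap exceeds `η`. -/
noncomputable def progress (d : ℕ) (η : ℝ) : ℝ := min (η ^ 2 / ((η + d) * (2 * η + d))) η

theorem progress_pos {η : ℝ} (hη : 0 < η) : 0 < progress d η := lt_min (by positivity) hη

open scoped Classical in
theorem objective_le_sub_card (hI : I.Admissible) (ρ : ℕ → ℝ) (t : ℕ) :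
    objective I.A (states I ρ t).X ≤ objective I.A (states I ρ 0).X -
      ((Finset.range t).filter fun s => I.tol < (oracleAt I ρ s).2).card *
        (progress d I.tol / 2) := by
  induction t with
  | zero => simp
  | succ t ih =>
    have h := objective_succ_le hI ρ t
    rw [Finset.range_add_one, Finset.filter_insert]
    obtain ⟨h1, h2, h3⟩ := oracleAt_spec hI ρ t
    have hX := (feasible_and_best_nonneg hI ρ t).1
    split_ifs with hg
    · rw [Finset.card_insert_of_notMem (by simp)]
      have := damped_step_ge (fun i => meas I.A (oracleAt I ρ t).1 i / meas I.A (states I ρ t).X i)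
        (fun i => div_nonneg (meas_nonneg hI.psd h1.1 i) (hX.2 i).le) hI.tol_pos hg.le
        (localDist_eq hX (oracleAt I ρ t).1)
        (by rw [h2, approxGap_eq_sum hX])
      have : progress d I.tol ≤ stepAt I ρ t * (oracleAt I ρ t).2 := this
      push_cast
      linarith
    · have := mul_nonneg (stepAt_mem hI ρ t).1 h3
      linarith

/-- A bound on the number of iterations whose gap exceeds `η`. -/
noncomputable def numLarge (n d : ℕ) (η : ℝ) : ℕ := ⌊d * Real.log n / (progress d η / 2)⌋₊

open scoped Classical in
-- Each of these iterations lowers the objective by at least `progress d η / 2`, and by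
-- `objective_init_le`, applied to the current iterate, the total decrease is at most `d log n`.
theorem card_gap_gt_le (hI : I.Admissible) (ρ : ℕ → ℝ) (t : ℕ) :
    ((Finset.range t).filter fun s => I.tol < (oracleAt I ρ s).2).card ≤ numLarge n d I.tol := by
  refine Nat.le_floor ?_
  rw [le_div_iff₀ (half_pos (progress_pos hI.tol_pos))]
  have h1 := objective_le_sub_card hI ρ t
  have h2 := objective_init_le hI.n_pos hI.psd hI.ne_zero (feasible_and_best_nonneg hI ρ t).1
  have h3 : objective I.A (states I ρ 0).X
    = objective I.A ((n : ℝ)⁻¹ • (1 : Matrix (Fin n) (Fin n) ℝ)) := rfl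
  linarith

open scoped Classical in
theorem count_eq_card (ρ : ℕ → ℝ) (t : ℕ) :
    (states I ρ t).count = ((Finset.range t).filter fun s => Passed I ρ s).card := by
  induction t with
  | zero => rfl
  | succ t ih =>
    rw [states_succ_count, Finset.range_add_one, Finset.filter_insert]
    split_ifs
    · rw [Finset.card_insert_of_notMem (by simp), ih]
    · exact ih

theorem best_le (ρ : ℕ → ℝ) {s t : ℕ} (h : s < t) :
    (states I ρ t).best ≤ (oracleAt I ρ s).2 := by
  induction t with
  | zero => simp at h
  | succ t ih =>
    rw [states_succ_best]
    rcases Nat.lt_succ_iff_lt_or_eq.1 h with h | rfl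
    · rw [if_neg (by omega)]
      exact (min_le_left _ _).trans (ih h)
    · split_ifs
      · exact le_rfl
      · exact min_le_right _ _

/-- At most `T` iterations with a small gap fail the stopping test, because of a large `δ`. -/
def FewLargeDelta (n d : ℕ) (tol : ℝ) (rule : ℕ → ℝ → ℝ) (T : ℕ) : Prop :=
  ∀ I : Input n d, I.tol = tol → I.rule = rule → I.Admissible → ∀ (ρ : ℕ → ℝ) (S : Finset ℕ),
    (∀ s ∈ S, (oracleAt I ρ s).2 ≤ tol ∧ 3 * tol / 2 < (states I ρ s).delta I s) → S.card ≤ T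

/-- The iterations in question precede the index from which on the sequence stays below `tol / 2`.
-/
theorem IsScheduled.fewLargeDelta {tol : ℝ} {rule : ℕ → ℝ → ℝ} (ht : 0 < tol)
    (h : IsScheduled tol rule) : ∃ T, FewLargeDelta n d tol rule T := by
  obtain ⟨s, -, h2, h3⟩ := h
  obtain ⟨T, hT⟩ := eventually_atTop.1 h2
  refine ⟨T, fun I hI hr _ ρ S hS => ?_⟩
  suffices S ⊆ Finset.range T by simpa using Finset.card_le_card this
  intro t htS
  have := (hS t htS).2
  rw [Iterate.delta, hr, h3] at this
  by_contra hc
  have := hT t (by simpa using hc)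
  linarith

/-- Of two such iterations `a < b`, the later one would have `δ_b ≤ tol / 2 + G_a ≤ 3 tol / 2`,
which is exactly the threshold of the test. -/
theorem IsAdaptive.fewLargeDelta {tol : ℝ} {rule : ℕ → ℝ → ℝ}
    (h : IsAdaptive tol rule) : FewLargeDelta n d tol rule 1 := by
  obtain ⟨-, -, h3⟩ := h
  intro I hI hr hadm ρ S hS
  refine Finset.card_le_one.2 fun a ha b hb => ?_
  have key : ∀ a ∈ S, ∀ b ∈ S, ¬ a < b := by
    intro a ha b hb hab
    have h1 := (hS b hb).2
    have h2 := h3 b _ (by omega) (feasible_and_best_nonneg hadm ρ b).2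
    have h4 := best_le (I := I) ρ hab
    have h5 := (hS a ha).1
    rw [Iterate.delta, hr] at h1
    linarith
  exact le_antisymm (not_lt.1 (key b hb a ha)) (not_lt.1 (key a ha b hb))

/-- An iteration has a large gap, or a small gap with a large `δ`, or passes the test. The first two
kinds are bounded in number, which leaves at least `l` passes among the first `K` iterations. -/
theorem stopped_of_fewLargeDelta {T : ℕ} (hI : I.Admissible)
    (hT : FewLargeDelta n d I.tol I.rule T) (ρ : ℕ → ℝ) :
    Stopped I ρ (numLarge n d I.tol + T + I.l) := by
  classical
  set K := numLarge n d I.tol + T + I.l with hK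
  rw [Stopped, count_eq_card]
  have h1 := card_gap_gt_le hI ρ K
  have h2 := hT I rfl rfl hI ρ ((Finset.range K).filter fun s => (oracleAt I ρ s).2 ≤ I.tol ∧
    3 * I.tol / 2 < (states I ρ s).delta I s) fun s hs => (Finset.mem_filter.1 hs).2
  have h3 : Finset.range K ⊆ ((Finset.range K).filter fun s => I.tol < (oracleAt I ρ s).2) ∪
      ((Finset.range K).filter fun s => (oracleAt I ρ s).2 ≤ I.tol ∧
        3 * I.tol / 2 < (states I ρ s).delta I s) ∪
      ((Finset.range K).filter fun s => Passed I ρ s) := by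
    intro s hs
    simp only [Finset.mem_union, Finset.mem_filter, hs, true_and]
    rcases lt_or_ge I.tol (oracleAt I ρ s).2 with h | h
    · exact Or.inl (Or.inl h)
    · rcases lt_or_ge (3 * I.tol / 2) ((states I ρ s).delta I s) with h' | h'
      · exact Or.inl (Or.inr ⟨h, h'⟩)
      · exact Or.inr ⟨h, h'⟩
  have h4 := (Finset.card_le_card h3).trans ((Finset.card_union_le _ _).trans
    (Nat.add_le_add_right (Finset.card_union_le _ _) _))
  rw [Finset.card_range] at h4
  omega

theorem stopTime_spec {T : ℕ} (hI : I.Admissible)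
    (hT : FewLargeDelta n d I.tol I.rule T) (ρ : ℕ → ℝ) :
    Stopped I ρ (stopTime I ρ) ∧ stopTime I ρ ≤ numLarge n d I.tol + T + I.l :=
  ⟨Nat.sInf_mem (s := {t | Stopped I ρ t}) ⟨_, stopped_of_fewLargeDelta hI hT ρ⟩,
    Nat.sInf_le (stopped_of_fewLargeDelta hI hT ρ)⟩

/-- The guarantee of the oracle is violated in iteration `t`. -/
def Fails (I : Input n d) (ρ : ℕ → ℝ) (t : ℕ) : Prop :=
  ¬((d : ℝ) < (oracleAt I ρ t).2 ∨
    IsSubopt I.A ((states I ρ t).delta I t) (states I ρ t).X (oracleAt I ρ t).1)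

/-- A gap of at most `tol ≤ d` excludes the first alternative of the guarantee. The second bounds
the exact gap by `G + δ ≤ tol + 3 tol / 2`, and the exact gap bounds the suboptimality at `s`;
monotonicity carries this on to `t`. -/
theorem isEpsOptimal_of_passed (hI : I.Admissible) (htol : I.tol ≤ d) {ρ : ℕ → ℝ} {s t : ℕ}
    (hst : s ≤ t) (hp : Passed I ρ s) (hf : ¬ Fails I ρ s) :
    IsEpsOptimal I.A (5 * I.tol / 2) (states I ρ t).X := by
  refine ⟨(feasible_and_best_nonneg hI ρ t).1, fun Y hY => ?_⟩
  have h1 := objective_antitone hI ρ hst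
  have h2 := objective_le_add_gap (feasible_and_best_nonneg hI ρ s).1 hY
  obtain ⟨h3, h4, h5⟩ := oracleAt_spec hI ρ s
  have h6 := (not_not.1 hf).resolve_left (not_lt.2 (hp.1.trans htol)) Y hY.1
  have h7 := hp.1
  have h8 := hp.2
  rw [approxGap] at h4
  simp only at h1
  linarith

/-- Each pass before the stopping time would certify the final iterate, had its oracle call not
failed. Exactly `l` of the passes are selected, so that the union bound runs over sets of one size.
-/
theorem exists_fails_of_not_isEpsOptimal {T : ℕ} (hI : I.Admissible) (htol : I.tol ≤ d)
    (hT : FewLargeDelta n d I.tol I.rule T) {ρ : ℕ → ℝ}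
    (h : ¬ IsEpsOptimal I.A (5 * I.tol / 2) (finalX I ρ)) :
    ∃ S ∈ (Finset.range (numLarge n d I.tol + T + I.l)).powersetCard I.l, ∀ s ∈ S,
      Fails I ρ s := by
  classical
  obtain ⟨h1, h2⟩ := stopTime_spec hI hT ρ
  rw [Stopped, count_eq_card] at h1
  obtain ⟨S, hS, hcard⟩ := Finset.exists_subset_card_eq h1
  refine ⟨S, Finset.mem_powersetCard.2 ⟨fun s hs => ?_, hcard⟩, fun s hs => ?_⟩
  · have := Finset.mem_range.1 (Finset.mem_filter.1 (hS hs)).1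
    exact Finset.mem_range.2 (this.trans_le h2)
  · by_contra hf
    have := Finset.mem_filter.1 (hS hs)
    exact h (isEpsOptimal_of_passed hI htol (Finset.mem_range.1 this.1).le this.2 hf)

end Method

/-! ### Law of the Gaussian representation -/

section GaussianLaw
variable {n d : ℕ} {I : Input n d}

theorem charFun_map_smul_const_gaussianReal {E : Type*} [NormedAddCommGroup E]
    [InnerProductSpace ℝ E] [MeasurableSpace E] [BorelSpace E] (w s : E) :
    charFun ((gaussianReal 0 1).map fun x : ℝ => x • w) s
      = Complex.exp (((-(inner ℝ w s) ^ 2 / 2 : ℝ)) : ℂ) := by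
  have hm : Measurable fun x : ℝ => x • w := (by fun_prop : Continuous fun x : ℝ => x • w).measurable
  have h := charFun_gaussianReal (μ := 0) (v := 1) (inner ℝ w s)
  rw [charFun_apply_real] at h
  rw [charFun_apply, integral_map hm.aemeasurable (by fun_prop)]
  simp only [real_inner_smul_left]
  convert h using 1
  · refine integral_congr_ae (ae_of_all _ fun x => ?_)
    simp only [Complex.ofReal_mul]
    ring_nf
  · congr 1
    simp
    ring

theorem iIndepFun_stdStream : iIndepFun (fun k (ξ : ℕ → ℝ) => ξ k) stdStream :=
  iIndepFun_infinitePi (X := fun _ x => x) fun _ => measurable_id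

theorem map_eval_stdStream (k : ℕ) :
    stdStream.map (fun ξ => ξ k) = gaussianReal 0 1 :=
  Measure.infinitePi_map_eval (fun _ : ℕ => gaussianReal 0 1) k

/-- A linear combination of independent standard Gaussians with vector coefficients is Gaussian. -/
theorem map_sum_smul_stdStream (m : ℕ) (w : ℕ → Fin n → ℝ) :
    stdStream.map (fun ξ => WithLp.toLp 2 (∑ k ∈ Finset.range m, ξ k • w k)) =
      multivariateGaussian 0 (∑ k ∈ Finset.range m, Matrix.vecMulVec (w k) (w k)) := by
  have hpsd : (∑ k ∈ Finset.range m, Matrix.vecMulVec (w k) (w k)).PosSemidef :=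
    Matrix.posSemidef_sum _ fun k _ => by simpa using Matrix.posSemidef_vecMulVec_self_star (w k)
  set v : ℕ → EuclideanSpace ℝ (Fin n) := fun k => WithLp.toLp 2 (w k) with hv
  have hfun : (fun ξ : ℕ → ℝ => WithLp.toLp 2 (∑ k ∈ Finset.range m, ξ k • w k)) =
      fun ξ : ℕ → ℝ => ∑ k ∈ Finset.range m, ξ k • v k := by
    funext ξ
    simp [hv, WithLp.toLp_sum]
  have hm : ∀ k, Measurable fun x : ℝ => x • v k := fun k =>
    (by fun_prop : Continuous fun x : ℝ => x • v k).measurable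
  have hmf : Measurable (fun ξ : ℕ → ℝ => ∑ k ∈ Finset.range m, ξ k • v k) :=
    Finset.measurable_sum _ fun k _ => (hm k).comp (measurable_pi_apply k)
  have : IsProbabilityMeasure stdStream := by unfold stdStream; infer_instance
  have : IsProbabilityMeasure (stdStream.map fun ξ : ℕ → ℝ => ∑ k ∈ Finset.range m, ξ k • v k) :=
    Measure.isProbabilityMeasure_map hmf.aemeasurable
  rw [hfun]
  -- By independence the characteristic function is the product of the factors `exp (-⟨w k, s⟩² /
  -- 2)`, and the exponents add up to the quadratic form of the covariance.
  apply Measure.ext_of_charFun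
  funext s
  rw [charFun_multivariateGaussian hpsd]
  have hind : iIndepFun (fun k (ξ : ℕ → ℝ) => ξ k • v k) stdStream :=
    iIndepFun_stdStream.comp (fun k x => x • v k) hm
  rw [iIndepFun.charFun_map_fun_finsetSum_eq_prod (X := fun k (ξ : ℕ → ℝ) => ξ k • v k)
    (fun k _ => ((hm k).comp (measurable_pi_apply k)).aemeasurable) (hind.restrict _)]
  have hk : ∀ k, charFun (stdStream.map fun ξ : ℕ → ℝ => ξ k • v k) s
      = Complex.exp (((-(inner ℝ (v k) s) ^ 2 / 2 : ℝ)) : ℂ) := fun k => by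
    rw [← charFun_map_smul_const_gaussianReal, ← map_eval_stdStream k,
      Measure.map_map (hm k) (measurable_pi_apply k)]
    rfl
  rw [Finset.prod_apply, Finset.prod_congr rfl fun k _ => hk k, ← Complex.exp_sum]
  congr 1
  rw [inner_zero_right, ← Complex.ofReal_sum]
  have : (s : Fin n → ℝ) ⬝ᵥ (∑ k ∈ Finset.range m, Matrix.vecMulVec (w k) (w k)).mulVec s
      = ∑ k ∈ Finset.range m, (inner ℝ (v k) s) ^ 2 := by
    rw [Matrix.sum_mulVec, dotProduct_sum]
    refine Finset.sum_congr rfl fun k _ => ?_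
    have h1 : inner ℝ (v k) s = w k ⬝ᵥ (s : Fin n → ℝ) := by
      simp [hv, PiLp.inner_apply, dotProduct, mul_comm]
    rw [Matrix.vecMulVec_mulVec, h1]
    simp [dotProduct_comm, sq]
  rw [this]
  push_cast
  rw [zero_mul, zero_sub, Finset.sum_div, ← Finset.sum_neg_distrib]
  exact Finset.sum_congr rfl fun k _ => by ring

/-- The fallback `(X, 0)` has gap zero and hence step size zero, so `u uᵀ` may replace the returned
matrix in every update. This is why the Gaussian recursion and the program can use `u`
unconditionally. -/
theorem stepAt_smul_oracleAt (ρ : ℕ → ℝ) (t : ℕ) :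
    stepAt I ρ t • (oracleAt I ρ t).1 = stepAt I ρ t •
      Matrix.vecMulVec
        (powerVec I (states I ρ t).X ((states I ρ t).delta I t) (startVec n ρ t))
        (powerVec I (states I ρ t).X ((states I ρ t).delta I t) (startVec n ρ t)) := by
  rw [stepAt_eq, oracleAt, plmo]
  split_ifs with h
  · simp [dampedStep]
  · rfl

/-- The Gaussian representation is linear in its randomness, with covariance `X^t`. -/
theorem exists_gaussIter_eq_sum (hI : I.Admissible) (ρ : ℕ → ℝ) (t : ℕ) :
    ∃ w : ℕ → Fin n → ℝ,
      (∀ ξ, gaussIter I ρ ξ t = ∑ k ∈ Finset.range (n + t), ξ k • w k) ∧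
      ∑ k ∈ Finset.range (n + t), Matrix.vecMulVec (w k) (w k) = (states I ρ t).X := by
  induction t with
  | zero =>
    refine ⟨fun k j => if k = j then (√n)⁻¹ else 0, fun ξ => ?_, ?_⟩
    · funext j
      simp only [gaussIter, add_zero, Finset.sum_apply, Pi.smul_apply, smul_eq_mul, mul_ite,
        mul_zero]
      rw [Finset.sum_ite_eq' (Finset.range n) (j : ℕ) fun k => ξ k * (√n)⁻¹]
      simp [div_eq_mul_inv]
    · ext i j
      have hn : (0 : ℝ) ≤ n := n.cast_nonneg
      simp only [states, add_zero, Matrix.sum_apply, Matrix.vecMulVec_apply, Matrix.smul_apply,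
        smul_eq_mul, ite_mul, zero_mul]
      rw [Finset.sum_ite_eq' (Finset.range n) (i : ℕ)]
      simp only [Finset.mem_range, i.isLt, if_true, Matrix.one_apply, Fin.val_inj]
      split_ifs <;> simp [← mul_inv, Real.mul_self_sqrt hn]
  | succ t ih =>
    obtain ⟨w, h1, h2⟩ := ih
    obtain ⟨h0, h1'⟩ := stepAt_mem hI ρ t
    set γ := stepAt I ρ t with hγ
    set u := powerVec I (states I ρ t).X ((states I ρ t).delta I t) (startVec n ρ t) with hu
    -- The fresh Gaussian has index `n + t`. The squares of the two scalings are the weights `1 - γ`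
    -- and `γ` of the update of `X`, so the sum of outer products follows that update.
    refine ⟨fun k => if k = n + t then √γ • u else √(1 - γ) • w k, fun ξ => ?_, ?_⟩
    · have hs : gaussIter I ρ ξ (t + 1) =
          √(1 - γ) • gaussIter I ρ ξ t + (√γ * ξ (n + t)) • u := rfl
      rw [hs, h1, ← add_assoc, Finset.sum_range_succ]
      simp only [if_true]
      rw [Finset.smul_sum, smul_smul, mul_comm (√γ)]
      congr 1
      refine Finset.sum_congr rfl fun k hk => ?_
      rw [if_neg (Finset.mem_range.1 hk).ne, smul_comm]
    · rw [states_succ_X, ← hγ, stepAt_smul_oracleAt, ← hγ, ← hu, ← h2, ← add_assoc,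
        Finset.sum_range_succ, Finset.smul_sum]
      simp only [if_true]
      have hsm : ∀ (a : ℝ) (x : Fin n → ℝ), 0 ≤ a →
          Matrix.vecMulVec (√a • x) (√a • x) = a • Matrix.vecMulVec x x := fun a x ha => by
        rw [Matrix.vecMulVec_smul, Matrix.smul_vecMulVec, smul_smul, Real.mul_self_sqrt ha]
      rw [hsm _ _ h0]
      congr 1
      refine Finset.sum_congr rfl fun k hk => ?_
      rw [if_neg (Finset.mem_range.1 hk).ne, hsm _ _ (sub_nonneg.2 h1')]

/-- The stopping time depends on `ρ` only; for fixed `ρ` it is a constant, and the linear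
representation at that index applies. -/
theorem map_finalZ (hI : I.Admissible) (ρ : ℕ → ℝ) :
    stdStream.map (fun ξ => WithLp.toLp 2 (finalZ I ρ ξ)) =
      multivariateGaussian 0 (finalX I ρ) := by
  obtain ⟨w, h1, h2⟩ := exists_gaussIter_eq_sum hI ρ (stopTime I ρ)
  rw [finalX, ← h2, ← map_sum_smul_stdStream]
  simp only [finalZ, h1]

end GaussianLaw

/-! ### Small-ball estimate for one Gaussian coordinate -/

section SmallBall

/-- The density is at most `1 / √(2 π)` and the interval has length `2 r`. -/
theorem gaussianReal_abs_le (r : ℝ) :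
    gaussianReal 0 1 {x | |x| ≤ r} ≤ ENNReal.ofReal (√(2 / Real.pi) * r) := by
  have hset : {x : ℝ | |x| ≤ r} = Set.Icc (-r) r := by ext x; simp [abs_le]
  rw [gaussianReal_apply 0 one_ne_zero, hset]
  calc ∫⁻ x in Set.Icc (-r) r, gaussianPDF 0 1 x
      ≤ ∫⁻ _ in Set.Icc (-r) r, ENNReal.ofReal (√(2 * Real.pi))⁻¹ := by
        refine lintegral_mono fun x => ENNReal.ofReal_le_ofReal ?_
        rw [gaussianPDFReal]
        simp only [NNReal.coe_one, mul_one]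
        refine mul_le_of_le_one_right (by positivity) (Real.exp_le_one_iff.2 ?_)
        have := sq_nonneg (x - 0)
        linarith
    _ = ENNReal.ofReal (√(2 / Real.pi) * r) := by
        rw [setLIntegral_const, Real.volume_Icc, ← ENNReal.ofReal_mul (by positivity)]
        congr 1
        have h1 : √(2 / Real.pi) = (√(2 * Real.pi))⁻¹ * 2 := by
          rw [Real.sqrt_eq_iff_mul_self_eq (by positivity) (by positivity), mul_mul_mul_comm,
            ← mul_inv, Real.mul_self_sqrt (by positivity)]
          field_simp
        rw [h1]; ring

theorem integrable_sq_gaussianReal : Integrable (fun x : ℝ => x ^ 2) (gaussianReal 0 1) :=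
  (memLp_id_gaussianReal (μ := 0) (v := 1) 2).integrable_sq

theorem integral_sq_gaussianReal : ∫ x : ℝ, x ^ 2 ∂gaussianReal 0 1 = 1 := by
  have h := variance_id_gaussianReal (μ := 0) (v := 1)
  rw [variance_eq_integral measurable_id.aemeasurable] at h
  simpa using h

instance (n : ℕ) : IsProbabilityMeasure (startLaw n) := by unfold startLaw; infer_instance

/-- An elementary form of Jensen's inequality: `√S ≤ (S / √m + √m) / 2`, where `S` has mean `m`. -/
theorem lintegral_sqrt_sum_sq_le (m : ℕ) :
    ∫⁻ z, ENNReal.ofReal √(∑ i, z i ^ 2) ∂startLaw m ≤ ENNReal.ofReal √m := by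
  rcases Nat.eq_zero_or_pos m with rfl | hm
  · simp
  have hs : 0 < √(m : ℝ) := Real.sqrt_pos.2 (Nat.cast_pos.2 hm)
  have hmp : ∀ i : Fin m, MeasurePreserving (fun z : Fin m → ℝ => z i) (startLaw m)
      (gaussianReal 0 1) := fun i => measurePreserving_eval (fun _ : Fin m => gaussianReal 0 1) i
  have hint : ∀ i : Fin m, Integrable (fun z : Fin m → ℝ => z i ^ 2) (startLaw m) := fun i =>
    (hmp i).integrable_comp_of_integrable integrable_sq_gaussianReal
  have hval : ∀ i : Fin m, ∫ z, z i ^ 2 ∂startLaw m = 1 := fun i => by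
    rw [← integral_sq_gaussianReal, ← (hmp i).map_eq,
      integral_map (hmp i).measurable.aemeasurable (by fun_prop)]
  have hsum : Integrable (fun z : Fin m → ℝ => ∑ i, z i ^ 2) (startLaw m) :=
    integrable_finsetSum _ fun i _ => hint i
  calc ∫⁻ z, ENNReal.ofReal √(∑ i, z i ^ 2) ∂startLaw m
      ≤ ∫⁻ z, ENNReal.ofReal (((√m)⁻¹ * ∑ i, z i ^ 2 + √m) / 2) ∂startLaw m := by
        refine lintegral_mono fun z => ENNReal.ofReal_le_ofReal ?_
        have h0 : 0 ≤ ∑ i, z i ^ 2 := Finset.sum_nonneg fun i _ => sq_nonneg _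
        have h1 := Real.sq_sqrt h0
        rw [le_div_iff₀ two_pos, ← sub_nonneg]
        have : (√m)⁻¹ * ∑ i, z i ^ 2 + √m - √(∑ i, z i ^ 2) * 2
            = (√m)⁻¹ * (√(∑ i, z i ^ 2) - √m) ^ 2 := by
          rw [sub_sq, h1]; field_simp
          rw [Real.sq_sqrt (Nat.cast_nonneg m)]; ring
        rw [this]; positivity
    _ = ENNReal.ofReal (∫ z, ((√m)⁻¹ * ∑ i, z i ^ 2 + √m) / 2 ∂startLaw m) := by
        rw [ofReal_integral_eq_lintegral_ofReal]
        · exact ((hsum.const_mul _).add (integrable_const _)).div_const 2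
        · exact ae_of_all _ fun z => by
            have : 0 ≤ ∑ i, z i ^ 2 := Finset.sum_nonneg fun i _ => sq_nonneg _
            simp only [Pi.zero_apply]
            positivity
    _ = ENNReal.ofReal √m := by
        rw [integral_div, integral_add (hsum.const_mul _) (integrable_const _),
          integral_const_mul, integral_finsetSum _ fun i _ => hint i,
          Finset.sum_congr rfl fun i _ => hval i]
        congr 1
        simp only [Finset.sum_const, Finset.card_univ, Fintype.card_fin, nsmul_eq_mul, mul_one,
          integral_const, probReal_univ, smul_eq_mul, one_mul]
        nth_rw 2 [← Real.mul_self_sqrt (Nat.cast_nonneg m)]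
        field_simp
        norm_num

/-- A coordinate of a Gaussian vector is rarely small compared to the others. -/
theorem startLaw_coord_small {m : ℕ} (i₀ : Fin (m + 1)) {a : ℝ} (ha : 0 ≤ a) :
    startLaw (m + 1) {y | y i₀ ^ 2 ≤ a ^ 2 * ∑ j, y (i₀.succAbove j) ^ 2} ≤
      ENNReal.ofReal (√(2 / Real.pi) * a * √m) := by
  have hmp := measurePreserving_piFinSuccAbove (fun _ : Fin (m + 1) => gaussianReal 0 1) i₀
  set S : Set (ℝ × (Fin m → ℝ)) := {q | q.1 ^ 2 ≤ a ^ 2 * ∑ j, q.2 j ^ 2} with hS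
  have hSm : MeasurableSet S := measurableSet_le (by fun_prop) (by fun_prop)
  have hpre : {y : Fin (m + 1) → ℝ | y i₀ ^ 2 ≤ a ^ 2 * ∑ j, y (i₀.succAbove j) ^ 2}
      = MeasurableEquiv.piFinSuccAbove (fun _ => ℝ) i₀ ⁻¹' S := rfl
  rw [startLaw, hpre, hmp.measure_preimage hSm.nullMeasurableSet,
    Measure.prod_apply_symm hSm]
  -- For fixed values `z` of the other coordinates, the remaining one is confined to an interval of
  -- radius `a ‖z‖`.
  calc ∫⁻ z, gaussianReal 0 1 ((fun x => (x, z)) ⁻¹' S) ∂startLaw m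
      ≤ ∫⁻ z, ENNReal.ofReal (√(2 / Real.pi) * a) * ENNReal.ofReal √(∑ i, z i ^ 2)
          ∂startLaw m := by
        refine lintegral_mono fun z => ?_
        rw [← ENNReal.ofReal_mul (by positivity), mul_assoc]
        refine le_trans (measure_mono fun x hx => ?_) (gaussianReal_abs_le _)
        have hx' : x ^ 2 ≤ a ^ 2 * ∑ j, z j ^ 2 := hx
        rw [Set.mem_ofPred_eq, ← Real.sqrt_sq ha, ← Real.sqrt_mul (sq_nonneg a)]
        exact Real.abs_le_sqrt hx'
    _ = ENNReal.ofReal (√(2 / Real.pi) * a) * ∫⁻ z, ENNReal.ofReal √(∑ i, z i ^ 2)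
          ∂startLaw m := by
        rw [lintegral_const_mul _ (by fun_prop)]
    _ ≤ _ := by
        rw [ENNReal.ofReal_mul (q := √m) (by positivity)]
        gcongr
        exact lintegral_sqrt_sum_sq_le m

end SmallBall

/-! ### Spectral analysis of the power method -/

section Spectral
variable {n : ℕ}

/-- An orthonormal eigenbasis of a symmetric matrix, in coordinates. -/
theorem exists_eigenbasis {M : Matrix (Fin n) (Fin n) ℝ} (hM : M.PosSemidef) :
    ∃ (e : Fin n → Fin n → ℝ) (μ : Fin n → ℝ), (∀ i, 0 ≤ μ i) ∧
      (∀ i x, e i ⬝ᵥ M.mulVec x = μ i * (e i ⬝ᵥ x)) ∧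
      (∀ x z, x ⬝ᵥ z = ∑ i, (e i ⬝ᵥ x) * (e i ⬝ᵥ z)) ∧
      MeasurePreserving (fun (g : Fin n → ℝ) i => e i ⬝ᵥ g) (startLaw n) (startLaw n) := by
  set b := hM.1.eigenvectorBasis with hb
  have hin : ∀ (i : Fin n) (x : Fin n → ℝ), (b i : Fin n → ℝ) ⬝ᵥ x
      = inner ℝ (b i) (WithLp.toLp 2 x) := fun i x => by
    simp [PiLp.inner_apply, dotProduct, mul_comm]
  refine ⟨fun i => b i, hM.1.eigenvalues, fun i => hM.eigenvalues_nonneg i, fun i x => ?_,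
    fun x z => ?_, ?_⟩
  · have hs : M.transpose = M := by simpa using hM.1.eq
    rw [Matrix.dotProduct_mulVec, ← Matrix.mulVec_transpose, hs, hM.1.mulVec_eigenvectorBasis,
      smul_dotProduct, smul_eq_mul]
  · have h := b.sum_inner_mul_inner (WithLp.toLp 2 x) (WithLp.toLp 2 z)
    have h2 : inner ℝ (WithLp.toLp 2 x : EuclideanSpace ℝ (Fin n)) (WithLp.toLp 2 z)
        = x ⬝ᵥ z := by
      simp [PiLp.inner_apply, dotProduct, mul_comm]
    rw [← h2, ← h]
    refine Finset.sum_congr rfl fun i _ => ?_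
    rw [hin, hin, real_inner_comm]
  · have hmeas : Measurable fun (g : Fin n → ℝ) (i : Fin n) => (b i : Fin n → ℝ) ⬝ᵥ g := by
      refine measurable_pi_lambda _ fun i => ?_
      simp only [dotProduct]
      fun_prop
    have hmeas' : Measurable fun (g : Fin n → ℝ) => ∑ i, g i • b i :=
      (by fun_prop : Continuous fun (g : Fin n → ℝ) => ∑ i, g i • b i).measurable
    have hofLp : Measurable (WithLp.ofLp : EuclideanSpace ℝ (Fin n) → Fin n → ℝ) := by fun_prop
    refine ⟨hmeas, ?_⟩
    -- Rotation invariance: assembling a vector from standard Gaussian coefficients in the basis `b`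
    -- preserves the standard law, and taking coefficients undoes this map.
    have h1 : (startLaw n).map (WithLp.toLp 2)
        = (startLaw n).map fun x : Fin n → ℝ => ∑ i, x i • b i :=
      map_pi_eq_stdGaussian.trans (stdGaussian_eq_map_pi_orthonormalBasis b)
    have h2 : startLaw n = (startLaw n).map
        (WithLp.ofLp ∘ fun x : Fin n → ℝ => ∑ i, x i • b i) := by
      rw [← Measure.map_map hofLp hmeas', ← h1, Measure.map_map hofLp (by fun_prop)]
      exact (Measure.map_id).symm
    conv_lhs => rw [h2]
    rw [Measure.map_map hmeas (hofLp.comp hmeas')]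
    have h3 : ((fun (g : Fin n → ℝ) (i : Fin n) => (b i : Fin n → ℝ) ⬝ᵥ g) ∘
        (WithLp.ofLp ∘ fun x : Fin n → ℝ => ∑ i, x i • b i)) = id := by
      funext x i
      simp only [Function.comp_apply, id]
      rw [hin, WithLp.toLp_ofLp, ← b.repr_apply_apply]
      have h4 : ∑ i, x i • b i = b.repr.symm (WithLp.toLp 2 x) :=
        b.sum_repr_symm (WithLp.toLp 2 x)
      rw [h4, b.repr.apply_symm_apply]
    rw [h3, Measure.map_id]

/-- The graph of the convex function `t ↦ t ^ (m + 1)` lies above its tangent at `x`. Consequently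
`x ^ m * (a - x) ≤ a ^ (m + 1) / (m + 1)`, a bound uniform in the smaller eigenvalues `x`, which
makes a spectral gap unnecessary. -/
theorem pow_mul_sub_le {x a : ℝ} (hx : 0 ≤ x) (ha : 0 ≤ a) (m : ℕ) :
    (m + 1) * (x ^ m * (a - x)) ≤ a ^ (m + 1) - x ^ (m + 1) := by
  induction m with
  | zero => simp
  | succ m ih =>
    have h1 := mul_le_mul_of_nonneg_left ih ha
    have h2 : 0 ≤ (m + 1 : ℝ) * x ^ m * (a - x) ^ 2 := by positivity
    push_cast
    have e1 : a ^ (m + 1 + 1) - x ^ (m + 1 + 1)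
        = a * (a ^ (m + 1) - x ^ (m + 1)) + x ^ (m + 1) * (a - x) := by ring
    have e2 : ((m : ℝ) + 1 + 1) * (x ^ (m + 1) * (a - x)) = a * ((m + 1) * (x ^ m * (a - x)))
        + x ^ (m + 1) * (a - x) - (m + 1) * x ^ m * (a - x) ^ 2 := by ring
    rw [e1, e2]
    linarith

/-- Normalisation only rescales, so `M ^ k g` can be analysed in place of the normalised iterate,
and the `0 / 0` convention matters only if this vector vanishes. -/
theorem powerStep_iterate_eq_smul (M : Matrix (Fin n) (Fin n) ℝ) (g : Fin n → ℝ) (k : ℕ) :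
    ∃ c : ℝ, (powerStep M)^[k] g = c • (M ^ k).mulVec g ∧ ((M ^ k).mulVec g ≠ 0 → c ≠ 0) := by
  induction k with
  | zero => exact ⟨1, by simp, fun _ => one_ne_zero⟩
  | succ k ih =>
    obtain ⟨c, hc, hc0⟩ := ih
    rw [Function.iterate_succ_apply', hc, powerStep, pow_succ', ← Matrix.mulVec_mulVec,
      Matrix.mulVec_smul]
    set w := M.mulVec ((M ^ k).mulVec g) with hw
    refine ⟨_, smul_smul _ _ _, fun h0 => ?_⟩
    have hc' : c ≠ 0 := hc0 fun h => h0 (by rw [hw, h, Matrix.mulVec_zero])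
    have hne : c • w ≠ 0 := smul_ne_zero hc' h0
    refine mul_ne_zero (inv_ne_zero ?_) hc'
    have : 0 < (c • w) ⬝ᵥ (c • w) := by
      refine lt_of_le_of_ne (Finset.sum_nonneg fun i _ => mul_self_nonneg _) fun h => hne ?_
      exact dotProduct_self_eq_zero.1 h.symm
    exact (Real.sqrt_pos.2 this).ne'

/-- The power method from a start vector whose leading coefficient is not too small. -/
theorem power_method_rayleigh {M : Matrix (Fin n) (Fin n) ℝ} {e : Fin n → Fin n → ℝ}
    {μ : Fin n → ℝ} (hμ : ∀ i, 0 ≤ μ i) (he : ∀ i x, e i ⬝ᵥ M.mulVec x = μ i * (e i ⬝ᵥ x))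
    (hp : ∀ x z, x ⬝ᵥ z = ∑ i, (e i ⬝ᵥ x) * (e i ⬝ᵥ z)) {i₀ : Fin n} (hi₀ : 0 < μ i₀)
    {τ : ℝ} (hτ1 : τ ≤ 1) {k : ℕ} (hk : 0 < k) {g : Fin n → ℝ}
    (hg : (1 - τ) ^ (2 * k + 1) / (2 * k + 1) * ∑ i ∈ Finset.univ.erase i₀, (e i ⬝ᵥ g) ^ 2
      < τ * (e i₀ ⬝ᵥ g) ^ 2) :
    (1 - τ) * μ i₀ ≤
      ((powerStep M)^[k] g) ⬝ᵥ M.mulVec ((powerStep M)^[k] g) := by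
  have hpow : ∀ (j : ℕ) (i : Fin n), e i ⬝ᵥ (M ^ j).mulVec g = μ i ^ j * (e i ⬝ᵥ g) := by
    intro j
    induction j with
    | zero => simp
    | succ j ih =>
      intro i
      rw [pow_succ', ← Matrix.mulVec_mulVec, he, ih, pow_succ']
      ring
  obtain ⟨c, hc, hc0⟩ := powerStep_iterate_eq_smul M g k
  set w := (M ^ k).mulVec g with hw
  have hτ' : 0 ≤ 1 - τ := sub_nonneg.2 hτ1
  -- The left side of the strict inequality `hg` is nonnegative, so the leading coefficient cannot
  -- vanish.
  have hy0 : e i₀ ⬝ᵥ g ≠ 0 := by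
    intro h
    rw [h, zero_pow two_ne_zero, mul_zero] at hg
    have : 0 ≤ (1 - τ) ^ (2 * k + 1) / (2 * k + 1) *
        ∑ i ∈ Finset.univ.erase i₀, (e i ⬝ᵥ g) ^ 2 :=
      mul_nonneg (by positivity) (Finset.sum_nonneg fun _ _ => sq_nonneg _)
    exact absurd hg (not_lt.2 this)
  have hw0 : w ≠ 0 := by
    intro h
    have := hpow k i₀
    rw [← hw, h, dotProduct_zero] at this
    exact mul_ne_zero (pow_ne_zero _ hi₀.ne') hy0 this.symm
  have hu1 : ((powerStep M)^[k] g) ⬝ᵥ ((powerStep M)^[k] g) = 1 := by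
    obtain ⟨k', rfl⟩ := Nat.exists_eq_succ_of_ne_zero hk.ne'
    have h := powerStep_dotProduct_self M ((powerStep M)^[k'] g)
    rw [← Function.iterate_succ_apply' (powerStep M)] at h
    refine h.resolve_left ?_
    rw [hc]
    exact smul_ne_zero (hc0 hw0) hw0
  have hray : (1 - τ) * μ i₀ * (w ⬝ᵥ w) ≤ w ⬝ᵥ M.mulVec w := by
    have h1 : w ⬝ᵥ M.mulVec w - (1 - τ) * μ i₀ * (w ⬝ᵥ w)
        = ∑ i, μ i ^ (2 * k) * (μ i - (1 - τ) * μ i₀) * (e i ⬝ᵥ g) ^ 2 := by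
      rw [hp w (M.mulVec w), hp w w, Finset.mul_sum, ← Finset.sum_sub_distrib]
      refine Finset.sum_congr rfl fun i _ => ?_
      rw [he, hw, hpow]
      ring
    rw [← sub_nonneg, h1, ← Finset.add_sum_erase _ _ (Finset.mem_univ i₀)]
    -- With `a = (1 - τ) μ i₀`, each other term is at least `-a ^ (2 k + 1) / (2 k + 1)` times its
    -- squared coefficient. By `hg` the leading term, `τ μ i₀ ^ (2 k + 1)` times its own, outweighs
    -- their sum.
    have h2 : ∀ i ∈ Finset.univ.erase i₀,
        -(((1 - τ) * μ i₀) ^ (2 * k + 1) / (2 * k + 1) * (e i ⬝ᵥ g) ^ 2) ≤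
          μ i ^ (2 * k) * (μ i - (1 - τ) * μ i₀) * (e i ⬝ᵥ g) ^ 2 := by
      intro i _
      rw [← neg_mul]
      refine mul_le_mul_of_nonneg_right ?_ (sq_nonneg _)
      have h3 := pow_mul_sub_le (hμ i) (mul_nonneg hτ' hi₀.le) (2 * k)
      have h4 : 0 ≤ μ i ^ (2 * k + 1) := pow_nonneg (hμ i) _
      have h5 : μ i ^ (2 * k) * ((1 - τ) * μ i₀ - μ i) ≤
          ((1 - τ) * μ i₀) ^ (2 * k + 1) / (2 * k + 1) := by
        rw [le_div_iff₀ (by positivity)]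
        push_cast at h3
        linarith
      linarith
    have h6 := Finset.sum_le_sum h2
    rw [Finset.sum_neg_distrib, ← Finset.mul_sum, mul_pow, mul_div_right_comm] at h6
    have h7 := mul_lt_mul_of_pos_left hg (pow_pos hi₀ (2 * k + 1))
    have h8 : μ i₀ ^ (2 * k) * (μ i₀ - (1 - τ) * μ i₀) * (e i₀ ⬝ᵥ g) ^ 2
        = μ i₀ ^ (2 * k + 1) * (τ * (e i₀ ⬝ᵥ g) ^ 2) := by ring
    rw [h8]
    linarith
  have hcc : c ^ 2 * (w ⬝ᵥ w) = 1 := by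
    rw [← hu1, hc, smul_dotProduct, dotProduct_smul, smul_eq_mul, smul_eq_mul]; ring
  have h9 := mul_le_mul_of_nonneg_left hray (sq_nonneg c)
  rw [hc, Matrix.mulVec_smul, smul_dotProduct, dotProduct_smul, smul_eq_mul, smul_eq_mul,
    ← mul_assoc, ← sq]
  calc (1 - τ) * μ i₀ = c ^ 2 * ((1 - τ) * μ i₀ * (w ⬝ᵥ w)) := by
        rw [mul_left_comm, hcc, mul_one]
    _ ≤ _ := h9

theorem frob_le_of_eigenbasis {M : Matrix (Fin n) (Fin n) ℝ} (hM : M.PosSemidef)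
    {e : Fin n → Fin n → ℝ} {μ : Fin n → ℝ}
    (he : ∀ i x, e i ⬝ᵥ M.mulVec x = μ i * (e i ⬝ᵥ x))
    (hp : ∀ x z, x ⬝ᵥ z = ∑ i, (e i ⬝ᵥ x) * (e i ⬝ᵥ z)) {i₀ : Fin n} (hi₀ : ∀ i, μ i ≤ μ i₀)
    {Y : Matrix (Fin n) (Fin n) ℝ} (hY : Y ∈ spectraplex n) : frob M Y ≤ μ i₀ := by
  have h : (μ i₀ • (1 : Matrix (Fin n) (Fin n) ℝ) - M).PosSemidef := by
    refine Matrix.PosSemidef.of_dotProduct_mulVec_nonneg ?_ fun v => ?_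
    · exact Matrix.IsHermitian.sub (by simp [Matrix.IsHermitian]) hM.1
    · rw [star_trivial, Matrix.sub_mulVec, Matrix.smul_mulVec, Matrix.one_mulVec, dotProduct_sub,
        dotProduct_smul, hp v v, hp v (M.mulVec v), smul_eq_mul, Finset.mul_sum,
        ← Finset.sum_sub_distrib]
      refine Finset.sum_nonneg fun i _ => ?_
      rw [he]
      nlinarith [mul_nonneg (sub_nonneg.2 (hi₀ i)) (mul_self_nonneg (e i ⬝ᵥ v))]
  have h2 := frob_nonneg h hY.1
  rw [frob_sub_left, frob_smul_left, frob_one_left, hY.2] at h2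
  linarith

end Spectral

/-! ### The power method satisfies the oracle guarantee -/

section PowerMethod

/-- The choice of `k` gives `(1 - τ) ^ (2 k) ≤ exp (-2 k τ) ≤ p² / (m + 1)`. As `m ≥ 1` and `p < 1`,
it also gives `2 k τ ≥ log 2 > 0.69 ≥ 2 / π`, so the denominator `(2 k + 1) τ` absorbs the constant
of the small-ball estimate. -/
theorem power_failure_bound {m : ℕ} (hm : 0 < m) {p τ : ℝ} (hp : 0 < p) (hp1 : p < 1)
    (hτ : 0 < τ) (hτ1 : τ ≤ 1) {k : ℕ}
    (hk : Real.log ((m + 1 : ℕ) / p ^ 2) / (2 * τ) ≤ k) :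
    √(2 / Real.pi) * √((1 - τ) ^ (2 * k + 1) / (2 * k + 1) / τ) * √m ≤ p := by
  have hτ' : 0 ≤ 1 - τ := sub_nonneg.2 hτ1
  have hm' : (1 : ℝ) ≤ m := Nat.one_le_cast.2 hm
  have hkτ : Real.log ((m + 1 : ℕ) / p ^ 2) ≤ 2 * k * τ := by
    rw [div_le_iff₀ (by positivity)] at hk; linarith
  have hp2 : p ^ 2 ≤ 1 := pow_le_one₀ hp.le hp1.le
  have h2 : Real.log 2 ≤ Real.log ((m + 1 : ℕ) / p ^ 2) := by
    refine Real.log_le_log two_pos ((le_div_iff₀ (by positivity)).2 ?_)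
    push_cast
    nlinarith
  have hlog : (0.69 : ℝ) < Real.log 2 := by linarith [Real.log_two_gt_d9]
  have hdec : (1 - τ) ^ (2 * k + 1) ≤ p ^ 2 / (m + 1) := by
    calc (1 - τ) ^ (2 * k + 1) ≤ (1 - τ) ^ (2 * k) :=
          pow_le_pow_of_le_one hτ' (by linarith) (by omega)
      _ ≤ Real.exp (-τ) ^ (2 * k) := by
          refine pow_le_pow_left₀ hτ' ?_ _
          linarith [Real.add_one_le_exp (-τ)]
      _ = Real.exp (-(2 * k * τ)) := by rw [← Real.exp_nat_mul]; push_cast; ring_nf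
      _ ≤ Real.exp (-Real.log ((m + 1 : ℕ) / p ^ 2)) := Real.exp_le_exp.2 (by linarith)
      _ = p ^ 2 / (m + 1) := by
          rw [Real.exp_neg, Real.exp_log (by positivity), inv_div]; push_cast; rfl
  have hpi : 2 / Real.pi ≤ 0.69 := by
    rw [div_le_iff₀ Real.pi_pos]; nlinarith [Real.pi_gt_d2]
  rw [← Real.sqrt_mul (by positivity), ← Real.sqrt_mul (by positivity)]
  refine Real.sqrt_le_iff.2 ⟨hp.le, ?_⟩
  have hden : 0.69 ≤ (2 * k + 1) * τ := by nlinarith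
  rw [div_div]
  calc 2 / Real.pi * ((1 - τ) ^ (2 * k + 1) / ((2 * k + 1) * τ)) * m
      ≤ 0.69 * (p ^ 2 / (m + 1) / 0.69) * m := by gcongr
    _ = p ^ 2 * (m / (m + 1)) := by ring
    _ ≤ p ^ 2 * 1 := by
        refine mul_le_mul_of_nonneg_left ((div_le_one (by positivity)).2 (by linarith))
          (sq_nonneg p)
    _ = p ^ 2 := mul_one _

variable {n d : ℕ} {I : Input n d}

/-- If the Rayleigh quotient of the vector of the power method is relatively close to the largest
eigenvalue, then the oracle satisfies its guarantee. -/
theorem plmo_guarantee (hI : I.Admissible) {X : Matrix (Fin n) (Fin n) ℝ}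
    (hX : IsFeasible I.A X) {δ : ℝ} (hδ : 0 < δ) {g : Fin n → ℝ} {top : ℝ}
    (htop : ∀ Y ∈ spectraplex n, frob (-gradB I.A X) Y ≤ top)
    (hray : (1 - relErr d I.c δ) * top ≤
      powerVec I X δ g ⬝ᵥ (-gradB I.A X).mulVec (powerVec I X δ g)) :
    (d : ℝ) < (plmo I X δ g).2 ∨ IsSubopt I.A δ X (plmo I X δ g).1 := by
  have hd : (0 : ℝ) < d := Nat.cast_pos.2 hI.d_pos
  have hc := hI.c_gt
  have hcd : 0 < I.c * d := mul_pos (by linarith) hd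
  have hlin : ∀ H, linObj I.A X H = -frob (-gradB I.A X) H := fun H => by
    rw [frob_neg_left, neg_neg]; rfl
  set u := powerVec I X δ g with hu
  rw [← frob_vecMulVec] at hray
  have hgap : approxGap I.A X (Matrix.vecMulVec u u)
      = frob (-gradB I.A X) (Matrix.vecMulVec u u) - d := by
    rw [approxGap, linObj_self hX, hlin]; ring
  -- The two entries of the minimum in `τ` serve one case each. If `top > c d`, then `τ ≤ (c - 2) /
  -- c` makes the Rayleigh quotient exceed `2 d`, hence the gap exceed `d`; otherwise the error `τ *
  -- top` is at most `δ`.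
  rcases lt_or_ge (I.c * d) top with h | h
  · left
    have hτ : relErr d I.c δ ≤ (I.c - 2) / I.c := by
      rw [relErr, div_le_div_iff₀ hcd (by linarith)]
      have := min_le_right δ ((I.c - 2) * d)
      nlinarith
    have hτ2 : 2 / I.c ≤ 1 - relErr d I.c δ := by
      have : 2 / I.c = 1 - (I.c - 2) / I.c := by field_simp; ring
      linarith
    have hbig : 2 * d < frob (-gradB I.A X) (Matrix.vecMulVec u u) := by
      refine lt_of_lt_of_le ?_ hray
      calc 2 * (d : ℝ) = 2 / I.c * (I.c * d) := by field_simp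
        _ < 2 / I.c * top := mul_lt_mul_of_pos_left h (by positivity)
        _ ≤ _ := mul_le_mul_of_nonneg_right hτ2 (hcd.trans h).le
    have hG : (d : ℝ) < approxGap I.A X (Matrix.vecMulVec u u) := by rw [hgap]; linarith
    rw [plmo, if_neg (not_lt.2 (hd.trans hG).le)]
    exact hG
  · right
    have hτ : relErr d I.c δ * top ≤ δ := by
      calc relErr d I.c δ * top ≤ relErr d I.c δ * (I.c * d) :=
            mul_le_mul_of_nonneg_left h (relErr_pos hI.d_pos hc hδ).le
        _ = min δ ((I.c - 2) * d) := by rw [relErr, div_mul_cancel₀ _ hcd.ne']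
        _ ≤ δ := min_le_left _ _
    intro Y hY
    have hYt := htop Y hY
    rw [hlin, hlin]
    rw [plmo]
    split_ifs with hneg
    -- The fallback means `⟨J, u uᵀ⟩ < d = ⟨J, X⟩`, so `X` is even better than `u uᵀ` and inherits
    -- its guarantee.
    · have h2 : frob (-gradB I.A X) X = d := by
        have := linObj_self hX
        rw [hlin] at this
        linarith
      rw [hgap] at hneg
      simp only [h2]
      linarith
    · simp only
      linarith

theorem isPLMO_plmo (hI : I.Admissible) : IsPLMO I.A I.p (plmo I) := by
  refine fun X hX δ hδ => ⟨fun g => plmo_spec hI hX hδ g, ?_⟩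
  have hM := neg_gradB_posSemidef hI.psd hX.1.1
  obtain ⟨e, μ, hμ, he, hp, hlaw⟩ := exists_eigenbasis hM
  have hn := hI.n_pos
  have hd : (0 : ℝ) < d := Nat.cast_pos.2 hI.d_pos
  obtain ⟨m, rfl⟩ := Nat.exists_eq_succ_of_ne_zero hn.ne'
  obtain ⟨i₀, hi₀⟩ := Finite.exists_max μ
  have htop := fun Y hY => frob_le_of_eigenbasis hM he hp hi₀ (Y := Y) hY
  have hpos : 0 < μ i₀ := by
    have h1 := htop X hX.1
    have h2 := linObj_self hX
    rw [linObj] at h2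
    rw [frob_neg_left, h2] at h1
    linarith
  set τ := relErr d I.c δ with hτ
  have hτ0 : 0 < τ := relErr_pos hI.d_pos hI.c_gt hδ
  have hτ1 : τ ≤ 1 := by
    have hc := hI.c_gt
    rw [hτ, relErr, div_le_one (mul_pos (by linarith) hd)]
    refine (min_le_right _ _).trans ?_
    nlinarith
  set k := powerCount (m + 1) d I.p I.c δ with hk
  have hk0 : 0 < k := powerCount_pos hn hI.d_pos hI.p_pos hI.p_lt hI.c_gt hδ
  have hk1 : Real.log ((m + 1 : ℕ) / I.p ^ 2) / (2 * τ) ≤ k := Nat.le_ceil _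
  -- The threshold for the ratio of the squared leading coefficient to the sum of the other squares,
  -- as required by `power_method_rayleigh`.
  set a2 := (1 - τ) ^ (2 * k + 1) / (2 * k + 1) / τ with ha2
  have ha20 : 0 ≤ a2 := by
    have : 0 ≤ 1 - τ := sub_nonneg.2 hτ1
    positivity
  set B : Set (Fin (m + 1) → ℝ) :=
    {y | y i₀ ^ 2 ≤ √a2 ^ 2 * ∑ j, y (i₀.succAbove j) ^ 2} with hB
  have hBm : MeasurableSet B := measurableSet_le (by fun_prop) (by fun_prop)
  have hBp : startLaw (m + 1) B ≤ ENNReal.ofReal I.p := by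
    refine (startLaw_coord_small i₀ (Real.sqrt_nonneg a2)).trans (ENNReal.ofReal_le_ofReal ?_)
    -- For `n = 1` there are no other coordinates and the small-ball bound is zero;
    -- `power_failure_bound` needs `n ≥ 2`.
    rcases Nat.eq_zero_or_pos m with h0 | h0
    · simp [h0, hI.p_pos.le]
    · exact power_failure_bound h0 hI.p_pos hI.p_lt hτ0 hτ1 hk1
  have hcompl : ENNReal.ofReal (1 - I.p) ≤ startLaw (m + 1) Bᶜ := by
    rw [prob_compl_eq_one_sub hBm, ENNReal.ofReal_sub _ hI.p_pos.le, ENNReal.ofReal_one]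
    exact tsub_le_tsub_left hBp 1
  rw [← hlaw.measure_preimage hBm.compl.nullMeasurableSet] at hcompl
  refine hcompl.trans (measure_mono fun g hg => ?_)
  refine plmo_guarantee hI hX hδ htop (power_method_rayleigh hμ he hp hpos hτ1 hk0 ?_)
  have hg' : √a2 ^ 2 * ∑ j, (e (i₀.succAbove j) ⬝ᵥ g) ^ 2 < (e i₀ ⬝ᵥ g) ^ 2 := not_le.1 hg
  have hsum : ∑ i ∈ Finset.univ.erase i₀, (e i ⬝ᵥ g) ^ 2
      = ∑ j, (e (i₀.succAbove j) ⬝ᵥ g) ^ 2 := by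
    have h1 := Fin.sum_univ_succAbove (fun i => (e i ⬝ᵥ g) ^ 2) i₀
    have h2 := Finset.add_sum_erase Finset.univ (fun i => (e i ⬝ᵥ g) ^ 2) (Finset.mem_univ i₀)
    linarith
  rw [hsum]
  rw [Real.sq_sqrt ha20, ha2, div_mul_eq_mul_div, div_lt_iff₀ hτ0] at hg'
  linarith

end PowerMethod

/-! ### Measurability of the oracle and of its failure -/

section Measurability
variable {n d : ℕ} {I : Input n d} {α : Type*} [MeasurableSpace α]

theorem measurable_meas {A : Fin d → Matrix (Fin n) (Fin n) ℝ} {X : α → Matrix (Fin n) (Fin n) ℝ}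
    (hX : ∀ i j, Measurable fun a => X a i j) (i : Fin d) :
    Measurable fun a => meas A (X a) i := by
  simp only [meas, frob_eq_sum]
  exact Finset.measurable_sum _ fun j _ => Finset.measurable_sum _ fun k _ =>
    (hX j k).const_mul _

theorem measurable_gradB {A : Fin d → Matrix (Fin n) (Fin n) ℝ}
    {X : α → Matrix (Fin n) (Fin n) ℝ} (hX : ∀ i j, Measurable fun a => X a i j) (j k : Fin n) :
    Measurable fun a => gradB A (X a) j k := by
  simp only [gradB, Matrix.neg_apply, Matrix.sum_apply, Matrix.smul_apply, smul_eq_mul]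
  exact (Finset.measurable_sum _ fun i _ => (measurable_meas hX i).inv.mul_const _).neg

theorem measurable_linObj {A : Fin d → Matrix (Fin n) (Fin n) ℝ}
    {X H : α → Matrix (Fin n) (Fin n) ℝ} (hX : ∀ i j, Measurable fun a => X a i j)
    (hH : ∀ i j, Measurable fun a => H a i j) :
    Measurable fun a => linObj A (X a) (H a) := by
  simp only [linObj, frob_eq_sum]
  exact Finset.measurable_sum _ fun j _ => Finset.measurable_sum _ fun k _ =>
    (measurable_gradB hX j k).mul (hH j k)

theorem measurable_approxGap {A : Fin d → Matrix (Fin n) (Fin n) ℝ}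
    {X H : α → Matrix (Fin n) (Fin n) ℝ} (hX : ∀ i j, Measurable fun a => X a i j)
    (hH : ∀ i j, Measurable fun a => H a i j) :
    Measurable fun a => approxGap A (X a) (H a) :=
  (measurable_linObj hX hX).sub (measurable_linObj hX hH)

theorem measurable_localDist {A : Fin d → Matrix (Fin n) (Fin n) ℝ}
    {X H : α → Matrix (Fin n) (Fin n) ℝ} (hX : ∀ i j, Measurable fun a => X a i j)
    (hH : ∀ i j, Measurable fun a => H a i j) :
    Measurable fun a => localDist A (X a) (H a) := by
  refine (Finset.measurable_sum _ fun i _ => Measurable.pow_const (Measurable.div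
    (measurable_meas (fun j k => ?_) i) (measurable_meas hX i)) 2).sqrt
  exact (hH j k).sub (hX j k)

theorem measurable_mulVec {M : α → Matrix (Fin n) (Fin n) ℝ} {x : α → Fin n → ℝ}
    (hM : ∀ i j, Measurable fun a => M a i j) (hx : Measurable x) :
    Measurable fun a => (M a).mulVec (x a) := by
  refine measurable_pi_lambda _ fun i => ?_
  simp only [Matrix.mulVec, dotProduct]
  exact Finset.measurable_sum _ fun j _ => (hM i j).mul ((measurable_pi_apply j).comp hx)

theorem measurable_powerStep {M : α → Matrix (Fin n) (Fin n) ℝ} {x : α → Fin n → ℝ}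
    (hM : ∀ i j, Measurable fun a => M a i j) (hx : Measurable x) :
    Measurable fun a => powerStep (M a) (x a) := by
  have h := measurable_mulVec hM hx
  simp only [powerStep]
  refine Measurable.smul (Measurable.inv (Measurable.sqrt ?_)) h
  simp only [dotProduct]
  exact Finset.measurable_sum _ fun j _ =>
    ((measurable_pi_apply j).comp h).mul ((measurable_pi_apply j).comp h)

theorem measurable_powerCount {p c : ℝ} {δ : α → ℝ} (hδ : Measurable δ) :
    Measurable fun a => powerCount n d p c (δ a) := by
  unfold powerCount relErr
  refine Nat.measurable_ceil.comp (Measurable.const_div ?_ _)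
  exact ((hδ.min measurable_const).div_const _).const_mul _

/-- The number of steps varies with `δ`, but it is a natural number: measurability for each fixed
number of steps gives joint measurability, into which the measurable step count is substituted. -/
theorem measurable_powerVec {X : α → Matrix (Fin n) (Fin n) ℝ} {δ : α → ℝ} {g : α → Fin n → ℝ}
    (hX : ∀ i j, Measurable fun a => X a i j) (hδ : Measurable δ) (hg : Measurable g) :
    Measurable fun a => powerVec I (X a) (δ a) (g a) := by
  have h : ∀ k : ℕ, Measurable fun a => (powerStep (-gradB I.A (X a)))^[k] (g a) := by
    intro k
    induction k with
    | zero => simpa using hg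
    | succ k ih =>
      simp only [Function.iterate_succ_apply']
      exact measurable_powerStep (fun i j => (measurable_gradB hX i j).neg) ih
  have h2 : Measurable fun q : ℕ × α => (powerStep (-gradB I.A (X q.2)))^[q.1] (g q.2) :=
    measurable_from_prod_countable_right h
  have h3 := h2.comp
    ((measurable_powerCount (n := n) (d := d) (p := I.p) (c := I.c) hδ).prodMk measurable_id)
  simp only [powerVec]
  exact h3

theorem measurable_plmo {X : α → Matrix (Fin n) (Fin n) ℝ} {δ : α → ℝ} {g : α → Fin n → ℝ}
    (hX : ∀ i j, Measurable fun a => X a i j) (hδ : Measurable δ) (hg : Measurable g) :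
    (∀ i j, Measurable fun a => (plmo I (X a) (δ a) (g a)).1 i j) ∧
      Measurable fun a => (plmo I (X a) (δ a) (g a)).2 := by
  have hu := measurable_powerVec (I := I) hX hδ hg
  have hH : ∀ i j, Measurable fun a => Matrix.vecMulVec (powerVec I (X a) (δ a) (g a))
      (powerVec I (X a) (δ a) (g a)) i j := fun i j =>
    ((measurable_pi_apply i).comp hu).mul ((measurable_pi_apply j).comp hu)
  have hG := measurable_approxGap (A := I.A) hX hH
  have hs := measurableSet_lt hG (measurable_const (a := (0 : ℝ)))
  refine ⟨fun i j => ?_, ?_⟩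
  · have heq : (fun a => (plmo I (X a) (δ a) (g a)).1 i j) = fun a =>
        if approxGap I.A (X a) (Matrix.vecMulVec (powerVec I (X a) (δ a) (g a))
          (powerVec I (X a) (δ a) (g a))) < 0 then X a i j
        else Matrix.vecMulVec (powerVec I (X a) (δ a) (g a)) (powerVec I (X a) (δ a) (g a)) i j := by
      funext a
      simp only [plmo]
      split_ifs <;> rfl
    rw [heq]
    exact Measurable.ite hs (hX i j) (hH i j)
  · have heq : (fun a => (plmo I (X a) (δ a) (g a)).2) = fun a =>
        if approxGap I.A (X a) (Matrix.vecMulVec (powerVec I (X a) (δ a) (g a))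
          (powerVec I (X a) (δ a) (g a))) < 0 then 0
        else approxGap I.A (X a) (Matrix.vecMulVec (powerVec I (X a) (δ a) (g a))
          (powerVec I (X a) (δ a) (g a))) := by
      funext a
      simp only [plmo]
      split_ifs <;> rfl
    rw [heq]
    exact Measurable.ite hs measurable_const hG

/-- Linear inequalities on the spectraplex can be tested on a countable subset. -/
theorem exists_countable_test_spectraplex (n : ℕ) :
    ∃ D : Set (Matrix (Fin n) (Fin n) ℝ), D ⊆ spectraplex n ∧ D.Countable ∧
      ∀ (M : Matrix (Fin n) (Fin n) ℝ) (a b : ℝ), (∀ Y ∈ D, a ≤ frob M Y + b) →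
        ∀ Y ∈ spectraplex n, a ≤ frob M Y + b := by
  have hs : TopologicalSpace.SeparableSpace (Matrix (Fin n) (Fin n) ℝ) :=
    inferInstanceAs (TopologicalSpace.SeparableSpace (Fin n → Fin n → ℝ))
  have hm : TopologicalSpace.PseudoMetrizableSpace (Matrix (Fin n) (Fin n) ℝ) :=
    inferInstanceAs (TopologicalSpace.PseudoMetrizableSpace (Fin n → Fin n → ℝ))
  obtain ⟨D, hDs, hDc, hDd⟩ := (TopologicalSpace.IsSeparable.of_separableSpace
    (spectraplex n)).exists_countable_dense_subset
  refine ⟨D, hDs, hDc, fun M a b h Y hY => ?_⟩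
  have hcont : Continuous fun Y : Matrix (Fin n) (Fin n) ℝ => frob M Y + b := by
    unfold frob
    fun_prop
  exact closure_minimal h (isClosed_le continuous_const hcont) (hDd hY)

theorem measurableSet_isSubopt {A : Fin d → Matrix (Fin n) (Fin n) ℝ}
    {X H : α → Matrix (Fin n) (Fin n) ℝ} {δ : α → ℝ} (hX : ∀ i j, Measurable fun a => X a i j)
    (hδ : Measurable δ) (hH : ∀ i j, Measurable fun a => H a i j) :
    MeasurableSet {a | IsSubopt A (δ a) (X a) (H a)} := by
  obtain ⟨D, hDs, hDc, hD⟩ := exists_countable_test_spectraplex n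
  have heq : {a | IsSubopt A (δ a) (X a) (H a)} =
      ⋂ Y ∈ D, {a | linObj A (X a) (H a) ≤ linObj A (X a) Y + δ a} := by
    ext a
    rw [Set.mem_iInter₂]
    exact ⟨fun h Y hY => h Y (hDs hY), fun h => hD _ _ _ h⟩
  rw [heq]
  refine MeasurableSet.biInter hDc fun Y _ => measurableSet_le (measurable_linObj hX hH)
    (Measurable.add ?_ hδ)
  exact measurable_linObj (H := fun _ => Y) hX fun _ _ => measurable_const

end Measurability

/-! ### Failure probabilities along the iteration -/

section Independence
variable {n d : ℕ} {I : Input n d}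

/-- The guarantee of the oracle is violated, if it is called in state `s` with randomness `g`. -/
def OracleFails (I : Input n d) (t : ℕ) (s : Iterate n) (g : Fin n → ℝ) : Prop :=
  ¬((d : ℝ) < (plmo I s.X (s.delta I t) g).2 ∨
    IsSubopt I.A (s.delta I t) s.X (plmo I s.X (s.delta I t) g).1)

theorem fails_iff (ρ : ℕ → ℝ) (t : ℕ) :
    Fails I ρ t ↔ OracleFails I t (states I ρ t) (startVec n ρ t) := Iff.rfl

theorem measurableSet_oracleFails (hr : ∀ t, Measurable (I.rule t)) {α : Type*}
    [MeasurableSpace α] {s : α → Iterate n} {g : α → Fin n → ℝ}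
    (hX : ∀ i j, Measurable fun a => (s a).X i j) (hb : Measurable fun a => (s a).best)
    (hg : Measurable g) (t : ℕ) : MeasurableSet {a | OracleFails I t (s a) (g a)} := by
  have hδ : Measurable fun a => (s a).delta I t := (hr t).comp hb
  obtain ⟨h1, h2⟩ := measurable_plmo (I := I) hX hδ hg
  exact ((measurableSet_lt measurable_const h2).union (measurableSet_isSubopt hX hδ h1)).compl

theorem startLaw_oracleFails_le (hI : I.Admissible) (hr : ∀ t, Measurable (I.rule t))
    {s : Iterate n} (hs : IsFeasible I.A s.X) (hb : 0 ≤ s.best) (t : ℕ) :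
    startLaw n {g | OracleFails I t s g} ≤ ENNReal.ofReal I.p := by
  have h := (isPLMO_plmo hI s.X hs (s.delta I t) (hI.rule_pos t _ hb)).2
  have hm : MeasurableSet {g | OracleFails I t s g} :=
    measurableSet_oracleFails hr (s := fun _ => s) (fun _ _ => measurable_const)
      measurable_const measurable_id t
  have heq : {g | (d : ℝ) < (plmo I s.X (s.delta I t) g).2 ∨
      IsSubopt I.A (s.delta I t) s.X (plmo I s.X (s.delta I t) g).1}
      = {g | OracleFails I t s g}ᶜ := by
    ext g; simp only [OracleFails, Set.mem_compl_iff, Set.mem_ofPred_eq, not_not]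
  rw [heq, prob_compl_eq_one_sub hm, ENNReal.ofReal_sub _ hI.p_pos.le, ENNReal.ofReal_one] at h
  exact (ENNReal.sub_le_sub_iff_left (prob_le_one) ENNReal.one_ne_top).1 h

theorem measurable_startVec (t : ℕ) : Measurable fun ρ : ℕ → ℝ => startVec n ρ t :=
  measurable_pi_lambda _ fun j => measurable_pi_apply (t * n + (j : ℕ))

/-- The counter can be left out: failures refer to the recursion continued without stopping, which
does not involve it. -/
theorem measurable_states (hr : ∀ t, Measurable (I.rule t)) (t : ℕ) :
    (∀ i j, Measurable fun ρ => (states I ρ t).X i j) ∧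
      Measurable fun ρ => (states I ρ t).best := by
  induction t with
  | zero => exact ⟨fun _ _ => measurable_const, measurable_const⟩
  | succ t ih =>
    obtain ⟨hX, hb⟩ := ih
    have hδ : Measurable fun ρ => (states I ρ t).delta I t := (hr t).comp hb
    obtain ⟨h1, h2⟩ := measurable_plmo (I := I) hX hδ (measurable_startVec t)
    have hD := measurable_localDist (A := I.A) hX h1
    have hγ : Measurable fun ρ => stepAt I ρ t :=
      (h2.div (hD.mul (hD.add h2))).min measurable_const
    refine ⟨fun i j => ?_, ?_⟩
    · exact ((measurable_const.sub hγ).mul (hX i j)).add (hγ.mul (h1 i j))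
    · simp only [states_succ_best]
      split_ifs
      · exact h2
      · exact hb.min h2

theorem states_congr {ρ ρ' : ℕ → ℝ} {t : ℕ} (h : ∀ k < t * n, ρ k = ρ' k) :
    states I ρ t = states I ρ' t := by
  induction t with
  | zero => rfl
  | succ t ih =>
    rw [Nat.succ_mul] at h
    have hv : startVec n ρ t = startVec n ρ' t := funext fun j => h _ (by omega)
    rw [states, states, ih fun k hk => h k (by omega), hv]

theorem fails_congr {ρ ρ' : ℕ → ℝ} {t : ℕ} (h : ∀ k < (t + 1) * n, ρ k = ρ' k) :
    Fails I ρ t ↔ Fails I ρ' t := by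
  rw [Nat.succ_mul] at h
  have hv : startVec n ρ t = startVec n ρ' t := funext fun j => h _ (by omega)
  rw [fails_iff, fails_iff, states_congr fun k hk => h k (by omega), hv]

/-- The first `N` terms of a sequence, followed by zeros. -/
def truncate (N : ℕ) (ρ : ℕ → ℝ) : ℕ → ℝ := fun k => if k < N then ρ k else 0

theorem measurable_truncate (N : ℕ) : Measurable (truncate N) :=
  measurable_pi_lambda _ fun k => by
    simp only [truncate]
    split_ifs
    · exact measurable_pi_apply k
    · exact measurable_const

/-- Truncation keeps the past in the form of a full sequence, to which `states` can be applied, and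
makes it independent of the current start vector. -/
theorem indepFun_truncate_startVec (t : ℕ) :
    IndepFun (truncate (t * n)) (fun ρ => startVec n ρ t) stdStream := by
  have h := iIndepFun_stdStream.indepFun_finset (Finset.range (t * n))
    (Finset.Ico (t * n) (t * n + n)) (by
      rw [Finset.disjoint_left]
      intro k hk hk'
      have := Finset.mem_range.1 hk
      have := (Finset.mem_Ico.1 hk').1
      omega) fun k => measurable_pi_apply k
  have h1 : Measurable fun (y : Finset.range (t * n) → ℝ) (k : ℕ) =>
      if hk : k < t * n then y ⟨k, Finset.mem_range.2 hk⟩ else 0 :=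
    measurable_pi_lambda _ fun k => by
      split_ifs
      · exact measurable_pi_apply _
      · exact measurable_const
  have h2 : Measurable fun (y : Finset.Ico (t * n) (t * n + n) → ℝ) (j : Fin n) =>
      y ⟨t * n + j, Finset.mem_Ico.2 ⟨by omega, by omega⟩⟩ :=
    measurable_pi_lambda _ fun j => measurable_pi_apply _
  have h3 := h.comp h1 h2
  convert h3 using 1
  · funext ρ k
    simp only [truncate, Function.comp_apply, dite_eq_ite]
  · rfl

instance : IsProbabilityMeasure stdStream := by unfold stdStream; infer_instance

theorem map_startVec (t : ℕ) : stdStream.map (fun ρ => startVec n ρ t) = startLaw n := by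
  have hinj : Function.Injective fun j : Fin n => t * n + (j : ℕ) := fun i j h =>
    Fin.ext (by simpa using h)
  have h := iIndepFun.map_fun_eq_pi_map (f := fun (j : Fin n) (ρ : ℕ → ℝ) => ρ (t * n + (j : ℕ)))
    (fun j => (measurable_pi_apply (t * n + (j : ℕ))).aemeasurable)
    (iIndepFun_stdStream.precomp hinj)
  have h2 : (fun j : Fin n => stdStream.map fun ρ : ℕ → ℝ => ρ (t * n + (j : ℕ)))
      = fun _ => gaussianReal 0 1 := funext fun j => map_eval_stdStream _
  rw [h2] at h
  exact h

/-- The largest index `t` is split off. The earlier failures and the state at `t` are functions of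
the truncated sequence, so Fubini and the bound `p`, uniform in the state, contribute one more
factor. The failures themselves need not be independent. -/
theorem stdStream_forall_fails_le (hI : I.Admissible) (hr : ∀ t, Measurable (I.rule t))
    (S : Finset ℕ) :
    stdStream {ρ | ∀ s ∈ S, Fails I ρ s} ≤ ENNReal.ofReal I.p ^ S.card := by
  induction S using Finset.induction_on_max with
  | empty => simp
  | insert t S hlt ih =>
    have hmem : t ∉ S := fun h => (hlt t h).ne rfl
    set N := t * n with hN
    have hfail : ∀ s, MeasurableSet {ρ | Fails I ρ s} := fun s =>
      measurableSet_oracleFails hr (measurable_states hr s).1 (measurable_states hr s).2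
        (measurable_startVec s) s
    have hE : MeasurableSet {ρ | ∀ s ∈ S, Fails I ρ s} := by
      simp only [Set.ofPred_forall]
      exact Finset.measurableSet_biInter _ fun s _ => hfail s
    have hW : MeasurableSet {q : (ℕ → ℝ) × (Fin n → ℝ) |
        (∀ s ∈ S, Fails I q.1 s) ∧ OracleFails I t (states I q.1 t) q.2} := by
      refine (hE.preimage measurable_fst).inter ?_
      exact measurableSet_oracleFails hr
        (fun i j => ((measurable_states hr t).1 i j).comp measurable_fst)
        ((measurable_states hr t).2.comp measurable_fst) measurable_snd t
    set W := {q : (ℕ → ℝ) × (Fin n → ℝ) |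
        (∀ s ∈ S, Fails I q.1 s) ∧ OracleFails I t (states I q.1 t) q.2} with hWdef
    have htr : ∀ ρ s, s ∈ S → (Fails I (truncate N ρ) s ↔ Fails I ρ s) := fun ρ s hs =>
      fails_congr fun k hk => if_pos <| hk.trans_le <| by
        rw [hN]; exact Nat.mul_le_mul_right n (hlt s hs)
    have hset : {ρ | ∀ s ∈ insert t S, Fails I ρ s} =
        (fun ρ => (truncate N ρ, startVec n ρ t)) ⁻¹' W := by
      ext ρ
      simp only [Set.mem_ofPred_eq, Set.mem_preimage, hWdef, Finset.forall_mem_insert]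
      rw [and_comm, fails_iff ρ t,
        states_congr (ρ := truncate N ρ) (ρ' := ρ) (t := t) fun k hk => if_pos hk]
      exact and_congr_left fun _ => forall₂_congr fun s hs => (htr ρ s hs).symm
    have hset' : {ρ | ∀ s ∈ S, Fails I ρ s} =
        truncate N ⁻¹' {ρ | ∀ s ∈ S, Fails I ρ s} := by
      ext ρ
      exact forall₂_congr fun s hs => (htr ρ s hs).symm
    have hpair := (measurable_truncate N).prodMk (measurable_startVec (n := n) t)
    have hlaw := (indepFun_iff_map_prod_eq_prod_map_map (measurable_truncate N).aemeasurable
      (measurable_startVec (n := n) t).aemeasurable).1 (indepFun_truncate_startVec (n := n) t)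
    rw [hset, ← Measure.map_apply hpair hW, hlaw, map_startVec, Measure.prod_apply hW,
      Finset.card_insert_of_notMem hmem, pow_succ]
    calc ∫⁻ y, startLaw n (Prod.mk y ⁻¹' W) ∂stdStream.map (truncate N)
        ≤ ∫⁻ y, {ρ | ∀ s ∈ S, Fails I ρ s}.indicator (fun _ => ENNReal.ofReal I.p) y
            ∂stdStream.map (truncate N) := by
          refine lintegral_mono fun y => ?_
          by_cases hy : y ∈ {ρ | ∀ s ∈ S, Fails I ρ s}
          · rw [Set.indicator_of_mem hy]
            obtain ⟨h1, h2⟩ := feasible_and_best_nonneg hI y t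
            exact (measure_mono fun g hg => hg.2).trans (startLaw_oracleFails_le hI hr h1 h2 t)
          · rw [Set.indicator_of_notMem hy]
            have : Prod.mk y ⁻¹' W = ∅ := by
              ext g
              simp only [Set.mem_preimage, Set.mem_empty_iff_false, iff_false]
              exact fun hg => hy hg.1
            rw [this, measure_empty]
      _ = ENNReal.ofReal I.p * stdStream {ρ | ∀ s ∈ S, Fails I ρ s} := by
          rw [lintegral_indicator_const hE, Measure.map_apply (measurable_truncate N) hE, ← hset']
      _ ≤ _ := by
          rw [mul_comm]
          exact mul_le_mul_left ih _

theorem IsScheduled.measurable {tol : ℝ} {rule : ℕ → ℝ → ℝ} (h : IsScheduled tol rule) (t : ℕ) :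
    Measurable (rule t) := by
  obtain ⟨s, -, -, hs⟩ := h
  rw [show rule t = fun _ => s t from funext (hs t)]
  exact measurable_const

/-- The complement of success is covered by the events that all calls in `S` fail, over the
`l`-subsets `S` of the first `K` indices. The recursion is defined beyond the stopping time, so
these index sets are deterministic; subadditivity alone is used, so the success event need not be
shown measurable. -/
theorem isEpsOptimal_probability {T : ℕ} (hI : I.Admissible) (hr : ∀ t, Measurable (I.rule t))
    (htol : I.tol ≤ d) (hT : FewLargeDelta n d I.tol I.rule T) :
    ENNReal.ofReal (1 - (numLarge n d I.tol + T + I.l).choose I.l * I.p ^ I.l) ≤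
      stdStream {ρ | IsEpsOptimal I.A (5 * I.tol / 2) (finalX I ρ)} := by
  set K := numLarge n d I.tol + T + I.l with hK
  set B := ⋃ S ∈ (Finset.range K).powersetCard I.l, {ρ | ∀ s ∈ S, Fails I ρ s} with hB
  have hBle : stdStream B ≤ ENNReal.ofReal (K.choose I.l * I.p ^ I.l) := by
    refine (measure_biUnion_finset_le _ _).trans ?_
    calc ∑ S ∈ (Finset.range K).powersetCard I.l, stdStream {ρ | ∀ s ∈ S, Fails I ρ s}
        ≤ ∑ S ∈ (Finset.range K).powersetCard I.l, ENNReal.ofReal I.p ^ I.l :=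
          Finset.sum_le_sum fun S hS => (stdStream_forall_fails_le hI hr S).trans_eq
            (by rw [(Finset.mem_powersetCard.1 hS).2])
      _ = _ := by
          rw [Finset.sum_const, Finset.card_powersetCard, Finset.card_range, nsmul_eq_mul,
            ENNReal.ofReal_mul (by positivity), ENNReal.ofReal_pow hI.p_pos.le,
            ENNReal.ofReal_natCast]
  have hcover : Set.univ ⊆ {ρ | IsEpsOptimal I.A (5 * I.tol / 2) (finalX I ρ)} ∪ B := by
    intro ρ _
    by_cases h : IsEpsOptimal I.A (5 * I.tol / 2) (finalX I ρ)
    · exact Or.inl h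
    · obtain ⟨S, hS, hf⟩ := exists_fails_of_not_isEpsOptimal hI htol hT h
      exact Or.inr (Set.mem_biUnion hS hf)
  have h1 := (measure_mono hcover).trans (measure_union_le (μ := stdStream) _ _)
  rw [measure_univ] at h1
  rw [ENNReal.ofReal_sub _ (mul_nonneg (Nat.cast_nonneg _) (pow_nonneg hI.p_pos.le _)),
    ENNReal.ofReal_one, tsub_le_iff_right]
  exact h1.trans (add_le_add_right hBle _)

end Independence

/-! ### Total-correctness rules for the machine -/

section Logic
variable {n d : ℕ} {I : Input n d} {tape : Bool → ℕ → ℝ} {M₁ M₂ : ℕ}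

/-- The command `c`, started in `s`, terminates in a configuration that satisfies `Q`. -/
def Runs (I : Input n d) (tape : Bool → ℕ → ℝ) (M₁ M₂ : ℕ) (c : Cmd) (s : Config)
    (Q : Config → Prop) : Prop := ∃ s', Exec I tape M₁ M₂ c s s' ∧ Q s'

theorem Runs.mono {c : Cmd} {s : Config} {P Q : Config → Prop} (h : Runs I tape M₁ M₂ c s P)
    (hPQ : ∀ s', P s' → Q s') : Runs I tape M₁ M₂ c s Q :=
  let ⟨s', h1, h2⟩ := h
  ⟨s', h1, hPQ s' h2⟩

theorem runs_setN {r : ℕ} {e : NExp} {s : Config} {Q : Config → Prop} (h : r < M₁)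
    (hQ : Q { s with ints := Function.update s.ints r (e.eval I s) }) :
    Runs I tape M₁ M₂ (.setN r e) s Q := ⟨_, .setN r e s h, hQ⟩

theorem runs_setR {a : NExp} {e : RExp} {s : Config} {Q : Config → Prop} (h : a.eval I s < M₂)
    (hQ : Q { s with reals := Function.update s.reals (a.eval I s) (e.eval I s) }) :
    Runs I tape M₁ M₂ (.setR a e) s Q := ⟨_, .setR a e s h, hQ⟩

theorem runs_draw {b : Bool} {a : NExp} {s : Config} {Q : Config → Prop} (h : a.eval I s < M₂)
    (hQ : Q { s with
      reals := Function.update s.reals (a.eval I s) (tape b (s.heads b))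
      heads := Function.update s.heads b (s.heads b + 1) }) :
    Runs I tape M₁ M₂ (.draw b a) s Q := ⟨_, .draw b a s h, hQ⟩

theorem Runs.seq {c₁ c₂ : Cmd} {s : Config} {P Q : Config → Prop}
    (h : Runs I tape M₁ M₂ c₁ s P) (h' : ∀ s', P s' → Runs I tape M₁ M₂ c₂ s' Q) :
    Runs I tape M₁ M₂ (.seq c₁ c₂) s Q := by
  obtain ⟨s', h1, hP⟩ := h
  obtain ⟨s'', h2, hQ⟩ := h' s' hP
  exact ⟨s'', .seq _ _ _ _ _ h1 h2, hQ⟩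

theorem runs_ifLE {x y : RExp} {c₁ c₂ : Cmd} {s : Config} {Q : Config → Prop}
    (h₁ : x.eval I s ≤ y.eval I s → Runs I tape M₁ M₂ c₁ s Q)
    (h₂ : ¬ x.eval I s ≤ y.eval I s → Runs I tape M₁ M₂ c₂ s Q) :
    Runs I tape M₁ M₂ (.ifLE x y c₁ c₂) s Q := by
  by_cases h : x.eval I s ≤ y.eval I s
  · obtain ⟨s', h1, hQ⟩ := h₁ h
    exact ⟨s', .ifTrue _ _ _ _ _ _ h h1, hQ⟩
  · obtain ⟨s', h1, hQ⟩ := h₂ h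
    exact ⟨s', .ifFalse _ _ _ _ _ _ h h1, hQ⟩

/-- The number `N` of passes is given in advance and indexes the invariant, so termination is part
of the conclusion. -/
theorem runs_while {x y : RExp} {c : Cmd} {s : Config} (N : ℕ) (P : ℕ → Config → Prop)
    (h0 : P 0 s) (hlt : ∀ k < N, ∀ s, P k s → x.eval I s < y.eval I s)
    (hstep : ∀ k < N, ∀ s, P k s → Runs I tape M₁ M₂ c s (P (k + 1)))
    (hhalt : ∀ s, P N s → ¬ x.eval I s < y.eval I s) :
    Runs I tape M₁ M₂ (.whileLT x y c) s (P N) := by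
  have key : ∀ m, ∀ k, k + m = N → ∀ s, P k s → Runs I tape M₁ M₂ (.whileLT x y c) s (P N) := by
    intro m
    induction m with
    | zero =>
      rintro k rfl s hs
      exact ⟨s, .whileStop _ _ _ _ (hhalt s hs), hs⟩
    | succ m ih =>
      intro k hk s hs
      obtain ⟨s', h1, hP⟩ := hstep k (by omega) s hs
      obtain ⟨s'', h2, hQ⟩ := ih (k + 1) (by omega) s' hP
      exact ⟨s'', .whileStep _ _ _ _ _ _ (hlt k (by omega) s hs) h1 h2, hQ⟩
  exact key N 0 (zero_add N) s h0

/-- The loop `for r < N`. -/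
def forDo (r : ℕ) (N : NExp) (c : Cmd) : Cmd :=
  .seq (.setN r (.const 0))
    (.whileLT (.ofNat (.cell r)) (.ofNat N) (.seq c (.setN r (.add (.cell r) (.const 1)))))

theorem runs_forDo {r : ℕ} {N : NExp} {c : Cmd} {s : Config} {m : ℕ} (P : ℕ → Config → Prop)
    (hr : r < M₁) (hN : ∀ s, N.eval I s = m)
    (h0 : P 0 { s with ints := Function.update s.ints r 0 })
    (hstep : ∀ k < m, ∀ s, s.ints r = k → P k s → Runs I tape M₁ M₂ c s
      fun s' => s'.ints r = k ∧ P (k + 1) { s' with ints := Function.update s'.ints r (k + 1) }) :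
    Runs I tape M₁ M₂ (forDo r N c) s (P m) := by
  refine Runs.seq (P := fun s => s.ints r = 0 ∧ P 0 s) (runs_setN hr ?_) fun s hs => ?_
  · exact ⟨by simp [NExp.eval], h0⟩
  · refine (runs_while m (fun k s => s.ints r = k ∧ P k s) hs ?_ ?_ ?_).mono fun s h => h.2
    · rintro k hk s ⟨h1, -⟩
      simp only [RExp.eval, NExp.eval, hN, h1]
      exact_mod_cast hk
    · rintro k hk s ⟨h1, h2⟩
      refine (hstep k hk s h1 h2).seq fun s' h' => runs_setN hr ?_
      simp only [NExp.eval, h'.1]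
      exact ⟨by simp, h'.2⟩
    · rintro s ⟨h1, -⟩
      simp [RExp.eval, NExp.eval, hN, h1]

/-- The configuration `s'` agrees with `s` in the first `L` integer cells, in the real cells
outside `S`, and in the positions on the tapes. -/
structure Frame (L : ℕ) (S : ℕ → Prop) (s s' : Config) : Prop where
  ints : ∀ r < L, s'.ints r = s.ints r
  reals : ∀ a, ¬ S a → s'.reals a = s.reals a
  heads : s'.heads = s.heads

theorem Frame.trans {L : ℕ} {S : ℕ → Prop} {s s' s'' : Config} (h : Frame L S s s')
    (h' : Frame L S s' s'') : Frame L S s s'' :=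
  ⟨fun r hr => (h'.ints r hr).trans (h.ints r hr),
    fun a ha => (h'.reals a ha).trans (h.reals a ha), h'.heads.trans h.heads⟩

theorem Frame.mono {L L' : ℕ} {S S' : ℕ → Prop} {s s' : Config} (h : Frame L S s s')
    (hL : L' ≤ L) (hS : ∀ a, S a → S' a) : Frame L' S' s s' :=
  ⟨fun r hr => h.ints r (hr.trans_le hL), fun a ha => h.reals a fun h => ha (hS a h), h.heads⟩

theorem Frame.refl (L : ℕ) (S : ℕ → Prop) (s : Config) : Frame L S s s :=
  ⟨fun _ _ => rfl, fun _ _ => rfl, rfl⟩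

theorem frame_setInt {L r : ℕ} (S : ℕ → Prop) (s : Config) (v : ℕ) (h : L ≤ r) :
    Frame L S s { s with ints := Function.update s.ints r v } :=
  ⟨fun r' hr' => Function.update_of_ne (by omega) _ _, fun _ _ => rfl, rfl⟩

theorem frame_setReal {S : ℕ → Prop} (L : ℕ) (s : Config) {a : ℕ} (v : ℝ) (h : S a) :
    Frame L S s { s with reals := Function.update s.reals a v } :=
  ⟨fun _ _ => rfl, fun b hb => Function.update_of_ne (fun hba => hb (by rw [hba]; exact h)) _ _, rfl⟩

/-- A sum, accumulated in the real cell `a` by a loop whose body adds a summand. -/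
def sumDo (r : ℕ) (a : NExp) (N : NExp) (c : Cmd) : Cmd :=
  .seq (.setR a (.ofNat (.const 0))) (forDo r N c)

/-- A loop with counter `r` preserves the integer cells below `r`, while its body must also preserve
`r` itself. Nested loops therefore use increasing counters, and their frames compose. -/
theorem runs_sumDo {r : ℕ} {a N : NExp} {c : Cmd} {s : Config} {m α : ℕ} (f : Fin m → ℝ)
    (S : ℕ → Prop) (hr : r < M₁) (hN : ∀ s, N.eval I s = m) (ha : a.eval I s = α) (hα : α < M₂)
    (hS : S α)
    (hc : ∀ (k : Fin m) (s' : Config), Frame r S s s' → s'.ints r = k →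
      Runs I tape M₁ M₂ c s' fun s'' => Frame (r + 1) S s' s'' ∧
        s''.reals α = s'.reals α + f k) :
    Runs I tape M₁ M₂ (sumDo r a N c) s fun s' => Frame r S s s' ∧ s'.reals α = ∑ k, f k := by
  set f' : ℕ → ℝ := fun k => if h : k < m then f ⟨k, h⟩ else 0 with hf'
  have hsum : ∑ k, f k = ∑ k ∈ Finset.range m, f' k := by
    rw [Finset.sum_range]; simp [hf']
  rw [hsum]
  refine Runs.seq (P := fun s' => Frame r S s s' ∧ s'.reals α = 0) (runs_setR (ha ▸ hα) ?_)
    fun s1 h1 => ?_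
  · rw [ha]
    exact ⟨frame_setReal r s _ hS, by simp [RExp.eval, NExp.eval]⟩
  refine runs_forDo (fun k s' => Frame r S s s' ∧ s'.reals α = ∑ i ∈ Finset.range k, f' i)
    hr hN ?_ ?_
  · exact ⟨h1.1.trans (frame_setInt S s1 0 le_rfl), by simpa using h1.2⟩
  · rintro k hk s2 h2 ⟨h3, h4⟩
    refine (hc ⟨k, hk⟩ s2 h3 h2).mono fun s3 h5 => ?_
    refine ⟨(h5.1.ints r (by omega)).trans h2, ?_, ?_⟩
    · exact (h3.trans (h5.1.mono (by omega) fun _ h => h)).trans (frame_setInt S s3 _ le_rfl)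
    · simp only
      rw [h5.2, h4, Finset.sum_range_succ]
      simp [hf', hk]

/-- A sum of expressions. -/
def sumExp (r : ℕ) (a : NExp) (N : NExp) (e : RExp) : Cmd :=
  sumDo r a N (.setR a (.add (.cell a) e))

theorem runs_sumExp {r : ℕ} {a N : NExp} {e : RExp} {s : Config} {m α : ℕ} (f : Fin m → ℝ)
    (S : ℕ → Prop) (hr : r < M₁) (hN : ∀ s, N.eval I s = m)
    (ha : ∀ s', Frame r S s s' → a.eval I s' = α) (hα : α < M₂) (hS : S α)
    (he : ∀ (k : Fin m) (s' : Config), Frame r S s s' → s'.ints r = k → e.eval I s' = f k) :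
    Runs I tape M₁ M₂ (sumExp r a N e) s fun s' => Frame r S s s' ∧ s'.reals α = ∑ k, f k := by
  refine runs_sumDo f S hr hN (ha s (Frame.refl _ _ _)) hα hS fun k s' h1 h2 => ?_
  have h3 := ha s' h1
  refine runs_setR (h3 ▸ hα) ?_
  rw [h3]
  refine ⟨frame_setReal _ _ _ hS, ?_⟩
  simp [RExp.eval, h3, he k s' h1 h2]

/-- A loop whose body computes the entry `r` of a vector that is stored from cell `α` on. -/
theorem runs_mapDo {r : ℕ} {N : NExp} {c : Cmd} {s : Config} {m : ℕ} (α : ℕ) (f : Fin m → ℝ)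
    (S : ℕ → Prop) (hr : r < M₁) (hN : ∀ s, N.eval I s = m) (hα : ∀ k < m, ¬ S (α + k))
    (hc : ∀ (k : Fin m) (s' : Config), Frame r (fun a => S a ∨ α ≤ a ∧ a < α + k) s s' →
      s'.ints r = k → Runs I tape M₁ M₂ c s' fun s'' =>
        Frame (r + 1) (fun a => S a ∨ a = α + k) s' s'' ∧ s''.reals (α + k) = f k) :
    Runs I tape M₁ M₂ (forDo r N c) s fun s' =>
      Frame r (fun a => S a ∨ α ≤ a ∧ a < α + m) s s' ∧ ∀ k : Fin m, s'.reals (α + k) = f k := by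
  refine (runs_forDo (fun k s' => Frame r (fun a => S a ∨ α ≤ a ∧ a < α + k) s s' ∧
    ∀ i : Fin m, (i : ℕ) < k → s'.reals (α + i) = f i) hr hN ?_ ?_).mono fun s' h =>
      ⟨h.1, fun k => h.2 k k.isLt⟩
  · exact ⟨frame_setInt _ s 0 le_rfl, fun i hi => absurd hi (Nat.not_lt_zero _)⟩
  · rintro k hk s2 h2 ⟨h3, h4⟩
    refine (hc ⟨k, hk⟩ s2 h3 h2).mono fun s3 h5 => ?_
    refine ⟨(h5.1.ints r (by omega)).trans h2, ?_, fun i hi => ?_⟩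
    · refine Frame.trans (Frame.trans (h3.mono le_rfl ?_) (h5.1.mono (by omega) ?_))
        (frame_setInt _ s3 _ le_rfl)
      · rintro a (h | h)
        · exact Or.inl h
        · exact Or.inr (by omega)
      · rintro a (h | h)
        · exact Or.inl h
        · exact Or.inr (by simp only at h; omega)
    · simp only
      rcases Nat.lt_succ_iff_lt_or_eq.1 hi with h | rfl
      · rw [h5.1.reals, h4 i h]
        rintro (h' | h')
        · exact hα i i.isLt h'
        · simp only at h'; omega
      · exact h5.2

theorem runs_mapExp {r : ℕ} {a N : NExp} {e : RExp} {s : Config} {m : ℕ} (α : ℕ) (f : Fin m → ℝ)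
    (hr : r < M₁) (hN : ∀ s, N.eval I s = m) (hα : α + m ≤ M₂)
    (ha : ∀ (k : Fin m) (s' : Config), s'.ints r = k → a.eval I s' = α + k)
    (he : ∀ (k : Fin m) (s' : Config), Frame r (fun a => α ≤ a ∧ a < α + k) s s' →
      s'.ints r = k → e.eval I s' = f k) :
    Runs I tape M₁ M₂ (forDo r N (.setR a e)) s fun s' =>
      Frame r (fun a => α ≤ a ∧ a < α + m) s s' ∧ ∀ k : Fin m, s'.reals (α + k) = f k := by
  refine (runs_mapDo α f (fun _ => False) hr hN (fun _ _ h => h) fun k s' h1 h2 => ?_).mono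
    fun s' h => ⟨h.1.mono le_rfl fun a ha => ha.resolve_left id, h.2⟩
  have h3 := ha k s' h2
  refine runs_setR (by rw [h3]; omega) ?_
  rw [h3]
  refine ⟨frame_setReal _ _ _ (Or.inr rfl), ?_⟩
  simp only [Function.update_self]
  exact he k s' (h1.mono le_rfl fun a ha => ha.resolve_left id) h2

/-- A loop that draws a vector from a tape. -/
theorem runs_drawLoop {r : ℕ} {a N : NExp} {b : Bool} {s : Config} {m : ℕ} (α : ℕ)
    (hr : r < M₁) (hN : ∀ s, N.eval I s = m) (hα : α + m ≤ M₂)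
    (ha : ∀ (k : Fin m) (s' : Config), s'.ints r = k → a.eval I s' = α + k) :
    Runs I tape M₁ M₂ (forDo r N (.draw b a)) s fun s' =>
      (∀ r' < r, s'.ints r' = s.ints r') ∧
      (∀ a, ¬ (α ≤ a ∧ a < α + m) → s'.reals a = s.reals a) ∧
      s'.heads = Function.update s.heads b (s.heads b + m) ∧
      ∀ k : Fin m, s'.reals (α + k) = tape b (s.heads b + k) := by
  -- `Frame` fixes the tape positions, which move here, so the invariant is spelled out.
  refine (runs_forDo (fun k s' => (∀ r' < r, s'.ints r' = s.ints r') ∧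
      (∀ a, ¬ (α ≤ a ∧ a < α + k) → s'.reals a = s.reals a) ∧
      s'.heads = Function.update s.heads b (s.heads b + k) ∧
      ∀ i : Fin m, (i : ℕ) < k → s'.reals (α + i) = tape b (s.heads b + i)) hr hN ?_ ?_).mono
        fun s' h => ⟨h.1, h.2.1, h.2.2.1, fun k => h.2.2.2 k k.isLt⟩
  · exact ⟨fun r' h => Function.update_of_ne (by omega) _ _, fun _ _ => rfl, by simp,
      fun i hi => absurd hi (Nat.not_lt_zero _)⟩
  · rintro k hk s2 h2 ⟨h3, h4, h5, h6⟩
    have h7 : a.eval I s2 = α + k := ha ⟨k, hk⟩ s2 h2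
    refine runs_draw (by rw [h7]; omega) ?_
    rw [h7]
    have h8 : s2.heads b = s.heads b + k := by rw [h5]; simp
    refine ⟨h2, fun r' h => ?_, fun a' ha' => ?_, ?_, fun i hi => ?_⟩
    · simp only
      rw [Function.update_of_ne (by omega), h3 r' h]
    · simp only
      rw [Function.update_of_ne (by omega), h4 a' (by omega)]
    · simp only
      rw [h8, h5, Function.update_idem, add_assoc]
    · simp only
      rcases Nat.lt_succ_iff_lt_or_eq.1 hi with h | h
      · rw [Function.update_of_ne (by omega), h6 i h]
      · rw [h, Function.update_self, h8]

end Logic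

/-! ### The program and its matrix-vector routines -/

section Program

/-! The memory layout: `z`, `x`, `y` (of length `n`), `v`, `h` (of length `d`), then the scalars
`best, δ, τ, lim, tmp, norm, G, ζ, γ, D`. -/

def xAddr (e : NExp) : NExp := .add .dimN e
def yAddr (e : NExp) : NExp := .add (.mul (.const 2) .dimN) e
def vAddr (e : NExp) : NExp := .add (.mul (.const 3) .dimN) e
def hAddr (e : NExp) : NExp := .add (.add (.mul (.const 3) .dimN) .dimD) e
def scalarAddr (q : ℕ) : NExp :=
  .add (.add (.mul (.const 3) .dimN) (.mul (.const 2) .dimD)) (.const q)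

/-- `y ← J x`. -/
def matVecCmd : Cmd :=
  forDo 3 .dimN (sumDo 4 (yAddr (.cell 3)) .dimD (.seq
    (sumExp 5 (scalarAddr 4) .dimN
      (.mul (.entry (.cell 4) (.cell 3) (.cell 5)) (.cell (xAddr (.cell 5)))))
    (.setR (yAddr (.cell 3)) (.add (.cell (yAddr (.cell 3)))
      (.div (.cell (scalarAddr 4)) (.cell (vAddr (.cell 4))))))))

/-- `x ← J x / ‖J x‖`. -/
def powerStepCmd : Cmd :=
  .seq matVecCmd (.seq
    (sumExp 3 (scalarAddr 5) .dimN (.mul (.cell (yAddr (.cell 3))) (.cell (yAddr (.cell 3)))))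
    (forDo 3 .dimN (.setR (xAddr (.cell 3))
      (.div (.cell (yAddr (.cell 3))) (.sqrt (.cell (scalarAddr 5)))))))

/-- `h i ← ⟨A i, x xᵀ⟩`. -/
def quadCmd : Cmd :=
  forDo 3 .dimD (sumDo 4 (hAddr (.cell 3)) .dimN (.seq
    (sumExp 5 (scalarAddr 4) .dimN
      (.mul (.entry (.cell 3) (.cell 4) (.cell 5)) (.cell (xAddr (.cell 5)))))
    (.setR (hAddr (.cell 3)) (.add (.cell (hAddr (.cell 3)))
      (.mul (.cell (scalarAddr 4)) (.cell (xAddr (.cell 4))))))))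

/-- `G ← ∑ i, h i / v i - v i / v i`. -/
def gapCmd : Cmd :=
  sumExp 3 (scalarAddr 6) .dimD
    (.sub (.div (.cell (hAddr (.cell 3))) (.cell (vAddr (.cell 3))))
      (.div (.cell (vAddr (.cell 3))) (.cell (vAddr (.cell 3)))))

/-- The squared local distance. -/
def distCmd : Cmd :=
  sumExp 3 (scalarAddr 9) .dimD
    (.mul
      (.div (.sub (.cell (hAddr (.cell 3))) (.cell (vAddr (.cell 3)))) (.cell (vAddr (.cell 3))))
      (.div (.sub (.cell (hAddr (.cell 3))) (.cell (vAddr (.cell 3)))) (.cell (vAddr (.cell 3)))))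

/-- A write to the scratch counter stands in for the empty command. -/
def skipCmd : Cmd := .setN 3 (.const 0)

/-- The gap that the oracle returns, and the step size. -/
def stepCmd : Cmd :=
  .seq gapCmd (.ifLE (.ofNat (.const 0)) (.cell (scalarAddr 6))
    (.seq distCmd (.seq (.setR (scalarAddr 9) (.sqrt (.cell (scalarAddr 9)))) (.seq
      (.setR (scalarAddr 8) (.div (.cell (scalarAddr 6)) (.mul (.cell (scalarAddr 9))
        (.add (.cell (scalarAddr 9)) (.cell (scalarAddr 6))))))
      (.ifLE (.ofNat (.const 1)) (.cell (scalarAddr 8))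
        (.setR (scalarAddr 8) (.ofNat (.const 1))) skipCmd))))
    (.seq (.setR (scalarAddr 6) (.ofNat (.const 0)))
      (.setR (scalarAddr 8) (.ofNat (.const 0)))))

/-- `lim ← log (n / p²) / (2 τ)`. -/
def limitCmd : Cmd :=
  .seq (.setR (scalarAddr 1) (.rule (.cell 0) (.cell (scalarAddr 0)))) (.seq
    (.setR (scalarAddr 2) (.mul (.sub .constC (.ofNat (.const 2))) (.ofNat .dimD))) (.seq
    (.ifLE (.cell (scalarAddr 1)) (.cell (scalarAddr 2))
      (.setR (scalarAddr 2) (.cell (scalarAddr 1))) skipCmd)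
    (.setR (scalarAddr 3) (.div (.log (.div (.ofNat .dimN) (.mul .failProb .failProb)))
      (.mul (.ofNat (.const 2))
        (.div (.cell (scalarAddr 2)) (.mul .constC (.ofNat .dimD))))))))

/-- The power method. -/
def powerCmd : Cmd :=
  .seq (.setN 2 (.const 0)) (.whileLT (.ofNat (.cell 2)) (.cell (scalarAddr 3))
    (.seq powerStepCmd (.setN 2 (.add (.cell 2) (.const 1)))))

/-- The new values `v` and `z`. -/
def updateCmd : Cmd :=
  .seq (forDo 3 .dimD (.setR (vAddr (.cell 3)) (.add
      (.mul (.sub (.ofNat (.const 1)) (.cell (scalarAddr 8))) (.cell (vAddr (.cell 3))))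
      (.mul (.cell (scalarAddr 8)) (.cell (hAddr (.cell 3)))))))
    (forDo 3 .dimN (.setR (.cell 3) (.add
      (.mul (.sqrt (.sub (.ofNat (.const 1)) (.cell (scalarAddr 8)))) (.cell (.cell 3)))
      (.mul (.mul (.sqrt (.cell (scalarAddr 8))) (.cell (scalarAddr 7)))
        (.cell (xAddr (.cell 3)))))))

/-- The new values of the counters and of the smallest gap. -/
def bookkeepingCmd : Cmd :=
  .seq (.ifLE (.cell (scalarAddr 6)) .tol
      (.ifLE (.cell (scalarAddr 1)) (.div (.mul (.ofNat (.const 3)) .tol) (.ofNat (.const 2)))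
        (.setN 1 (.add (.cell 1) (.const 1))) skipCmd) skipCmd) (.seq
    (.ifLE (.ofNat (.cell 0)) (.ofNat (.const 0))
      (.setR (scalarAddr 0) (.cell (scalarAddr 6)))
      (.ifLE (.cell (scalarAddr 0)) (.cell (scalarAddr 6)) skipCmd
        (.setR (scalarAddr 0) (.cell (scalarAddr 6)))))
    (.setN 0 (.add (.cell 0) (.const 1))))

def initCmd : Cmd :=
  .seq (forDo 3 .dimN (.draw true (.cell 3))) (.seq
    (forDo 3 .dimN (.setR (.cell 3) (.div (.cell (.cell 3)) (.sqrt (.ofNat .dimN)))))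
    (forDo 3 .dimD (sumExp 4 (vAddr (.cell 3)) .dimN
      (.div (.entry (.cell 3) (.cell 4) (.cell 4)) (.ofNat .dimN)))))

/-- The number `ζ` is drawn even if the step size turns out to be zero, so the tape positions are
determined by `t`. -/
def iterationCmd : Cmd :=
  .seq (forDo 3 .dimN (.draw false (xAddr (.cell 3)))) (.seq
    (.draw true (scalarAddr 7)) (.seq limitCmd (.seq powerCmd (.seq quadCmd (.seq stepCmd
      (.seq updateCmd bookkeepingCmd))))))

/-- The whole method. -/
def methodCmd : Cmd :=
  .seq initCmd (.whileLT (.ofNat (.cell 1)) (.ofNat .target) iterationCmd)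

variable {n d : ℕ} {I : Input n d} {tape : Bool → ℕ → ℝ} {M₁ M₂ : ℕ}

theorem entry_eq (I : Input n d) (i : Fin d) (j k : Fin n) : I.entry i j k = I.A i j k := by
  simp [Input.entry]

/-- The matrix `J` is never formed: `(J x) j = ∑ i, (A i x) j / ⟨A i, X⟩` needs only the input, the
stored measurements and one scalar accumulator besides `y`. -/
theorem runs_matVecCmd {s : Config} {x : Fin n → ℝ} {v : Fin d → ℝ} (h1 : 6 ≤ M₁)
    (h2 : 3 * n + 2 * d + 10 ≤ M₂) (hx : ∀ j : Fin n, s.reals (n + j) = x j)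
    (hv : ∀ i : Fin d, s.reals (3 * n + i) = v i) :
    Runs I tape M₁ M₂ matVecCmd s fun s' =>
      Frame 3 (fun a => a = 3 * n + 2 * d + 4 ∨ 2 * n ≤ a ∧ a < 2 * n + n) s s' ∧
      ∀ j : Fin n, s'.reals (2 * n + j) = ∑ i, (∑ k, I.A i j k * x k) / v i := by
  refine runs_mapDo (2 * n) _ (fun a => a = 3 * n + 2 * d + 4) (by omega) (fun _ => rfl)
    (fun k hk => by omega) fun j s1 f1 hj => ?_
  refine runs_sumDo _ (fun a => a = 3 * n + 2 * d + 4 ∨ a = 2 * n + j) (by omega) (fun _ => rfl)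
    (congrArg (2 * n + ·) hj) (by omega) (Or.inr rfl) fun i s2 f2 hi => ?_
  have hj2 : s2.ints 3 = j := (f2.ints 3 (by omega)).trans hj
  refine (runs_sumExp (fun k => I.A i j k * x k) (fun a => a = 3 * n + 2 * d + 4) (by omega)
    (fun _ => rfl) (α := 3 * n + 2 * d + 4) (fun _ _ => rfl) (by omega) rfl
    fun k s3 f3 hk => ?_).seq fun s3 h3 => ?_
  · have e1 : s3.ints 3 = j := (f3.ints 3 (by omega)).trans hj2
    have e2 : s3.ints 4 = i := (f3.ints 4 (by omega)).trans hi
    have e3 : s3.reals (n + k) = x k := by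
      rw [f3.reals _ (by omega), f2.reals _ (by omega), f1.reals _ (by omega), hx]
    simp only [RExp.eval, NExp.eval, xAddr, e1, e2, hk, e3, entry_eq]
  · obtain ⟨f3, h4⟩ := h3
    have e1 : s3.ints 3 = j := (f3.ints 3 (by omega)).trans hj2
    have e2 : s3.ints 4 = i := (f3.ints 4 (by omega)).trans hi
    have e3 : s3.reals (3 * n + i) = v i := by
      rw [f3.reals _ (by omega), f2.reals _ (by omega), f1.reals _ (by omega), hv]
    have e4 : s3.reals (2 * n + j) = s2.reals (2 * n + j) := f3.reals _ (by omega)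
    have e5 : (yAddr (.cell 3)).eval I s3 = 2 * n + j := congrArg (2 * n + ·) e1
    refine runs_setR (by rw [e5]; omega) ?_
    rw [e5]
    refine ⟨(f3.mono le_rfl fun a ha => Or.inl ha).trans (frame_setReal _ _ _ (Or.inr rfl)), ?_⟩
    simp only [Function.update_self, RExp.eval, NExp.eval, e5, scalarAddr, vAddr, e2, e3, e4, h4]

theorem mulVec_neg_gradB (A : Fin d → Matrix (Fin n) (Fin n) ℝ) (X : Matrix (Fin n) (Fin n) ℝ)
    (x : Fin n → ℝ) (j : Fin n) :
    (-gradB A X).mulVec x j = ∑ i, (∑ k, A i j k * x k) / meas A X i := by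
  rw [gradB, neg_neg, Matrix.sum_mulVec, Finset.sum_apply]
  refine Finset.sum_congr rfl fun i _ => ?_
  rw [Matrix.smul_mulVec, Pi.smul_apply, smul_eq_mul, div_eq_inv_mul]
  rfl

theorem runs_powerStepCmd {s : Config} {x : Fin n → ℝ} {X : Matrix (Fin n) (Fin n) ℝ}
    (h1 : 6 ≤ M₁) (h2 : 3 * n + 2 * d + 10 ≤ M₂) (hx : ∀ j : Fin n, s.reals (n + j) = x j)
    (hv : ∀ i : Fin d, s.reals (3 * n + i) = meas I.A X i) :
    Runs I tape M₁ M₂ powerStepCmd s fun s' =>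
      Frame 3 (fun a => a = 3 * n + 2 * d + 4 ∨ a = 3 * n + 2 * d + 5 ∨ n ≤ a ∧ a < 3 * n) s s' ∧
      ∀ j : Fin n, s'.reals (n + j) = powerStep (-gradB I.A X) x j := by
  refine (runs_matVecCmd h1 h2 hx hv).seq fun s1 ⟨f1, hy⟩ => ?_
  simp_rw [← mulVec_neg_gradB] at hy
  set y := (-gradB I.A X).mulVec x with hydef
  refine (runs_sumExp (fun j => y j * y j) (fun a => a = 3 * n + 2 * d + 5) (by omega)
    (fun _ => rfl) (α := 3 * n + 2 * d + 5) (fun _ _ => rfl) (by omega) rfl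
    fun k s2 f2 hk => ?_).seq fun s2 ⟨f2, hs⟩ => ?_
  · have e : s2.reals (2 * n + k) = y k := by rw [f2.reals _ (by omega), hy]
    simp only [RExp.eval, NExp.eval, yAddr, hk, e]
  · refine (runs_mapExp (a := xAddr (.cell 3)) n (fun j => powerStep (-gradB I.A X) x j) (by omega) (fun _ => rfl)
      (by omega) (fun k s' h => congrArg (n + ·) h) fun k s3 f3 hk => ?_).mono fun s3 h3 => ?_
    · have e : s3.reals (2 * n + k) = y k := by
        rw [f3.reals _ (by omega), f2.reals _ (by omega), hy]
      have e' : s3.reals (3 * n + 2 * d + 5) = ∑ j, y j * y j := by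
        rw [f3.reals _ (by omega), hs]
      simp only [RExp.eval, NExp.eval, yAddr, scalarAddr, hk, e, e', powerStep, Pi.smul_apply,
        smul_eq_mul, dotProduct, ← hydef]
      rw [div_eq_inv_mul]
    · refine ⟨((f1.mono le_rfl ?_).trans (f2.mono le_rfl ?_)).trans (h3.1.mono le_rfl ?_), h3.2⟩
      all_goals intro a ha; omega

theorem runs_quadCmd {s : Config} {x : Fin n → ℝ} (h1 : 6 ≤ M₁)
    (h2 : 3 * n + 2 * d + 10 ≤ M₂) (hx : ∀ j : Fin n, s.reals (n + j) = x j) :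
    Runs I tape M₁ M₂ quadCmd s fun s' =>
      Frame 3 (fun a => a = 3 * n + 2 * d + 4 ∨ 3 * n + d ≤ a ∧ a < 3 * n + d + d) s s' ∧
      ∀ i : Fin d, s'.reals (3 * n + d + i) = meas I.A (Matrix.vecMulVec x x) i := by
  have hm : ∀ i : Fin d, meas I.A (Matrix.vecMulVec x x) i
      = ∑ j, (∑ k, I.A i j k * x k) * x j := fun i => by
    rw [meas, frob_vecMulVec]
    simp only [Matrix.mulVec, dotProduct]
    exact Finset.sum_congr rfl fun j _ => mul_comm _ _
  simp_rw [hm]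
  refine runs_mapDo (3 * n + d) _ (fun a => a = 3 * n + 2 * d + 4) (by omega) (fun _ => rfl)
    (fun k hk => by omega) fun i s1 f1 hi => ?_
  refine runs_sumDo _ (fun a => a = 3 * n + 2 * d + 4 ∨ a = 3 * n + d + i) (by omega)
    (fun _ => rfl) (congrArg (3 * n + d + ·) hi) (by omega) (Or.inr rfl) fun j s2 f2 hj => ?_
  have hi2 : s2.ints 3 = i := (f2.ints 3 (by omega)).trans hi
  refine (runs_sumExp (fun k => I.A i j k * x k) (fun a => a = 3 * n + 2 * d + 4) (by omega)
    (fun _ => rfl) (α := 3 * n + 2 * d + 4) (fun _ _ => rfl) (by omega) rfl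
    fun k s3 f3 hk => ?_).seq fun s3 h3 => ?_
  · have e1 : s3.ints 3 = i := (f3.ints 3 (by omega)).trans hi2
    have e2 : s3.ints 4 = j := (f3.ints 4 (by omega)).trans hj
    have e3 : s3.reals (n + k) = x k := by
      rw [f3.reals _ (by omega), f2.reals _ (by omega), f1.reals _ (by omega), hx]
    simp only [RExp.eval, NExp.eval, xAddr, e1, e2, hk, e3, entry_eq]
  · obtain ⟨f3, h4⟩ := h3
    have e1 : s3.ints 3 = i := (f3.ints 3 (by omega)).trans hi2
    have e2 : s3.ints 4 = j := (f3.ints 4 (by omega)).trans hj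
    have e3 : s3.reals (n + j) = x j := by
      rw [f3.reals _ (by omega), f2.reals _ (by omega), f1.reals _ (by omega), hx]
    have e4 : s3.reals (3 * n + d + i) = s2.reals (3 * n + d + i) := f3.reals _ (by omega)
    have e5 : (hAddr (.cell 3)).eval I s3 = 3 * n + d + i := congrArg (3 * n + d + ·) e1
    refine runs_setR (by rw [e5]; omega) ?_
    rw [e5]
    refine ⟨(f3.mono le_rfl fun a ha => Or.inl ha).trans (frame_setReal _ _ _ (Or.inr rfl)), ?_⟩
    simp only [Function.update_self, RExp.eval, NExp.eval, e5, scalarAddr, xAddr, e2, e3, e4, h4]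

theorem runs_powerCmd {s : Config} {g : Fin n → ℝ} {X : Matrix (Fin n) (Fin n) ℝ} {δ : ℝ}
    (h1 : 6 ≤ M₁) (h2 : 3 * n + 2 * d + 10 ≤ M₂) (hx : ∀ j : Fin n, s.reals (n + j) = g j)
    (hv : ∀ i : Fin d, s.reals (3 * n + i) = meas I.A X i)
    (hlim : s.reals (3 * n + 2 * d + 3) = Real.log (n / I.p ^ 2) / (2 * relErr d I.c δ)) :
    Runs I tape M₁ M₂ powerCmd s fun s' =>
      Frame 2 (fun a => a = 3 * n + 2 * d + 4 ∨ a = 3 * n + 2 * d + 5 ∨ n ≤ a ∧ a < 3 * n) s s' ∧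
      ∀ j : Fin n, s'.reals (n + j) = powerVec I X δ g j := by
  set S : ℕ → Prop :=
    fun a => a = 3 * n + 2 * d + 4 ∨ a = 3 * n + 2 * d + 5 ∨ n ≤ a ∧ a < 3 * n with hS
  set P : ℕ → Config → Prop := fun k s' => Frame 2 S s s' ∧ s'.ints 2 = k ∧
    ∀ j : Fin n, s'.reals (n + j) = (powerStep (-gradB I.A X))^[k] g j with hP
  refine Runs.seq (P := P 0) (runs_setN (by omega) ?_) fun s1 hs1 => ?_
  · exact ⟨frame_setInt _ _ _ le_rfl, by simp [NExp.eval], hx⟩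
  refine (runs_while (powerCount n d I.p I.c δ) P hs1 ?_ ?_ ?_).mono fun s' h => ⟨h.1, h.2.2⟩
  · rintro k hk s2 ⟨f2, e2, -⟩
    simp only [RExp.eval, NExp.eval, scalarAddr, e2]
    rw [f2.reals _ (by simp only [hS]; omega), hlim]
    -- Comparing the integer counter with the real limit yields exactly `⌈lim⌉` passes, without a
    -- rounding operation.
    exact Nat.lt_ceil.1 hk
  · rintro k hk s2 ⟨f2, e2, h2x⟩
    refine (runs_powerStepCmd (X := X) h1 h2 h2x fun i => ?_).seq fun s3 ⟨f3, h3⟩ => ?_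
    · rw [f2.reals _ (by simp only [hS]; omega), hv]
    · refine runs_setN (by omega) ⟨(f2.trans (f3.mono (by omega) fun _ h => h)).trans
        (frame_setInt _ _ _ le_rfl), ?_, fun j => ?_⟩
      · simp [NExp.eval, f3.ints 2 (by omega), e2]
      · rw [Function.iterate_succ_apply']; exact h3 j
  · rintro s2 ⟨f2, e2, -⟩
    simp only [RExp.eval, NExp.eval, scalarAddr, e2]
    rw [f2.reals _ (by simp only [hS]; omega), hlim]
    exact not_lt.2 (Nat.le_ceil _)

end Program

/-! ### Correctness of one iteration and of the whole program -/

section Program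
variable {n d : ℕ} {I : Input n d} {tape : Bool → ℕ → ℝ} {M₁ M₂ : ℕ}

theorem runs_assign {a : NExp} {e : RExp} {s : Config} (L : ℕ) (S : ℕ → Prop) (α : ℕ) (v : ℝ)
    (ha : a.eval I s = α) (he : e.eval I s = v) (hα : α < M₂) (hS : S α) :
    Runs I tape M₁ M₂ (.setR a e) s fun s' => Frame L S s s' ∧ s'.reals α = v := by
  refine runs_setR (ha ▸ hα) ?_
  rw [ha, he]
  exact ⟨frame_setReal L s v hS, Function.update_self _ _ _⟩

theorem runs_skipCmd {s : Config} (S : ℕ → Prop) (h : 6 ≤ M₁) :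
    Runs I tape M₁ M₂ skipCmd s fun s' => Frame 3 S s s' :=
  runs_setN (by omega) (frame_setInt _ _ _ le_rfl)

theorem runs_limitCmd {s : Config} {t : ℕ} {b : ℝ} (h1 : 6 ≤ M₁)
    (h2 : 3 * n + 2 * d + 10 ≤ M₂) (ht : s.ints 0 = t) (hb : s.reals (3 * n + 2 * d + 0) = b) :
    Runs I tape M₁ M₂ limitCmd s fun s' =>
      Frame 3 (fun a => 3 * n + 2 * d + 1 ≤ a ∧ a ≤ 3 * n + 2 * d + 3) s s' ∧
      s'.reals (3 * n + 2 * d + 1) = I.rule t b ∧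
      s'.reals (3 * n + 2 * d + 3) = Real.log (n / I.p ^ 2) / (2 * relErr d I.c (I.rule t b)) := by
  set S : ℕ → Prop := fun a => 3 * n + 2 * d + 1 ≤ a ∧ a ≤ 3 * n + 2 * d + 3 with hS
  set δ := I.rule t b with hδ
  refine (runs_assign 3 (fun a => a = 3 * n + 2 * d + 1) (3 * n + 2 * d + 1) δ rfl ?_ (by omega)
    rfl).seq fun s1 ⟨f1, e1⟩ => ?_
  · simp only [RExp.eval, NExp.eval, scalarAddr, ht, hb, hδ]
  refine (runs_assign 3 (fun a => a = 3 * n + 2 * d + 2) (3 * n + 2 * d + 2) ((I.c - 2) * d) rfl ?_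
    (by omega) rfl).seq fun s2 ⟨f2, e2⟩ => ?_
  · simp [RExp.eval, NExp.eval]
  have e12 : s2.reals (3 * n + 2 * d + 1) = δ := by rw [f2.reals _ (by omega), e1]
  refine Runs.seq (P := fun s' => Frame 3 (fun a => a = 3 * n + 2 * d + 2) s2 s' ∧
    s'.reals (3 * n + 2 * d + 2) = min δ ((I.c - 2) * d)) (runs_ifLE (fun h => ?_) fun h => ?_)
      fun s3 ⟨f3, e3⟩ => ?_
  · simp only [RExp.eval, NExp.eval, scalarAddr, e12, e2] at h
    rw [min_eq_left h]
    exact runs_assign 3 _ _ _ rfl e12 (by omega) rfl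
  · simp only [RExp.eval, NExp.eval, scalarAddr, e12, e2] at h
    rw [min_eq_right (not_le.1 h).le]
    exact (runs_skipCmd (fun _ => False) h1).mono fun s' f =>
      ⟨f.mono le_rfl fun _ h => h.elim, (f.reals _ id).trans e2⟩
  · refine (runs_assign 3 (fun a => a = 3 * n + 2 * d + 3) (3 * n + 2 * d + 3) _ rfl rfl (by omega)
      rfl).mono fun s4 ⟨f4, e4⟩ => ⟨?_, ?_, ?_⟩
    · refine (((f1.mono le_rfl ?_).trans (f2.mono le_rfl ?_)).trans (f3.mono le_rfl ?_)).trans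
        (f4.mono le_rfl ?_)
      all_goals intro a ha; simp only [hS]; omega
    · rw [f4.reals _ (by omega), f3.reals _ (by omega), e12]
    · rw [e4]
      simp [RExp.eval, NExp.eval, scalarAddr, e3, relErr, sq]

theorem runs_stepCmd {s : Config} {X : Matrix (Fin n) (Fin n) ℝ} {δ : ℝ} {g : Fin n → ℝ}
    (h1 : 6 ≤ M₁) (h2 : 3 * n + 2 * d + 10 ≤ M₂)
    (hv : ∀ i : Fin d, s.reals (3 * n + i) = meas I.A X i)
    (hh : ∀ i : Fin d, s.reals (3 * n + d + i) =
      meas I.A (Matrix.vecMulVec (powerVec I X δ g) (powerVec I X δ g)) i) :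
    Runs I tape M₁ M₂ stepCmd s fun s' =>
      Frame 3 (fun a => a = 3 * n + 2 * d + 6 ∨ a = 3 * n + 2 * d + 8 ∨ a = 3 * n + 2 * d + 9)
        s s' ∧
      s'.reals (3 * n + 2 * d + 6) = (plmo I X δ g).2 ∧
      s'.reals (3 * n + 2 * d + 8) =
        dampedStep (plmo I X δ g).2 (localDist I.A X (plmo I X δ g).1) := by
  set S : ℕ → Prop :=
    fun a => a = 3 * n + 2 * d + 6 ∨ a = 3 * n + 2 * d + 8 ∨ a = 3 * n + 2 * d + 9 with hS
  set H := Matrix.vecMulVec (powerVec I X δ g) (powerVec I X δ g) with hH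
  refine (runs_sumExp (fun i => meas I.A H i / meas I.A X i - meas I.A X i / meas I.A X i)
    (fun a => a = 3 * n + 2 * d + 6) (by omega)
    (fun _ => rfl) (α := 3 * n + 2 * d + 6) (fun _ _ => rfl) (by omega) rfl
    fun i s1 f1 hi => ?_).seq fun s1 ⟨f1, e1⟩ => ?_
  · have e1 : s1.reals (3 * n + i) = meas I.A X i := by rw [f1.reals _ (by omega), hv]
    have e2 : s1.reals (3 * n + d + i) = meas I.A H i := by rw [f1.reals _ (by omega), hh]
    simp only [RExp.eval, NExp.eval, vAddr, hAddr, hi, e1, e2]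
  -- The program subtracts `v i / v i` instead of `1`, so this identity needs no feasibility of `X`:
  -- it also holds where a measurement vanishes.
  have hgap : ∑ i, (meas I.A H i / meas I.A X i - meas I.A X i / meas I.A X i)
      = approxGap I.A X H := by
    rw [approxGap, linObj_eq_sum, linObj_eq_sum, Finset.sum_sub_distrib]; ring
  rw [hgap] at e1
  have f1' : Frame 3 S s s1 := f1.mono le_rfl fun a ha => Or.inl ha
  refine runs_ifLE (fun h => ?_) fun h => ?_
  · simp only [RExp.eval, NExp.eval, scalarAddr, e1, Nat.cast_zero] at h
    have hpl : plmo I X δ g = (H, approxGap I.A X H) := by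
      rw [plmo, if_neg (not_lt.2 h)]
    rw [hpl]
    simp only
    set G := approxGap I.A X H with hG
    set D := localDist I.A X H with hD
    refine (runs_sumExp (fun i => (meas I.A (H - X) i / meas I.A X i) ^ 2)
      (fun a => a = 3 * n + 2 * d + 9) (by omega)
      (fun _ => rfl) (α := 3 * n + 2 * d + 9) (fun _ _ => rfl) (by omega) rfl
      fun i s2 f2 hi => ?_).seq fun s2 ⟨f2, e2⟩ => ?_
    · have e1 : s2.reals (3 * n + i) = meas I.A X i := by
        rw [f2.reals _ (by omega), f1.reals _ (by omega), hv]
      have e2 : s2.reals (3 * n + d + i) = meas I.A H i := by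
        rw [f2.reals _ (by omega), f1.reals _ (by omega), hh]
      have e3 : meas I.A (H - X) i = meas I.A H i - meas I.A X i := frob_sub_right _ _ _
      simp only [RExp.eval, NExp.eval, vAddr, hAddr, hi, e1, e2, e3, sq]
    refine (runs_assign 3 (fun a => a = 3 * n + 2 * d + 9) (3 * n + 2 * d + 9) D rfl ?_ (by omega)
      rfl).seq fun s3 ⟨f3, e3⟩ => ?_
    · simp only [RExp.eval, NExp.eval, scalarAddr, e2, hD, localDist]
    have g3 : s3.reals (3 * n + 2 * d + 6) = G := by
      rw [f3.reals _ (by omega), f2.reals _ (by omega), e1]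
    refine (runs_assign 3 (fun a => a = 3 * n + 2 * d + 8) (3 * n + 2 * d + 8)
      (G / (D * (D + G))) rfl ?_ (by omega) rfl).seq fun s4 ⟨f4, e4⟩ => ?_
    · simp only [RExp.eval, NExp.eval, scalarAddr, e3, g3]
    have f4' : Frame 3 S s s4 := by
      refine ((f1'.trans (f2.mono le_rfl ?_)).trans (f3.mono le_rfl ?_)).trans (f4.mono le_rfl ?_)
      all_goals intro a ha; simp only [hS]; omega
    have g4 : s4.reals (3 * n + 2 * d + 6) = G := by rw [f4.reals _ (by omega), g3]
    refine runs_ifLE (fun h => ?_) fun h => ?_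
    · simp only [RExp.eval, NExp.eval, scalarAddr, e4, Nat.cast_one] at h
      refine (runs_assign 3 (fun a => a = 3 * n + 2 * d + 8) (3 * n + 2 * d + 8) 1 rfl
        (by simp [RExp.eval, NExp.eval]) (by omega) rfl).mono fun s5 ⟨f5, e5⟩ => ⟨?_, ?_, ?_⟩
      · exact f4'.trans (f5.mono le_rfl fun a ha => Or.inr (Or.inl ha))
      · rw [f5.reals _ (by omega), g4]
      · rw [e5, dampedStep, min_eq_right h]
    · simp only [RExp.eval, NExp.eval, scalarAddr, e4, Nat.cast_one] at h
      refine (runs_skipCmd (fun _ => False) h1).mono fun s5 f5 => ⟨?_, ?_, ?_⟩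
      · exact f4'.trans (f5.mono le_rfl fun a ha => ha.elim)
      · rw [f5.reals _ id, g4]
      · rw [f5.reals _ id, e4, dampedStep, min_eq_left (not_le.1 h).le]
  · simp only [RExp.eval, NExp.eval, scalarAddr, e1, Nat.cast_zero, not_le] at h
    have hpl : plmo I X δ g = (X, 0) := by rw [plmo, if_pos h]
    rw [hpl]
    refine (runs_assign 3 (fun a => a = 3 * n + 2 * d + 6) (3 * n + 2 * d + 6) 0 rfl
      (by simp [RExp.eval, NExp.eval]) (by omega) rfl).seq fun s2 ⟨f2, e2⟩ => ?_
    refine (runs_assign 3 (fun a => a = 3 * n + 2 * d + 8) (3 * n + 2 * d + 8) 0 rfl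
      (by simp [RExp.eval, NExp.eval]) (by omega) rfl).mono fun s3 ⟨f3, e3⟩ => ⟨?_, ?_, ?_⟩
    · exact (f1'.trans (f2.mono le_rfl fun a ha => Or.inl ha)).trans
        (f3.mono le_rfl fun a ha => Or.inr (Or.inl ha))
    · rw [f3.reals _ (by omega), e2]
    · rw [e3]; simp [dampedStep]

theorem runs_updateCmd {s : Config} {γ ζ : ℝ} {v h : Fin d → ℝ} {z u : Fin n → ℝ}
    (h1 : 6 ≤ M₁) (h2 : 3 * n + 2 * d + 10 ≤ M₂)
    (hγ : s.reals (3 * n + 2 * d + 8) = γ) (hζ : s.reals (3 * n + 2 * d + 7) = ζ)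
    (hv : ∀ i : Fin d, s.reals (3 * n + i) = v i)
    (hh : ∀ i : Fin d, s.reals (3 * n + d + i) = h i)
    (hz : ∀ j : Fin n, s.reals j = z j) (hu : ∀ j : Fin n, s.reals (n + j) = u j) :
    Runs I tape M₁ M₂ updateCmd s fun s' =>
      Frame 3 (fun a => a < n ∨ 3 * n ≤ a ∧ a < 3 * n + d) s s' ∧
      (∀ i : Fin d, s'.reals (3 * n + i) = (1 - γ) * v i + γ * h i) ∧
      ∀ j : Fin n, s'.reals j = √(1 - γ) * z j + √γ * ζ * u j := by
  refine (runs_mapExp (a := vAddr (.cell 3)) (3 * n) (fun i => (1 - γ) * v i + γ * h i) (by omega)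
    (fun _ => rfl) (by omega) (fun k s' h => congrArg (3 * n + ·) h) fun i s1 f1 hi => ?_).seq
      fun s1 ⟨f1, e1⟩ => ?_
  · have e1 : s1.reals (3 * n + i) = v i := by rw [f1.reals _ (by omega), hv]
    have e2 : s1.reals (3 * n + d + i) = h i := by rw [f1.reals _ (by omega), hh]
    have e3 : s1.reals (3 * n + 2 * d + 8) = γ := by rw [f1.reals _ (by omega), hγ]
    simp only [RExp.eval, NExp.eval, vAddr, hAddr, scalarAddr, hi, e1, e2, e3, Nat.cast_one]
  refine (runs_mapExp (a := .cell 3) 0 (fun j => √(1 - γ) * z j + √γ * ζ * u j) (by omega)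
    (fun _ => rfl) (by omega) (fun k s' h => by simpa [NExp.eval] using h)
    fun j s2 f2 hj => ?_).mono fun s2 ⟨f2, e2⟩ => ⟨?_, fun i => ?_, fun j => ?_⟩
  · have e1 : s2.reals j = z j := by rw [f2.reals _ (by omega), f1.reals _ (by omega), hz]
    have e2 : s2.reals (n + j) = u j := by rw [f2.reals _ (by omega), f1.reals _ (by omega), hu]
    have e3 : s2.reals (3 * n + 2 * d + 8) = γ := by
      rw [f2.reals _ (by omega), f1.reals _ (by omega), hγ]
    have e4 : s2.reals (3 * n + 2 * d + 7) = ζ := by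
      rw [f2.reals _ (by omega), f1.reals _ (by omega), hζ]
    simp only [RExp.eval, NExp.eval, xAddr, scalarAddr, hj, e1, e2, e3, e4, Nat.cast_one]
  · refine (f1.mono le_rfl ?_).trans (f2.mono le_rfl ?_)
    all_goals intro a ha; omega
  · rw [f2.reals _ (by omega), e1]
  · rw [← e2 j, zero_add]

theorem runs_bookkeepingCmd {s : Config} {t k : ℕ} {G δ b : ℝ} (h1 : 6 ≤ M₁)
    (h2 : 3 * n + 2 * d + 10 ≤ M₂) (ht : s.ints 0 = t) (hk : s.ints 1 = k)
    (hG : s.reals (3 * n + 2 * d + 6) = G) (hδ : s.reals (3 * n + 2 * d + 1) = δ)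
    (hb : s.reals (3 * n + 2 * d + 0) = b) :
    Runs I tape M₁ M₂ bookkeepingCmd s fun s' =>
      Frame 0 (fun a => a = 3 * n + 2 * d + 0) s s' ∧ s'.ints 0 = t + 1 ∧
      s'.ints 1 = (if G ≤ I.tol ∧ δ ≤ 3 * I.tol / 2 then k + 1 else k) ∧
      s'.reals (3 * n + 2 * d + 0) = if t = 0 then G else min b G := by
  set S : ℕ → Prop := fun a => a = 3 * n + 2 * d + 0 with hS
  refine Runs.seq (P := fun s' => Frame 0 (fun _ => False) s s' ∧ s'.ints 0 = t ∧
    s'.ints 1 = if G ≤ I.tol ∧ δ ≤ 3 * I.tol / 2 then k + 1 else k) ?_ fun s1 ⟨f1, t1, k1⟩ => ?_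
  · have hcond : ∀ s' : Config, s'.reals = s.reals →
        ((RExp.cell (scalarAddr 6)).eval I s' ≤ RExp.tol.eval I s' ↔ G ≤ I.tol) ∧
        ((RExp.cell (scalarAddr 1)).eval I s' ≤
          (RExp.div (.mul (.ofNat (.const 3)) .tol) (.ofNat (.const 2))).eval I s' ↔
          δ ≤ 3 * I.tol / 2) := fun s' h => by
      simp [RExp.eval, NExp.eval, scalarAddr, h, hδ, hG]
    obtain ⟨c1, c2⟩ := hcond s rfl
    refine runs_ifLE (fun h => runs_ifLE (fun h' => ?_) fun h' => ?_) fun h => ?_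
    · rw [c1] at h
      rw [c2] at h'
      rw [if_pos ⟨h, h'⟩]
      refine runs_setN (by omega) ⟨frame_setInt _ _ _ (by omega), ?_, ?_⟩
      · simp [ht]
      · simp [NExp.eval, hk]
    · rw [c2] at h'
      rw [if_neg fun h => h' h.2]
      exact (runs_skipCmd _ h1).mono fun s' f => ⟨f.mono (by omega) fun _ h => h,
        (f.ints 0 (by omega)).trans ht, (f.ints 1 (by omega)).trans hk⟩
    · rw [c1] at h
      rw [if_neg fun h' => h h'.1]
      exact (runs_skipCmd _ h1).mono fun s' f => ⟨f.mono (by omega) fun _ h => h,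
        (f.ints 0 (by omega)).trans ht, (f.ints 1 (by omega)).trans hk⟩
  have g1 : s1.reals (3 * n + 2 * d + 6) = G := by rw [f1.reals _ id, hG]
  have b1 : s1.reals (3 * n + 2 * d + 0) = b := by rw [f1.reals _ id, hb]
  refine Runs.seq (P := fun s' => Frame 3 S s1 s' ∧
    s'.reals (3 * n + 2 * d + 0) = if t = 0 then G else min b G) ?_ fun s2 ⟨f2, e2⟩ => ?_
  · refine runs_ifLE (fun h => ?_) fun h => ?_
    · simp only [RExp.eval, NExp.eval, t1, Nat.cast_le, Nat.le_zero] at h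
      rw [if_pos h]
      exact runs_assign 3 S _ G rfl g1 (by omega) rfl
    · simp only [RExp.eval, NExp.eval, t1, Nat.cast_le, Nat.le_zero] at h
      rw [if_neg h]
      refine runs_ifLE (fun h => ?_) fun h => ?_
      · simp only [RExp.eval, NExp.eval, scalarAddr, b1, g1] at h
        rw [min_eq_left h]
        exact (runs_skipCmd (fun _ => False) h1).mono fun s' f =>
          ⟨f.mono le_rfl fun _ h => h.elim, (f.reals _ id).trans b1⟩
      · simp only [RExp.eval, NExp.eval, scalarAddr, b1, g1] at h
        rw [min_eq_right (not_le.1 h).le]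
        exact runs_assign 3 S _ G rfl g1 (by omega) rfl
  · refine runs_setN (by omega) ⟨?_, ?_, ?_, ?_⟩
    · exact ((f1.mono le_rfl fun _ h => h.elim).trans (f2.mono (by omega) fun _ h => h)).trans
        (frame_setInt _ _ _ (by omega))
    · simp [NExp.eval, f2.ints 0 (by omega), t1]
    · simp [f2.ints 1 (by omega), k1]
    · exact e2

/-- The contents of the memory before iteration `t`. -/
structure LoopInv (I : Input n d) (ρ ξ : ℕ → ℝ) (t : ℕ) (s : Config) : Prop where
  iter : s.ints 0 = t
  count : s.ints 1 = (states I ρ t).count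
  best : s.reals (3 * n + 2 * d + 0) = (states I ρ t).best
  z : ∀ j : Fin n, s.reals j = gaussIter I ρ ξ t j
  v : ∀ i : Fin d, s.reals (3 * n + i) = meas I.A (states I ρ t).X i
  heads : s.heads = fun b => cond b (n + t) (t * n)

theorem runs_initCmd {ρ ξ : ℕ → ℝ} (h1 : 6 ≤ M₁) (h2 : 3 * n + 2 * d + 10 ≤ M₂) :
    Runs I (fun b => cond b ξ ρ) M₁ M₂ initCmd ⟨fun _ => 0, fun _ => 0, fun _ => 0⟩
      (LoopInv I ρ ξ 0) := by
  refine (runs_drawLoop (a := .cell 3) (m := n) 0 (by omega) (fun _ => rfl) (by omega)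
    (fun k s' h => by simpa [NExp.eval] using h)).seq fun s1 ⟨i1, r1, p1, e1⟩ => ?_
  refine (runs_mapExp (a := .cell 3) 0 (fun j : Fin n => ξ j / √n) (by omega)
    (fun _ => rfl) (by omega) (fun k s' h => by simpa [NExp.eval] using h)
    fun j s2 f2 hj => ?_).seq fun s2 ⟨f2, e2⟩ => ?_
  · have e : s2.reals j = ξ j := by
      have := e1 j
      rw [zero_add] at this
      rw [f2.reals _ (by omega), this]
      simp
    simp only [RExp.eval, NExp.eval, hj, e]
  refine (runs_mapDo (3 * n) (fun i => meas I.A (states I ρ 0).X i) (fun _ => False)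
    (by omega) (fun _ => rfl) (fun _ _ h => h) fun i s3 f3 hi => ?_).mono
      fun s3 ⟨f3', e3⟩ => ?_
  · have hm : meas I.A (states I ρ 0).X i = ∑ j, I.A i j j / n := by
      rw [states, meas, frob_smul_right, frob_one_right, Matrix.trace, Finset.mul_sum]
      exact Finset.sum_congr rfl fun j _ => by rw [div_eq_inv_mul]; rfl
    simp only [hm]
    refine (runs_sumExp (α := 3 * n + i) (fun j => I.A i j j / n) (fun a => a = 3 * n + i)
      (by omega) (fun _ => rfl) (fun s' f => ?_) (by omega) rfl fun j s4 f4 hj => ?_).mono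
        fun s4 ⟨f4, e4⟩ => ⟨f4.mono le_rfl fun a ha => Or.inr ha, e4⟩
    · simp only [vAddr, NExp.eval, (f.ints 3 (by omega)).trans hi]
    · simp only [RExp.eval, NExp.eval, (f4.ints 3 (by omega)).trans hi, hj, entry_eq]
  · have f3 : Frame 3 (fun a => 3 * n ≤ a ∧ a < 3 * n + d) s2 s3 :=
      f3'.mono le_rfl fun a ha => ha.resolve_left id
    have hi : ∀ r < 3, s3.ints r = 0 := fun r hr => by
      rw [f3.ints r hr, f2.ints r hr, i1 r hr]
    refine ⟨hi 0 (by omega), hi 1 (by omega), ?_, fun j => ?_, e3, ?_⟩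
    · rw [f3.reals _ (by omega), f2.reals _ (by omega), r1 _ (by omega)]; rfl
    · have := e2 j
      rw [zero_add] at this
      rw [f3.reals _ (by omega), this]; rfl
    · rw [f3.heads, f2.heads, p1]
      funext b
      cases b <;> simp

theorem runs_iterationCmd {ρ ξ : ℕ → ℝ} {t : ℕ} {s : Config} (h1 : 6 ≤ M₁)
    (h2 : 3 * n + 2 * d + 10 ≤ M₂) (hs : LoopInv I ρ ξ t s) :
    Runs I (fun b => cond b ξ ρ) M₁ M₂ iterationCmd s (LoopInv I ρ ξ (t + 1)) := by
  obtain ⟨ht, hk, hb, hz, hv, hp⟩ := hs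
  set st := states I ρ t with hst
  set δ := st.delta I t with hδ
  set g := startVec n ρ t with hg
  set u := powerVec I st.X δ g with hu
  refine (runs_drawLoop (a := xAddr (.cell 3)) (m := n) n (by omega) (fun _ => rfl) (by omega)
    (fun k s' h => congrArg (n + ·) h)).seq fun s1 ⟨i1, r1, p1, e1⟩ => ?_
  have hx1 : ∀ j : Fin n, s1.reals (n + j) = g j := fun j => by rw [e1 j, hp]; rfl
  refine Runs.seq (P := fun s' => s'.ints = s1.ints ∧
    (∀ a, a ≠ 3 * n + 2 * d + 7 → s'.reals a = s1.reals a) ∧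
    s'.reals (3 * n + 2 * d + 7) = ξ (n + t) ∧
    s'.heads = fun b => bif b then n + (t + 1) else (t + 1) * n)
    (runs_draw (a := scalarAddr 7) (show 3 * n + 2 * d + 7 < M₂ by omega) ⟨rfl, ?_, ?_, ?_⟩)
    fun s2 ⟨i2, r2, e2, p2⟩ => ?_
  · exact fun a ha => Function.update_of_ne ha _ _
  · have : (scalarAddr 7).eval I s1 = 3 * n + 2 * d + 7 := rfl
    rw [this, p1, hp]
    simp
  · simp only [p1, hp]
    funext b
    cases b <;> simp [Nat.succ_mul, add_assoc]
  have hi2 : ∀ r < 3, s2.ints r = s.ints r := fun r hr => by rw [i2, i1 r hr]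
  have hr2 : ∀ a, ¬ (n ≤ a ∧ a < n + n) → a ≠ 3 * n + 2 * d + 7 → s2.reals a = s.reals a :=
    fun a h h' => by rw [r2 a h', r1 a h]
  refine (runs_limitCmd (t := t) (b := st.best) h1 h2 (by rw [hi2 0 (by omega), ht])
    (by rw [hr2 _ (by omega) (by omega), hb])).seq fun s3 ⟨f3, d3, l3⟩ => ?_
  refine (runs_powerCmd (g := g) (X := st.X) (δ := δ) h1 h2 (fun j => ?_) (fun i => ?_) l3).seq
    fun s4 ⟨f4, e4⟩ => ?_
  · rw [f3.reals _ (by omega), r2 _ (by omega), hx1]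
  · rw [f3.reals _ (by omega), hr2 _ (by omega) (by omega), hv]
  refine (runs_quadCmd h1 h2 e4).seq fun s5 ⟨f5, e5⟩ => ?_
  have v5 : ∀ i : Fin d, s5.reals (3 * n + i) = meas I.A st.X i := fun i => by
    rw [f5.reals _ (by omega), f4.reals _ (by omega), f3.reals _ (by omega),
      hr2 _ (by omega) (by omega), hv]
  refine (runs_stepCmd (X := st.X) (δ := δ) (g := g) h1 h2 v5 e5).seq fun s6 ⟨f6, G6, γ6⟩ => ?_
  -- Between the draws and the update, `z`, `v`, `best`, `ζ` and the two integer counters stay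
  -- untouched.
  have f26 : Frame 2 (fun a => n ≤ a ∧ a < 3 * n ∨ 3 * n + d ≤ a ∧ a ≠ 3 * n + 2 * d + 0 ∧
      a ≠ 3 * n + 2 * d + 7) s2 s6 := by
    refine (((f3.mono (by omega) ?_).trans (f4.mono (by omega) ?_)).trans
      (f5.mono (by omega) ?_)).trans (f6.mono (by omega) ?_)
    all_goals intro a ha; omega
  have hstep : dampedStep (plmo I st.X δ g).2 (localDist I.A st.X (plmo I st.X δ g).1)
      = stepAt I ρ t := rfl
  rw [hstep] at γ6
  refine (runs_updateCmd (γ := stepAt I ρ t) (ζ := ξ (n + t)) (v := fun i => meas I.A st.X i)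
    (h := fun i => meas I.A (Matrix.vecMulVec u u) i) (z := gaussIter I ρ ξ t) (u := u)
    h1 h2 γ6 (by rw [f26.reals _ (by omega), e2]) (fun i => ?_) (fun i => ?_) (fun j => ?_)
    fun j => ?_).seq fun s7 ⟨f7, v7, z7⟩ => ?_
  · rw [f6.reals _ (by omega), v5]
  · rw [f6.reals _ (by omega), e5]
  · rw [f26.reals _ (by omega), hr2 _ (by omega) (by omega), hz]
  · rw [f6.reals _ (by omega), f5.reals _ (by omega), e4]
  refine (runs_bookkeepingCmd (t := t) (k := st.count) (G := (plmo I st.X δ g).2) (δ := δ)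
    (b := st.best) h1 h2 ?_ ?_ ?_ ?_ ?_).mono fun s8 ⟨f8, t8, k8, b8⟩ => ?_
  · rw [f7.ints 0 (by omega), f26.ints 0 (by omega), hi2 0 (by omega), ht]
  · rw [f7.ints 1 (by omega), f26.ints 1 (by omega), hi2 1 (by omega), hk]
  · rw [f7.reals _ (by omega), G6]
  · rw [f7.reals _ (by omega), f6.reals _ (by omega), f5.reals _ (by omega),
      f4.reals _ (by omega), d3]; rfl
  · rw [f7.reals _ (by omega), f26.reals _ (by omega), hr2 _ (by omega) (by omega), hb]
  refine ⟨t8, k8, b8, fun j => ?_, fun i => ?_, ?_⟩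
  · rw [f8.reals _ (by omega), z7]; rfl
  -- The memory holds the measurements of `u uᵀ` even if the oracle fell back to `X`; the step size
  -- is zero in that case.
  · rw [f8.reals _ (by omega), v7, states_succ_X, stepAt_smul_oracleAt]
    exact (meas_step _ _ _ _).symm
  · rw [f8.heads, f7.heads, f26.heads, p2]

theorem outputsWithin_methodCmd {ρ ξ : ℕ → ℝ} (hnd : 1 ≤ n + d)
    (hhalt : Stopped I ρ (stopTime I ρ)) :
    OutputsWithin methodCmd I ρ ξ (19 * (n + d)) (finalZ I ρ ξ) := by
  -- The 6 integer cells and the 10 scalars are absorbed by `1 ≤ n + d`: `3 n + 2 d + 16 ≤ 19 (n +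
  -- d)`.
  refine ⟨6, 3 * n + 2 * d + 10, by omega, ?_⟩
  have h : Runs I (fun b => cond b ξ ρ) 6 (3 * n + 2 * d + 10) methodCmd
      ⟨fun _ => 0, fun _ => 0, fun _ => 0⟩ (LoopInv I ρ ξ (stopTime I ρ)) := by
    refine (runs_initCmd le_rfl le_rfl).seq fun s hs => ?_
    refine runs_while (stopTime I ρ) (LoopInv I ρ ξ) hs (fun t ht s hs => ?_)
      (fun t _ s hs => runs_iterationCmd le_rfl le_rfl hs) fun s hs => ?_
    · have hn : ¬ Stopped I ρ t := Nat.notMem_of_lt_sInf (s := {t | Stopped I ρ t}) ht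
      simp only [RExp.eval, NExp.eval, hs.count]
      exact_mod_cast not_le.1 hn
    · simp only [RExp.eval, NExp.eval, hs.count, not_lt]
      exact_mod_cast hhalt
  obtain ⟨s', h1, h2⟩ := h
  exact ⟨s', h1, fun j => h2.z j⟩

end Program

end GMeanSDP

/-! ### Assembly of the main theorem -/

theorem mainTheorem11 :
    -- one program and one constant for all sizes and all inputs
    ∃ (prog : GMeanSDP.Cmd) (C : ℕ),
      ∀ (n d : ℕ) (ε : ℝ) (l : ℕ) (rule : ℕ → ℝ → ℝ),
        0 < ε → 2 * ε / 5 ≤ d → 1 ≤ l →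
        (GMeanSDP.IsScheduled (2 * ε / 5) rule ∨ GMeanSDP.IsAdaptive (2 * ε / 5) rule) →
        ∃ K : ℕ, ∀ (A : Fin d → Matrix (Fin n) (Fin n) ℝ) (p c : ℝ),
          (∀ i, (A i).PosSemidef) → (∀ i, A i ≠ 0) → 0 < p → p < 1 → 2 < c →
          let I : GMeanSDP.Input n d :=
            { A := A, tol := 2 * ε / 5, p := p, c := c, l := l, rule := rule }
          -- the power method implements the oracle
          GMeanSDP.IsPLMO A p (GMeanSDP.plmo I) ∧
          -- for every outcome `ρ` of the power method's randomness ...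
          (∀ ρ : ℕ → ℝ,
            -- ... the method stops after at most `K` iterations
            GMeanSDP.Stopped I ρ (GMeanSDP.stopTime I ρ) ∧ GMeanSDP.stopTime I ρ ≤ K ∧
            GMeanSDP.IsFeasible A (GMeanSDP.finalX I ρ) ∧
            -- ... the program performs it in `O(n + d)` memory
            (∀ ξ : ℕ → ℝ, GMeanSDP.OutputsWithin prog I ρ ξ (C * (n + d))
              (GMeanSDP.finalZ I ρ ξ)) ∧
            -- ... and the output is Gaussian with mean zero and covariance the final iterate
            GMeanSDP.stdStream.map (fun ξ => WithLp.toLp 2 (GMeanSDP.finalZ I ρ ξ)) =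
              ProbabilityTheory.multivariateGaussian 0 (GMeanSDP.finalX I ρ)) ∧
          -- the final iterate is `ε`-optimal with high probability
          ENNReal.ofReal (1 - K.choose l * p ^ l) ≤
            GMeanSDP.stdStream {ρ | GMeanSDP.IsEpsOptimal A ε (GMeanSDP.finalX I ρ)} ∧
          (∀ q : ℝ, K * p ≤ q → ENNReal.ofReal (1 - q ^ l) ≤
            GMeanSDP.stdStream {ρ | GMeanSDP.IsEpsOptimal A ε (GMeanSDP.finalX I ρ)}) := by
  refine ⟨GMeanSDP.methodCmd, 19, fun n d ε l rule hε hd _ hrule => ?_⟩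
  have htol : 0 < 2 * ε / 5 := by positivity
  have hd0 : 0 < d := by
    have : (0 : ℝ) < d := htol.trans_le hd
    exact_mod_cast this
  obtain ⟨T, hT⟩ : ∃ T, GMeanSDP.FewLargeDelta n d (2 * ε / 5) rule T :=
    hrule.elim (fun h => h.fewLargeDelta htol) fun h => ⟨1, h.fewLargeDelta⟩
  have hmeas : ∀ t, Measurable (rule t) := hrule.elim (fun h => h.measurable) fun h => h.1
  have hpos : ∀ t m, 0 ≤ m → 0 < rule t m := by
    rcases hrule with ⟨s, h1, -, h2⟩ | h
    · exact fun t m _ => h2 t m ▸ h1 t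
    · exact h.2.1
  -- `K` is fixed before `A`, `p` and `c` are introduced, which is possible because both iteration
  -- bounds are uniform in them.
  refine ⟨GMeanSDP.numLarge n d (2 * ε / 5) + T + l, fun A p c hA hA0 hp hp1 hc => ?_⟩
  intro I
  -- For `n = 0` every matrix is zero, contradicting `A i ≠ 0` for some `i`, which exists as `d >
  -- 0`.
  have hn : 0 < n := by
    rcases Nat.eq_zero_or_pos n with rfl | h
    · exact absurd (Subsingleton.elim _ _) (hA0 ⟨0, hd0⟩)
    · exact h
  have hI : I.Admissible := ⟨hn, hd0, hA, hA0, hp, hp1, hc, htol, hpos⟩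
  have hprob := GMeanSDP.isEpsOptimal_probability hI hmeas hd hT
  have heq : 5 * I.tol / 2 = ε := by
    change 5 * (2 * ε / 5) / 2 = ε
    ring
  rw [heq] at hprob
  refine ⟨GMeanSDP.isPLMO_plmo hI, fun ρ => ?_, hprob, fun q hq => le_trans ?_ hprob⟩
  · obtain ⟨h1, h2⟩ := GMeanSDP.stopTime_spec hI hT ρ
    exact ⟨h1, h2, (GMeanSDP.feasible_and_best_nonneg hI ρ _).1,
      fun ξ => GMeanSDP.outputsWithin_methodCmd (by omega) h1, GMeanSDP.map_finalZ hI ρ⟩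
  · refine ENNReal.ofReal_le_ofReal (sub_le_sub_left ?_ 1)
    change ((GMeanSDP.numLarge n d (2 * ε / 5) + T + l).choose l : ℝ) * p ^ l ≤ q ^ l
    set K := GMeanSDP.numLarge n d (2 * ε / 5) + T + l
    calc (K.choose l : ℝ) * p ^ l ≤ (K : ℝ) ^ l * p ^ l := by
          refine mul_le_mul_of_nonneg_right ?_ (by positivity)
          exact_mod_cast Nat.choose_le_pow K l
      _ = (K * p) ^ l := (mul_pow _ _ _).symm
      _ ≤ q ^ l := pow_le_pow_left₀ (by positivity) hq l
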